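/- **Setting.** Fix integers $m\ge 1$ (number of factors), $K_0\ge 1$ (true number of groups) and $\bar K\ge K_0$. Consider a sequence of panels whose numbers of units $N$ and of periods $T$ both tend to infinity; all quantities below except $m,K_0,\bar K$ and the named constants and limits may depend on the panel. The data are $$y_{it}=\lambda_i^\top f_t+\epsilon_{it},\quad i\le N,\ t\le T,\qquad \lambda_i=\lambda_{\mathcal G,k}\in\mathbb R^m\ \text{ for } i\in\mathcal G_k,$$ where $\mathcal G=\{\mathcal G_1,\dots,\mathcal G_{K_0}\}$ is a partition of $\{1,\dots,N\}$. Let $y_t=(y_{1t},\dots,y_{Nt})^\top$, $\underline y_i=(y_{i1},\dots,y_{iT})^\top$, $\epsilon_t=(\epsilon_{1t},\dots,\epsilon_{Nt})^\top$, $Y=(y_1,\dots,y_T)^\top$ and $\Lambda=(\lambda_1,\dots,\lambda_N)^\top$. **Estimators.** Let $\widehat K_y=\frac{2}{T(T-1)}\sum_{t<s}\frac{(y_t-y_s)(y_t-y_s)^\top}{\|y_t-y_s\|^2}$. Let the columns of $\widetilde\Lambda=(\tilde\lambda_1,\dots,\tilde\lambda_N)^\top$ be $\sqrt N$ times orthonormal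 eigenvectors of $\widehat K_y$ for its $m$ largest eigenvalues, let $\widehat V$ be the diagonal matrix of these eigenvalues, and let $\widetilde F=(\tilde f_1,\dots,\tilde f_T)^\top=Y\widetilde\Lambda/N$. Run agglomerative hierarchical clustering with complete linkage on the distances $\widehat\Delta_{ij}=\frac1m\|\tilde\lambda_i-\tilde\lambda_j\|_1$: start from $N$ singletons and repeatedly merge two distinct groups $\mathcal A,\mathcal B$ with the smallest $\max_{i\in\mathcal A,j\in\mathcal B}\widehat\Delta_{ij}$; let $\widetilde{\mathcal G}(K)$ be the partition when $K$ groups are left. For a partition $\mathcal P$ of $\{1,\dots,N\}$ let $\widehat\Lambda_{\mathcal P}$ be the $N\times m$ matrix whose $i$-th row is $$\hat\lambda_{i|\mathcal P}=\frac1{|C|}(\widetilde F^\top\widetilde F)^{-1}\widetilde F^\top\sum_{j\in C}\underline y_j,\qquad i\in C\in\mathcal P.$$ Put $S(K)=(NT)^{-1}\sum_{i,t}(y_{it}-\hat\lambda_{i|\widetilde{\mathcal G}(K)}^\top\tilde f_t)^2$ and $IC(K)=\log S(K)+K\rho$ with a deterministic $\rho\in(0,1)$ that may depend on the panel, let $\hat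 K$ be a minimizer of $IC$ over $1\le K\le\bar K$, and let $\widehat\Lambda=\widehat\Lambda_{\widetilde{\mathcal G}(\hat K)}$. The oracle estimator is $\widehat\Lambda^*=\widehat\Lambda_{\mathcal G}$. Choices of eigenvectors, ties in the clustering and ties in the minimization may be resolved in any way. **Assumptions.** 1. $(f_t^\top,\epsilon_t^\top)^\top=\xi_t\begin{pmatrix}I_m&0\\0&A\end{pmatrix}\frac{g_t}{\|g_t\|}$ with a deterministic $N\times N$ matrix $A$, where $(\xi_t,g_t)_{t\le T}$ are i.i.d., $\xi_t>0$ almost surely, $g_t\sim\mathcal N(0,I_{m+N})$ is independent of $\xi_t$, and $\xi_t/\sqrt N=O_p(1)$. With $\Sigma_\epsilon=AA^\top$, the largest diagonal entry of $\begin{pmatrix}I_m&0\\0&\Sigma_\epsilon\end{pmatrix}$ is $1$. 2. $\|\lambda_i\|\le\bar\lambda<\infty$ with a constant $\bar\lambda$, and $\Lambda^\top\Lambda/N\to V$ with $V$ positive definite with distinct eigenvalues. 3. There are constants $c_1,c_2>0$ such that all eigenvalues of $\Sigma_\epsilon$ lie in $[c_2,c_1]$. 4. $T^{-1}\sum_t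 f_tf_t^\top$ converges in probability to a positive definite matrix. 5. There is a constant $M$ such that for all panels the following expectations exist and: (a) $|\mathbb E[\epsilon_{it}\epsilon_{is}]|\le|\tau_{ts}|$ for all $i$ and some $\tau_{ts}$ with $T^{-1}\sum_{t,s}|\tau_{ts}|\le M$; (b) $\sigma_{ij}=\mathbb E[T^{-1}\sum_t\epsilon_{it}\epsilon_{jt}]$ satisfies $|\sigma_{ii}|\le M$ for all $i$ and $N^{-1}\sum_{i,j}|\sigma_{ij}|\le M$. 6. $\mathbb E\big[\frac1N\sum_i\|\frac1{\sqrt T}\sum_t f_t\epsilon_{it}\|^2\big]\le M_1$ for a constant $M_1<\infty$. 7. (a) $\min_k|\mathcal G_k|\ge\tau_1N$ for a constant $\tau_1\in(0,1)$. (b) Let $M_F=\frac{2}{T(T-1)}\sum_{t<s}\frac{(f_t-f_s)(f_t-f_s)^\top}{\|y_t-y_s\|^2}$, $\widehat H=M_F\Lambda^\top\widetilde\Lambda\widehat V^{-1}$ and $\zeta=\min_{k\ne l}\min_{i\in\mathcal G_k,j\in\mathcal G_l}\frac1m\|\widehat H^\top(\lambda_i-\lambda_j)\|_1$ ($\zeta=\infty$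 if $K_0=1$). Then $\min\{\sqrt{\min_k|\mathcal G_k|},\sqrt T\}\cdot\rho\to\infty$, and $\rho/\zeta^2\to0$ and $\max\{\sqrt{N/T},N^{-1/4}\}/\zeta\to0$ in probability. **Theorem.** Under Assumptions 1–7, along the sequence of panels, (a) $P(\hat K=K_0)\to1$; (b) $P(\widehat\Lambda=\widehat\Lambda^*)\to1$. -/

import Mathlib

open MeasureTheory ProbabilityTheory Filter Topology

universe u

noncomputable section

namespace GroupedFactor

/-! ### The factor model with grouped loadings, for one pair `(N, T)` -/

/-- Parameters and sources of randomness of one panel with `N` units, `T` periods, `m` factors and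
`K₀` groups: radial variables `ξ`, Gaussian vectors `g`, the mixing matrix `A` of the errors, the
group `grp i` of unit `i`, and the loading vectors `lamG k` of the groups. The distributional
conditions are imposed in `EllipticalErrors` below. -/
structure Panel (m K₀ : ℕ) where
  N : ℕ
  T : ℕ
  Ω : Type u
  mΩ : MeasurableSpace Ω
  P : Measure Ω
  prob : IsProbabilityMeasure P
  ξ : Fin T → Ω → ℝ
  g : Fin T → Ω → (Fin m ⊕ Fin N → ℝ)
  A : Matrix (Fin N) (Fin N) ℝ
  grp : Fin N → Fin K₀
  lamG : Fin K₀ → Fin m → ℝ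

attribute [instance] Panel.mΩ Panel.prob

/-- The Euclidean norm of a vector of coordinates. -/
def l2norm {ι : Type*} [Fintype ι] (v : ι → ℝ) : ℝ := ‖WithLp.toLp 2 v‖

namespace Panel

variable {m K₀ : ℕ} (D : Panel.{u} m K₀)

/-- `(f_tᵀ, ε_tᵀ)ᵀ = ξ_t · blockdiag(I_m, A) · g_t / ‖g_t‖`. -/
def source (t : Fin D.T) (ω : D.Ω) : Fin m ⊕ Fin D.N → ℝ :=
  (D.ξ t ω / l2norm (D.g t ω)) • (Matrix.fromBlocks 1 0 0 D.A).mulVec (D.g t ω)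

/-- The factor vector `f_t`. -/
def f (t : Fin D.T) (ω : D.Ω) : Fin m → ℝ := fun a => D.source t ω (Sum.inl a)

/-- The idiosyncratic error `ε_{it}`. -/
def eps (i : Fin D.N) (t : Fin D.T) (ω : D.Ω) : ℝ := D.source t ω (Sum.inr i)

/-- The true loading matrix: row `i` is the loading vector of the group of `i`. -/
def Lam : Matrix (Fin D.N) (Fin m) ℝ := Matrix.of fun i => D.lamG (D.grp i)

/-- The data matrix `Y` (`T × N`), `y_{it} = λ_iᵀ f_t + ε_{it}`. -/
def Y (ω : D.Ω) : Matrix (Fin D.T) (Fin D.N) ℝ :=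
  Matrix.of fun t i => D.Lam i ⬝ᵥ D.f t ω + D.eps i t ω

/-- The scatter matrix `Σ_ε = A Aᵀ`. -/
def SigmaEps : Matrix (Fin D.N) (Fin D.N) ℝ := D.A * D.A.transpose

/-- The scatter matrix `Σ₀ = blockdiag(I_m, Σ_ε)`. -/
def Sigma0 : Matrix (Fin m ⊕ Fin D.N) (Fin m ⊕ Fin D.N) ℝ := Matrix.fromBlocks 1 0 0 D.SigmaEps

/-- The true group `𝒢_k`. -/
def group (k : Fin K₀) : Finset (Fin D.N) := Finset.univ.filter fun i => D.grp i = k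

/-- The true group that contains unit `i`. -/
def trueCell (i : Fin D.N) : Finset (Fin D.N) := D.group (D.grp i)

/-- `C_{NT} = min {√(min_k |𝒢_k|), √T}`. -/
def CNT : ℝ := min (Real.sqrt (⨅ k : Fin K₀, ((D.group k).card : ℝ))) (Real.sqrt D.T)

end Panel

/-! ### The estimation procedure, for a `T × N` data matrix -/

section Procedure

variable {m N T : ℕ}

/-- The sample spatial Kendall's tau matrix. -/
def kendall (Y : Matrix (Fin T) (Fin N) ℝ) : Matrix (Fin N) (Fin N) ℝ :=
  (2 / ((T : ℝ) * ((T : ℝ) - 1))) • ∑ t : Fin T, ∑ s ∈ Finset.Ioi t,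
    ((l2norm (Y t - Y s)) ^ 2)⁻¹ • Matrix.vecMulVec (Y t - Y s) (Y t - Y s)

/-- The columns of `L` are `√N` times orthonormal eigenvectors of the symmetric matrix `K`, for its
`m` largest eigenvalues `v 0 ≥ v 1 ≥ …` (with multiplicity). No choice of signs, or of a basis where
eigenvalues coincide, is prescribed. -/
structure IsLeadingEigen (K : Matrix (Fin N) (Fin N) ℝ) (v : Fin m → ℝ)
    (L : Matrix (Fin N) (Fin m) ℝ) : Prop where
  normalized : L.transpose * L = (N : ℝ) • (1 : Matrix (Fin m) (Fin m) ℝ)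
  eigen : K * L = L * Matrix.diagonal v
  descending : Antitone v
  leading : ∀ (x : Fin N → ℝ) (μ : ℝ), x ≠ 0 → K.mulVec x = μ • x →
    L.transpose.mulVec x = 0 → ∀ j, μ ≤ v j

/-- The estimated factors `F̃ = Y Λ̃ / N`. -/
def factorEst (Y : Matrix (Fin T) (Fin N) ℝ) (L : Matrix (Fin N) (Fin m) ℝ) :
    Matrix (Fin T) (Fin m) ℝ := (N : ℝ)⁻¹ • (Y * L)

/-- The distance `Δ̂_{ij} = m⁻¹ ‖λ̃_i - λ̃_j‖₁`. -/
def dist1 (L : Matrix (Fin N) (Fin m) ℝ) (i j : Fin N) : ℝ := (m : ℝ)⁻¹ * ∑ k, |L i k - L j k|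

/-- Complete linkage `max_{i ∈ A, j ∈ B} d i j`. -/
def linkage (d : Fin N → Fin N → ℝ) (A B : Finset (Fin N)) : ℝ :=
  sSup {x | ∃ i ∈ A, ∃ j ∈ B, x = d i j}

/-- `Q` arises from `P` by merging two distinct groups whose linkage distance is smallest. -/
def IsClosestMerge (d : Fin N → Fin N → ℝ)
    (P Q : Finpartition (Finset.univ : Finset (Fin N))) : Prop :=
  ∃ A ∈ P.parts, ∃ B ∈ P.parts, A ≠ B ∧
    (∀ C ∈ P.parts, ∀ E ∈ P.parts, C ≠ E → linkage d A B ≤ linkage d C E) ∧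
    Q.parts = insert (A ∪ B) ((P.parts.erase A).erase B)

/-- `G` is a run of agglomerative hierarchical clustering, `G K` being the partition into `K` groups:
it starts from `N` singletons and merges a closest pair until one group is left. Ties may be broken
in any way. -/
def IsAHCRun (d : Fin N → Fin N → ℝ)
    (G : ℕ → Finpartition (Finset.univ : Finset (Fin N))) : Prop :=
  G N = ⊥ ∧ ∀ K, 1 ≤ K → K < N → IsClosestMerge d (G (K + 1)) (G K)

/-- The grouped loading estimator: row `i` is `|c|⁻¹ (F̃ᵀ F̃)⁻¹ F̃ᵀ ∑_{j ∈ c} y_j`, where `c = cell i`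
is the group of `i` and `y_j = (y_{j1}, …, y_{jT})`. -/
def groupedLoading (Y : Matrix (Fin T) (Fin N) ℝ) (L : Matrix (Fin N) (Fin m) ℝ)
    (cell : Fin N → Finset (Fin N)) : Matrix (Fin N) (Fin m) ℝ :=
  Matrix.of fun i => ((cell i).card : ℝ)⁻¹ •
    (((factorEst Y L).transpose * factorEst Y L)⁻¹ * (factorEst Y L).transpose).mulVec
      (∑ j ∈ cell i, fun t => Y t j)

/-- The goodness of fit `(NT)⁻¹ ∑_{i,t} (y_{it} - λ̂_iᵀ f̃_t)²` of a grouping. -/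
def fitS (Y : Matrix (Fin T) (Fin N) ℝ) (L : Matrix (Fin N) (Fin m) ℝ)
    (cell : Fin N → Finset (Fin N)) : ℝ :=
  ((N : ℝ) * (T : ℝ))⁻¹ * ∑ i, ∑ t,
    (Y t i - groupedLoading Y L cell i ⬝ᵥ factorEst Y L t) ^ 2

/-- The information criterion `IC(K) = log S(K) + K ρ` along the partitions `G`. -/
def infoCrit (Y : Matrix (Fin T) (Fin N) ℝ) (L : Matrix (Fin N) (Fin m) ℝ)
    (G : ℕ → Finpartition (Finset.univ : Finset (Fin N))) (ρ : ℝ) (K : ℕ) : ℝ :=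
  Real.log (fitS Y L (G K).part) + K * ρ

/-- `L, v, G, Khat` is an output of the whole procedure on the data `Y`: loadings and eigenvalues from
Kendall's tau, a clustering run on the loadings, and a minimizer of the information criterion over
`1 ≤ K ≤ Kbar`. -/
structure IsOutput (Kbar : ℕ) (ρ : ℝ) (Y : Matrix (Fin T) (Fin N) ℝ)
    (L : Matrix (Fin N) (Fin m) ℝ) (v : Fin m → ℝ)
    (G : ℕ → Finpartition (Finset.univ : Finset (Fin N))) (Khat : ℕ) : Prop where
  eigen : IsLeadingEigen (kendall Y) v L
  ahc : IsAHCRun (dist1 L) G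
  range : 1 ≤ Khat ∧ Khat ≤ Kbar
  minimizes : ∀ K, 1 ≤ K → K ≤ Kbar → infoCrit Y L G ρ Khat ≤ infoCrit Y L G ρ K

end Procedure

/-! ### The rotation matrix and the signal strength -/

namespace Panel

variable {m K₀ : ℕ} (D : Panel.{u} m K₀)

/-- `M₁ = 2/(T(T-1)) ∑_{t<s} (f_t - f_s)(f_t - f_s)ᵀ / ‖y_t - y_s‖²`. -/
def M1 (ω : D.Ω) : Matrix (Fin m) (Fin m) ℝ :=
  (2 / ((D.T : ℝ) * ((D.T : ℝ) - 1))) • ∑ t : Fin D.T, ∑ s ∈ Finset.Ioi t,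
    ((l2norm (D.Y ω t - D.Y ω s)) ^ 2)⁻¹ •
      Matrix.vecMulVec (D.f t ω - D.f s ω) (D.f t ω - D.f s ω)

/-- `Ĥ = M₁ Λᵀ Λ̃ V̂⁻¹`, with `V̂` the diagonal matrix of the leading eigenvalues `v`. -/
def Hhat (L : Matrix (Fin D.N) (Fin m) ℝ) (v : Fin m → ℝ) (ω : D.Ω) : Matrix (Fin m) (Fin m) ℝ :=
  D.M1 ω * D.Lam.transpose * L * (Matrix.diagonal v)⁻¹

/-- `Δ_{ij} = m⁻¹ ‖Ĥᵀ (λ_i - λ_j)‖₁`. -/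
def Delta (L : Matrix (Fin D.N) (Fin m) ℝ) (v : Fin m → ℝ) (ω : D.Ω) (i j : Fin D.N) : ℝ :=
  (m : ℝ)⁻¹ * ∑ k, |((D.Hhat L v ω).transpose.mulVec (D.Lam i - D.Lam j)) k|

/-- `ζ`, the smallest `Δ_{ij}` over units `i, j` of different groups (`∞` if there is one group). -/
def zeta (L : Matrix (Fin D.N) (Fin m) ℝ) (v : Fin m → ℝ) (ω : D.Ω) : ENNReal :=
  ⨅ (i : Fin D.N) (j : Fin D.N) (_ : D.grp i ≠ D.grp j), ENNReal.ofReal (D.Delta L v ω i j)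

end Panel

/-! ### The assumptions, along a sequence of panels -/

section Assumptions

variable {m K₀ : ℕ}

/-- The pairs `(ξ_t, g_t)` are independent over `t`, with `ξ_t` (positive, of a law that does not
depend on `t`) independent of the standard Gaussian vector `g_t`; `ξ/√N = O_p(1)`; and
`‖diag Σ₀‖_∞ = 1` (the norm on a function type is the maximum norm). -/
structure EllipticalErrors (D : ℕ → Panel.{u} m K₀) : Prop where
  law : ∀ n, ∃ ν : Measure ℝ, IsProbabilityMeasure ν ∧ ∀ t,
    HasLaw (fun ω => ((D n).ξ t ω, (D n).g t ω))
      (ν.prod (Measure.pi fun _ : Fin m ⊕ Fin (D n).N => gaussianReal 0 1)) (D n).P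
  indep : ∀ n, iIndepFun (fun t ω => ((D n).ξ t ω, (D n).g t ω)) (D n).P
  pos : ∀ n t, ∀ᵐ ω ∂(D n).P, 0 < (D n).ξ t ω
  tight : ∀ η : ℝ, 0 < η → ∃ C : ℝ, ∀ᶠ n in atTop, ∀ t,
    (D n).P.real {ω | C < |(D n).ξ t ω / Real.sqrt (D n).N|} ≤ η
  scale : ∀ n, ‖(D n).Sigma0.diag‖ = 1

/-- Bounded loadings, and `Λᵀ Λ / N → V` for a positive definite `V` with distinct eigenvalues. -/
structure PervasiveLoadings (D : ℕ → Panel.{u} m K₀) : Prop where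
  bounded : ∃ B : ℝ, ∀ n i, l2norm ((D n).Lam i) ≤ B
  limit : ∃ (V : Matrix (Fin m) (Fin m) ℝ) (hV : V.PosDef),
    Function.Injective hV.isHermitian.eigenvalues ∧
    (∃ c₁ c₂ : ℝ, 0 < c₁ ∧ 0 < c₂ ∧ ∀ j, c₂ ≤ hV.isHermitian.eigenvalues j ∧
      hV.isHermitian.eigenvalues j ≤ c₁) ∧
    Tendsto (fun n => ((D n).N : ℝ)⁻¹ • ((D n).Lam.transpose * (D n).Lam)) atTop (𝓝 V)

/-- The eigenvalues of `Σ_ε` are bounded away from `0` and `∞`. -/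
def BoundedErrorSpectrum (D : ℕ → Panel.{u} m K₀) : Prop :=
  ∃ c₁ c₂ : ℝ, 0 < c₁ ∧ 0 < c₂ ∧ ∀ n, ∀ μ ∈ spectrum ℝ (D n).SigmaEps, c₂ ≤ μ ∧ μ ≤ c₁

/-- `T⁻¹ ∑_t f_t f_tᵀ` converges in probability to a positive definite matrix. -/
def FactorSecondMoment (D : ℕ → Panel.{u} m K₀) : Prop :=
  ∃ S : Matrix (Fin m) (Fin m) ℝ, S.PosDef ∧ ∀ a b, ∀ η : ℝ, 0 < η →
    Tendsto (fun n => (D n).P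
      {ω | η ≤ |((D n).T : ℝ)⁻¹ * ∑ t, (D n).f t ω a * (D n).f t ω b - S a b|}) atTop (𝓝 0)

/-- Limited temporal and cross-sectional dependence of the errors, with one constant `M` for all
panels. -/
def WeakErrorDependence (D : ℕ → Panel.{u} m K₀) : Prop :=
  ∃ M : ℝ, 0 < M ∧ ∀ n,
    ((∀ i t s, Integrable (fun ω => (D n).eps i t ω * (D n).eps i s ω) (D n).P) ∧
      ∃ τ : Fin (D n).T → Fin (D n).T → ℝ,
        (∀ i t s, |∫ ω, (D n).eps i t ω * (D n).eps i s ω ∂(D n).P| ≤ |τ t s|) ∧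
        ((D n).T : ℝ)⁻¹ * ∑ t, ∑ s, |τ t s| ≤ M) ∧
    ((∀ i j, Integrable
        (fun ω => ((D n).T : ℝ)⁻¹ * ∑ t, (D n).eps i t ω * (D n).eps j t ω) (D n).P) ∧
      ∃ σ : Fin (D n).N → Fin (D n).N → ℝ,
        (∀ i j, ∫ ω, ((D n).T : ℝ)⁻¹ * ∑ t, (D n).eps i t ω * (D n).eps j t ω ∂(D n).P = σ i j) ∧
        (∀ i, |σ i i| ≤ M) ∧ ((D n).N : ℝ)⁻¹ * ∑ i, ∑ j, |σ i j| ≤ M)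

/-- `N⁻¹ ∑_i ‖T^{-1/2} ∑_t f_t ε_{it}‖²`. -/
def Panel.crossMoment (D : Panel.{u} m K₀) (ω : D.Ω) : ℝ :=
  (D.N : ℝ)⁻¹ * ∑ i, (l2norm ((Real.sqrt D.T)⁻¹ • ∑ t, D.eps i t ω • D.f t ω)) ^ 2

/-- Weak dependence between factors and errors. -/
def WeakFactorErrorDependence (D : ℕ → Panel.{u} m K₀) : Prop :=
  ∃ M₁ : ℝ, 0 < M₁ ∧ ∀ n, Integrable (D n).crossMoment (D n).P ∧
    ∫ ω, (D n).crossMoment ω ∂(D n).P ≤ M₁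

/-- All groups have a size of order `N`. -/
def GroupSizes (D : ℕ → Panel.{u} m K₀) : Prop :=
  ∃ τ₁ : ℝ, 0 < τ₁ ∧ τ₁ < 1 ∧ ∀ n k, τ₁ * (D n).N ≤ ((D n).group k).card

/-- Rates of the tuning parameter `ρ` and of the signal strength `ζ`. As `ζ` is random, `a/ζ → 0` is
convergence in probability, written `P(ε ζ < a) → 0` for every `ε > 0`. -/
structure TuningRates (D : ℕ → Panel.{u} m K₀) (ρ : ℕ → ℝ)
    (L : ∀ n, (D n).Ω → Matrix (Fin (D n).N) (Fin m) ℝ) (v : ∀ n, (D n).Ω → Fin m → ℝ) : Prop where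
  range : ∀ n, 0 < ρ n ∧ ρ n < 1
  large : Tendsto (fun n => (D n).CNT * ρ n) atTop atTop
  small : ∀ η : ℝ, 0 < η → Tendsto (fun n => (D n).P
    {ω | ENNReal.ofReal η * (D n).zeta (L n ω) (v n ω) ω ^ 2 < ENNReal.ofReal (ρ n)}) atTop (𝓝 0)
  signal : ∀ η : ℝ, 0 < η → Tendsto (fun n => (D n).P
    {ω | ENNReal.ofReal η * (D n).zeta (L n ω) (v n ω) ω <
      ENNReal.ofReal (max (Real.sqrt ((D n).N / (D n).T)) (((D n).N : ℝ) ^ (-(1 / 4) : ℝ)))})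
    atTop (𝓝 0)

/-- The events `E n` hold with probability tending to one. This is stated for the complements, so
that it is also meaningful (through outer measures) without measurability of `E n`. -/
def ProbTendsToOne (D : ℕ → Panel.{u} m K₀) (E : ∀ n, Set (D n).Ω) : Prop :=
  Tendsto (fun n => (D n).P (E n)ᶜ) atTop (𝓝 0)

end Assumptions

theorem ProbTendsToOne.tendsto_one {m K₀ : ℕ} {D : ℕ → Panel.{u} m K₀} {E : ∀ n, Set (D n).Ω}
    (h : ProbTendsToOne D E) : Tendsto (fun n => (D n).P (E n)) atTop (𝓝 1) := by
  have h1 : Tendsto (fun n => 1 - (D n).P (E n)ᶜ) atTop (𝓝 (1 - 0)) :=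
    ENNReal.Tendsto.sub tendsto_const_nhds h (Or.inl ENNReal.one_ne_top)
  rw [tsub_zero] at h1
  refine tendsto_of_tendsto_of_tendsto_of_le_of_le h1 tendsto_const_nhds (fun n => ?_)
    (fun n => prob_le_one)
  have h2 : (1 : ENNReal) ≤ (D n).P (E n) + (D n).P (E n)ᶜ := by
    have h3 := measure_union_le (μ := (D n).P) (E n) (E n)ᶜ
    rwa [Set.union_compl_self, measure_univ] at h3
  exact tsub_le_iff_right.mpr h2

end GroupedFactor

end

/-! The sample Kendall's tau matrix is an average of products of normalized differences of data. A
difference of two independent spherical vectors is again spherical, so the mean of a nonnegative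
function of its direction that vanishes at the origin is the Gaussian mean times the mass off the
origin, and that mass is at least 1/2. Everything about the matrix thus reduces to Gaussian ratios
`⟪p, x⟫ ⟪q, x⟫ / ∑ i, ⟪b i, x⟫ ^ 2`. These are of order `‖p‖ ‖q‖ / N`, because the denominator
divided by `N` has a bounded inverse fourth moment. No moment of the radius enters at this stage.

With the model inserted, the matrix is `Λ M₁ Λᵀ + Λ M₂ᵀ + M₂ Λᵀ + M₃`. The parts `M₂` and `M₃` are
split into means and deviations. Deviations are U-statistics of order two, with a relative variance
of order `1/T`. The mean of `M₃` applied to a vector `y` has entries of order `‖y‖ / N`. The mean of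
`M₂` has entries of order `N^(-3/2)` rather than `1/N`, because negating the factors flips the sign
of the numerator and changes the denominator only by a cross term. On the column space of `Λ` the
quadratic form of the matrix is bounded below, so the `m` leading eigenvalues stay away from zero.
Dividing the eigenvector equation by them bounds `Λ̃ - Λ Ĥ` entrywise by a multiple of `√(N/T) +
1/√N`, and in Frobenius norm by a multiple of `√N √r` with `r = 1/N + 1/T`. The signal `ζ` dominates
the entrywise bound, so all within-group distances lie below all between-group distances. Complete
linkage then returns the true grouping at `K₀` clusters and joins entire groups below `K₀`
(`IsAHCRun.part_eq_group`, `IsAHCRun.exists_merged`).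

The fit of a grouping is the residual of projecting `Y` on the estimated factors, common to all
groupings, plus the projected variation left after averaging within cells (`fitS_decomp`). For the
true grouping the second term contains only projected errors and is of order `r`, so no other
grouping fits better by more than that. Since `r` is negligible against `ρ`, a choice `K > K₀`
loses. A choice `K < K₀` merges two groups and raises the fit by a multiple of `‖λ_i - λ_j‖²`, which
dominates `ζ²` and hence `ρ` (`RegularFit.infoCrit_lt`).

Passing to logarithms needs a lower bound for the fit, hence for `‖E‖`. Factors and errors share the
radius, and the factors have a nondegenerate second moment. Cauchy-Schwarz turns this into `‖F‖⁴ N ≤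
T · factorSize · ‖E‖²`, where `factorSize` has bounded mean. All these arguments are deterministic
on an event given by a level `Q`. Markov's inequality bounds its failure by `C/Q` plus terms that
vanish with `n`, and `Q` is arbitrary. On the event `K̂ = K₀` and the cells agree, which gives both
claims. -/

noncomputable section

namespace GroupedFactor

/-! ### Spherical laws and functions of the direction -/

section Spherical

open scoped RealInnerProductSpace ENNReal

variable {E : Type*} [NormedAddCommGroup E] [InnerProductSpace ℝ E] [FiniteDimensional ℝ E]
  [MeasurableSpace E] [BorelSpace E]

/-- A measure that is invariant under all linear isometries. -/
def IsSpherical (μ : Measure E) : Prop := ∀ φ : E ≃ₗᵢ[ℝ] E, μ.map φ = μ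

theorem isSpherical_stdGaussian : IsSpherical (stdGaussian E) := fun φ => stdGaussian_map φ

/-- The reflection in the hyperplane orthogonal to `s - t` exchanges `s` and `t` when their norms
agree, and it preserves the measure. -/
theorem IsSpherical.charFun_eq {μ : Measure E} (hμ : IsSpherical μ) {s t : E} (h : ‖s‖ = ‖t‖) :
    charFun μ s = charFun μ t := by
  set φ : E ≃ₗᵢ[ℝ] E := (Submodule.span ℝ {s - t})ᗮ.reflection with hφ
  have hst : φ s = t := Submodule.reflection_sub h
  rw [charFun_apply, charFun_apply]
  conv_rhs => rw [← hμ φ]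
  rw [integral_map (by fun_prop) (Measurable.aestronglyMeasurable (by fun_prop))]
  simp_rw [← hst, LinearIsometryEquiv.inner_map_map]

/-- Uniqueness of the uniform law on the sphere without constructing it. As `charFun σ₁ t` depends
only on `‖t‖`, it may be averaged over `‖t‖ • x` with `x` drawn from `σ₂`. The resulting double
integral is symmetric in the two measures, and Fubini identifies it with `charFun σ₂ t`. -/
theorem IsSpherical.eq_of_norm_eq_one {σ₁ σ₂ : Measure E} [IsProbabilityMeasure σ₁]
    [IsProbabilityMeasure σ₂] (h₁ : IsSpherical σ₁) (h₂ : IsSpherical σ₂)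
    (u₁ : ∀ᵐ x ∂σ₁, ‖x‖ = 1) (u₂ : ∀ᵐ x ∂σ₂, ‖x‖ = 1) : σ₁ = σ₂ := by
  refine Measure.ext_of_charFun (funext fun t => ?_)
  have e₁ : charFun σ₁ t = ∫ x, ∫ y, Complex.exp (⟪y, ‖t‖ • x⟫ * Complex.I) ∂σ₁ ∂σ₂ := by
    rw [integral_congr_ae (g := fun _ => charFun σ₁ t)]
    · simp
    · filter_upwards [u₂] with x hx
      exact h₁.charFun_eq (by simp [norm_smul, hx])
  have e₂ : charFun σ₂ t = ∫ y, ∫ x, Complex.exp (⟪x, ‖t‖ • y⟫ * Complex.I) ∂σ₂ ∂σ₁ := by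
    rw [integral_congr_ae (g := fun _ => charFun σ₂ t)]
    · simp
    · filter_upwards [u₁] with x hx
      exact h₂.charFun_eq (by simp [norm_smul, hx])
  rw [e₁, e₂, integral_integral_swap]
  · simp_rw [real_inner_smul_right, real_inner_comm]
  · refine Integrable.of_bound (C := 1) (Measurable.aestronglyMeasurable (by fun_prop)) ?_
    exact Eventually.of_forall fun p => by simp [Function.uncurry, Complex.norm_exp_ofReal_mul_I]

theorem IsSpherical.cond_compl_zero {μ : Measure E} (hμ : IsSpherical μ) :
    IsSpherical (μ[|({0}ᶜ : Set E)]) := by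
  intro φ
  have h0 : φ ⁻¹' ({0}ᶜ : Set E) = {0}ᶜ := by ext x; simp
  have := Measure.restrict_map (μ := μ) (f := φ) (by fun_prop)
    (measurableSet_singleton (0 : E)).compl
  rw [hμ φ, h0] at this
  rw [ProbabilityTheory.cond, Measure.map_smul, ← this]

theorem IsSpherical.map_normalize {μ : Measure E} (hμ : IsSpherical μ) :
    IsSpherical (μ.map fun x => ‖x‖⁻¹ • x) := by
  intro φ
  have hm : Measurable fun x : E => ‖x‖⁻¹ • x := by fun_prop
  rw [Measure.map_map (by fun_prop) hm]
  have : (φ ∘ fun x : E => ‖x‖⁻¹ • x) = (fun x : E => ‖x‖⁻¹ • x) ∘ φ := by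
    ext x; simp
  rw [this, ← Measure.map_map hm (by fun_prop), hμ φ]

/-- Conditioned off the origin and normalized, both laws are spherical on the unit sphere, hence
equal. The function sees only the direction and vanishes at the origin, so the mass of `μ` off the
origin is the only difference. -/
theorem IsSpherical.lintegral_eq {μ γ : Measure E} [IsProbabilityMeasure μ]
    [IsProbabilityMeasure γ] (hμ : IsSpherical μ) (hγ : IsSpherical γ) (hγ0 : γ {0} = 0)
    {h : E → ℝ≥0∞} (hm : Measurable h) (hh : ∀ c : ℝ, 0 < c → ∀ x, h (c • x) = h x)
    (h0 : h 0 = 0) : ∫⁻ x, h x ∂μ = μ {0}ᶜ * ∫⁻ x, h x ∂γ := by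
  have hs : MeasurableSet ({0}ᶜ : Set E) := (measurableSet_singleton (0 : E)).compl
  have hN : Measurable fun x : E => ‖x‖⁻¹ • x := by fun_prop
  have e₁ : ∫⁻ x, h x ∂μ = ∫⁻ x in ({0}ᶜ : Set E), h x ∂μ := by
    have hz : ∫⁻ x in ({0} : Set E), h x ∂μ = 0 := by
      refine (setLIntegral_congr_fun (measurableSet_singleton 0) (g := 0) ?_).trans (by simp)
      intro x hx; rw [Set.mem_singleton_iff.1 hx, h0]; rfl
    rw [← lintegral_add_compl h hs, compl_compl, hz, add_zero]
  by_cases hp : μ ({0}ᶜ : Set E) = 0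
  · rw [e₁, hp, zero_mul, Measure.restrict_eq_zero.2 hp, lintegral_zero_measure]
  have := cond_isProbabilityMeasure hp
  have hnorm : ∀ {ν : Measure E}, ν {0} = 0 → ∀ᵐ x ∂(ν.map fun x => ‖x‖⁻¹ • x), ‖x‖ = 1 := by
    intro ν hν
    rw [ae_map_iff hN.aemeasurable (measurableSet_eq_fun (by fun_prop) (by fun_prop))]
    have : ∀ᵐ x ∂ν, x ≠ 0 := by rw [ae_iff]; simpa using hν
    filter_upwards [this] with x hx
    rw [norm_smul, norm_inv, norm_norm, inv_mul_cancel₀ (norm_ne_zero_iff.2 hx)]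
  have hc0 : (μ[|({0}ᶜ : Set E)]) {0} = 0 := by
    rw [cond_apply hs]; simp
  have key : (μ[|({0}ᶜ : Set E)]).map (fun x => ‖x‖⁻¹ • x) = γ.map (fun x => ‖x‖⁻¹ • x) :=
    have := Measure.isProbabilityMeasure_map (μ := μ[|({0}ᶜ : Set E)]) hN.aemeasurable
    have := Measure.isProbabilityMeasure_map (μ := γ) hN.aemeasurable
    hμ.cond_compl_zero.map_normalize.eq_of_norm_eq_one hγ.map_normalize (hnorm hc0) (hnorm hγ0)
  have hhN : ∀ x, h (‖x‖⁻¹ • x) = h x := by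
    intro x
    by_cases hx : x = 0
    · simp [hx]
    · exact hh _ (inv_pos.2 (norm_pos_iff.2 hx)) x
  have hl : ∀ ν : Measure E, ∫⁻ x, h x ∂(ν.map fun x => ‖x‖⁻¹ • x) = ∫⁻ x, h x ∂ν := by
    intro ν; rw [lintegral_map hm hN]; simp_rw [hhN]
  rw [e₁, ← hl γ, ← key, hl, ProbabilityTheory.cond, lintegral_smul_measure, smul_eq_mul,
    ← mul_assoc, ENNReal.mul_inv_cancel hp (measure_ne_top _ _), one_mul]

/-- Under a spherical law, the mean of a nonnegative function of the direction is at most the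
Gaussian mean, with equality up to the mass of the origin. -/
theorem IsSpherical.integrable_and_le {μ γ : Measure E} [IsProbabilityMeasure μ]
    [IsProbabilityMeasure γ] (hμ : IsSpherical μ) (hγ : IsSpherical γ) (hγ0 : γ {0} = 0)
    {h : E → ℝ} (hm : Measurable h) (hh : ∀ c : ℝ, 0 < c → ∀ x, h (c • x) = h x)
    (h0 : h 0 = 0) (hpos : ∀ x, 0 ≤ h x) (hi : Integrable h γ) :
    Integrable h μ ∧ ∫ x, h x ∂μ = μ.real {0}ᶜ * ∫ x, h x ∂γ := by
  have e := hμ.lintegral_eq hγ hγ0 (h := fun x => ENNReal.ofReal (h x)) hm.ennreal_ofReal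
    (fun c hc x => by rw [hh c hc]) (by simp [h0])
  constructor
  · refine ⟨hm.aestronglyMeasurable, ?_⟩
    rw [hasFiniteIntegral_iff_ofReal (Eventually.of_forall hpos), e]
    exact ENNReal.mul_lt_top (measure_lt_top _ _)
      ((hasFiniteIntegral_iff_ofReal (Eventually.of_forall hpos)).1 hi.2)
  · rw [integral_eq_lintegral_of_nonneg_ae (Eventually.of_forall hpos) hm.aestronglyMeasurable,
      integral_eq_lintegral_of_nonneg_ae (Eventually.of_forall hpos) hm.aestronglyMeasurable, e,
      ENNReal.toReal_mul]; rfl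

end Spherical

end GroupedFactor

namespace GroupedFactor

/-! ### Moments of ratios of Gaussian forms -/

section GaussianMoments

set_option linter.unusedSectionVars false

open scoped RealInnerProductSpace ENNReal

theorem integrable_abs_rpow_gaussianReal {s : ℝ} (hs : -1 < s) :
    Integrable (fun x : ℝ => |x| ^ s) (gaussianReal 0 1) := by
  have h0 : IntegrableOn (fun x : ℝ => |x| ^ s * Real.exp (-(1 / 2) * x ^ 2)) (Set.Ioi 0) :=
    (integrableOn_rpow_mul_exp_neg_mul_sq (b := 1 / 2) (by norm_num) hs).congr_fun
      (fun x hx => by simp only [abs_of_pos (Set.mem_Ioi.1 hx)]) measurableSet_Ioi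
  have h1 : Integrable (fun x : ℝ => |x| ^ s * Real.exp (-(1 / 2) * x ^ 2)) := by
    rw [← integrableOn_univ, ← @Set.Iio_union_Ici _ _ (0 : ℝ), integrableOn_union,
      integrableOn_Ici_iff_integrableOn_Ioi]
    refine ⟨?_, h0⟩
    rw [← (Measure.measurePreserving_neg (volume : Measure ℝ)).integrableOn_comp_preimage
      (Homeomorph.neg ℝ).measurableEmbedding]
    simpa [Function.comp_def] using h0
  rw [gaussianReal_of_var_ne_zero _ one_ne_zero,
    integrable_withDensity_iff_integrable_smul' (measurable_gaussianPDF 0 1)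
      (Eventually.of_forall fun x => gaussianPDF_lt_top)]
  refine (h1.const_mul (√(2 * Real.pi))⁻¹).congr (Eventually.of_forall fun x => ?_)
  simp only [toReal_gaussianPDF, gaussianPDFReal, smul_eq_mul, NNReal.coe_one, mul_one, sub_zero]
  rw [mul_comm (|x| ^ s), ← mul_assoc]
  congr 3
  ring

/-- The moment of order `-8/9` of a standard Gaussian variable. -/
def invMoment : ℝ := ∫ x : ℝ, |x| ^ (-(8 / 9) : ℝ) ∂gaussianReal 0 1

theorem invMoment_nonneg : 0 ≤ invMoment :=
  integral_nonneg fun _ => Real.rpow_nonneg (abs_nonneg _) _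

/-- Jensen for the concave power `9/n` compares the moment of order `-8/n` with the one of order
`-8/9`; the `n`-th power then no longer depends on `n`. The threshold 9 is the least `n` for which
the exponent `-8/n` exceeds `-1`. -/
theorem integral_abs_rpow_pow_le {n : ℕ} (hn : 9 ≤ n) :
    (∫ x : ℝ, |x| ^ (-(8 / n) : ℝ) ∂gaussianReal 0 1) ^ n ≤ invMoment ^ 9 := by
  have hn0 : (0 : ℝ) < n := by exact_mod_cast (by omega : 0 < n)
  have hn9 : (9 : ℝ) ≤ n := by exact_mod_cast hn
  have hr1 : (9 : ℝ) / n ≤ 1 := (div_le_one hn0).2 hn9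
  have hr0 : (0 : ℝ) ≤ 9 / n := by positivity
  have hpow : ∀ x : ℝ, |x| ^ (-(8 / n) : ℝ) = (|x| ^ (-(8 / 9) : ℝ)) ^ (9 / n : ℝ) := by
    intro x
    rw [← Real.rpow_mul (abs_nonneg x)]
    congr 1
    field_simp
  have hi : Integrable (fun x : ℝ => |x| ^ (-(8 / n) : ℝ)) (gaussianReal 0 1) := by
    refine integrable_abs_rpow_gaussianReal ?_
    have : 8 / (n : ℝ) ≤ 8 / 9 := by gcongr
    linarith
  have hJ : ∫ x : ℝ, |x| ^ (-(8 / n) : ℝ) ∂gaussianReal 0 1 ≤ invMoment ^ (9 / n : ℝ) := by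
    have := (Real.concaveOn_rpow hr0 hr1).le_map_integral (μ := gaussianReal 0 1)
      (f := fun x : ℝ => |x| ^ (-(8 / 9) : ℝ))
      (Real.continuous_rpow_const hr0).continuousOn isClosed_Ici
      (Eventually.of_forall fun x => Real.rpow_nonneg (abs_nonneg _) _)
      (integrable_abs_rpow_gaussianReal (by norm_num))
      (hi.congr (Eventually.of_forall hpow))
    simpa only [hpow, invMoment] using this
  calc _ ≤ (invMoment ^ (9 / n : ℝ)) ^ n :=
        pow_le_pow_left₀ (integral_nonneg fun _ => Real.rpow_nonneg (abs_nonneg _) _) hJ n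
    _ = invMoment ^ 9 := by
        rw [← Real.rpow_natCast, ← Real.rpow_mul invMoment_nonneg, div_mul_cancel₀ _ hn0.ne']
        norm_cast

/-- The inequality of arithmetic and geometric means: an inverse mean square is at most a product
over coordinates, and a product factorizes under a product measure. -/
theorem pow_four_card_div_sum_sq_le {n : ℕ} (hn : 0 < n) {x : Fin n → ℝ} (hx : ∀ j, x j ≠ 0) :
    (n / ∑ j, x j ^ 2) ^ 4 ≤ ∏ j, |x j| ^ (-(8 / n) : ℝ) := by
  have hn0 : (0 : ℝ) < n := by exact_mod_cast hn
  have hne : (Finset.univ : Finset (Fin n)).Nonempty := ⟨⟨0, hn⟩, Finset.mem_univ _⟩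
  have ham := Real.geom_mean_le_arith_mean_weighted Finset.univ (fun _ : Fin n => (1 / n : ℝ))
    (fun j => x j ^ 2) (fun _ _ => by positivity) (by simp [hn0.ne']) (fun _ _ => sq_nonneg _)
  rw [← Finset.mul_sum, one_div_mul_eq_div] at ham
  have hgpos : 0 < ∏ j, (x j ^ 2) ^ (1 / n : ℝ) :=
    Finset.prod_pos fun j _ => Real.rpow_pos_of_pos (by have := hx j; positivity) _
  have e : ∏ j, |x j| ^ (-(8 / n) : ℝ) = ((∏ j, (x j ^ 2) ^ (1 / n : ℝ))⁻¹) ^ 4 := by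
    rw [← Finset.prod_inv_distrib, ← Finset.prod_pow]
    refine Finset.prod_congr rfl fun j _ => ?_
    have hp : 0 < |x j| := abs_pos.2 (hx j)
    rw [← sq_abs, ← Real.rpow_natCast |x j| 2, ← Real.rpow_mul hp.le, ← Real.rpow_neg hp.le,
      ← Real.rpow_natCast, ← Real.rpow_mul hp.le]
    congr 1
    push_cast
    ring
  rw [e, ← inv_div]
  gcongr

theorem integral_pi_card_div_sum_sq {n : ℕ} (hn : 9 ≤ n) :
    Integrable (fun x : Fin n → ℝ => (n / ∑ j, x j ^ 2) ^ 4)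
      (Measure.pi fun _ => gaussianReal 0 1) ∧
    ∫ x : Fin n → ℝ, (n / ∑ j, x j ^ 2) ^ 4 ∂(Measure.pi fun _ => gaussianReal 0 1)
      ≤ invMoment ^ 9 := by
  have hn9 : (9 : ℝ) ≤ n := by exact_mod_cast hn
  have hi : Integrable (fun x : ℝ => |x| ^ (-(8 / n) : ℝ)) (gaussianReal 0 1) := by
    refine integrable_abs_rpow_gaussianReal ?_
    have : 8 / (n : ℝ) ≤ 8 / 9 := by gcongr
    linarith
  have hip : Integrable (fun x : Fin n → ℝ => ∏ j, |x j| ^ (-(8 / n) : ℝ))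
      (Measure.pi fun _ => gaussianReal 0 1) :=
    Integrable.fintype_prod (f := fun _ x => |x| ^ (-(8 / n) : ℝ)) fun _ => hi
  have hae : ∀ᵐ x : Fin n → ℝ ∂(Measure.pi fun _ => gaussianReal 0 1), ∀ j, x j ≠ 0 := by
    rw [ae_all_iff]
    intro j
    have := (measurePreserving_eval (fun _ : Fin n => gaussianReal 0 1) j).quasiMeasurePreserving
    have hna : NullSingletonClass (gaussianReal 0 1) :=
      nullSingletonClass_gaussianReal one_ne_zero
    have h0 : ∀ᵐ y ∂gaussianReal 0 1, y ≠ 0 := by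
      rw [ae_iff]; simp
    exact this.ae h0
  have hle : ∀ᵐ x : Fin n → ℝ ∂(Measure.pi fun _ => gaussianReal 0 1),
      (n / ∑ j, x j ^ 2) ^ 4 ≤ ∏ j, |x j| ^ (-(8 / n) : ℝ) := by
    filter_upwards [hae] with x hx using pow_four_card_div_sum_sq_le (by omega) hx
  have hintg : Integrable (fun x : Fin n → ℝ => (n / ∑ j, x j ^ 2) ^ 4)
      (Measure.pi fun _ => gaussianReal 0 1) := by
    refine hip.mono' (Measurable.aestronglyMeasurable (by fun_prop)) ?_
    filter_upwards [hle] with x hx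
    rwa [Real.norm_of_nonneg (by positivity)]
  refine ⟨hintg, (integral_mono_ae hintg hip hle).trans ?_⟩
  rw [integral_fintype_prod_eq_pow (fun x : ℝ => |x| ^ (-(8 / n) : ℝ)), Fintype.card_fin]
  exact integral_abs_rpow_pow_le hn

variable {E : Type*} [NormedAddCommGroup E] [InnerProductSpace ℝ E] [FiniteDimensional ℝ E]
  [MeasurableSpace E] [BorelSpace E]

/-- Characteristic functions: the adjoint moves across the inner product, and `i` preserves the norm
of the frequency. -/
theorem stdGaussian_map_adjoint {F : Type*} [NormedAddCommGroup F] [InnerProductSpace ℝ F]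
    [FiniteDimensional ℝ F] [MeasurableSpace F] [BorelSpace F] (i : F →ₗᵢ[ℝ] E) :
    (stdGaussian E).map (ContinuousLinearMap.adjoint i.toContinuousLinearMap) = stdGaussian F := by
  refine Measure.ext_of_charFun (funext fun t => ?_)
  rw [charFun_apply, integral_map (by fun_prop) (Measurable.aestronglyMeasurable (by fun_prop))]
  simp_rw [ContinuousLinearMap.adjoint_inner_left]
  rw [← charFun_apply, charFun_stdGaussian, charFun_stdGaussian]
  simp

theorem stdGaussian_map_inner (v : E) :
    (stdGaussian E).map (fun x => ⟪v, x⟫) = (gaussianReal 0 1).map (fun x => ‖v‖ * x) := by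
  have h := IsGaussian.map_eq_gaussianReal (μ := stdGaussian E) (innerSL ℝ v)
  rw [integral_strongDual_stdGaussian, variance_dual_stdGaussian, innerSL_apply_norm] at h
  rw [gaussianReal_map_const_mul, mul_zero, mul_one]
  convert h using 2
  · rfl
  · exact (Real.toNNReal_of_nonneg (sq_nonneg _)).symm

theorem stdGaussian_singleton_zero [Nontrivial E] : stdGaussian E {0} = 0 := by
  obtain ⟨v, hv⟩ := exists_ne (0 : E)
  have h : (stdGaussian E).map (fun x => ⟪v, x⟫) {0} = 0 := by
    rw [stdGaussian_map_inner, Measure.map_apply (by fun_prop) (measurableSet_singleton _)]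
    have hna : NullSingletonClass (gaussianReal 0 1) :=
      nullSingletonClass_gaussianReal one_ne_zero
    have : (fun x : ℝ => ‖v‖ * x) ⁻¹' {0} = {0} := by ext x; simp [hv]
    rw [this, measure_singleton]
  rw [Measure.map_apply (by fun_prop) (measurableSet_singleton _)] at h
  refine measure_mono_null ?_ h
  rintro x rfl
  simp

/-- The eighth moment of a standard Gaussian variable. -/
def moment8 : ℝ := ∫ x : ℝ, x ^ 8 ∂gaussianReal 0 1

/-- The first absolute moment of a standard Gaussian variable. -/
def absMoment : ℝ := ∫ x : ℝ, |x| ∂gaussianReal 0 1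

theorem integrable_pow_gaussianReal (k : ℕ) :
    Integrable (fun x : ℝ => x ^ k) (gaussianReal 0 1) := by
  have h := (memLp_id_gaussianReal (μ := 0) (v := 1) k).integrable_norm_pow'
  refine h.mono (Measurable.aestronglyMeasurable (by fun_prop)) (Eventually.of_forall fun x => ?_)
  simp

theorem moment8_nonneg : 0 ≤ moment8 := integral_nonneg fun _ => by positivity

theorem absMoment_pos : 0 < absMoment := by
  have hi : Integrable (fun x : ℝ => |x|) (gaussianReal 0 1) := by
    simpa using (integrable_pow_gaussianReal 1).abs
  refine (integral_pos_iff_support_of_nonneg (fun _ => abs_nonneg _) hi).2 ?_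
  have hs : Function.support (fun x : ℝ => |x|) = {0}ᶜ := by ext x; simp
  have hna : NullSingletonClass (gaussianReal 0 1) :=
      nullSingletonClass_gaussianReal one_ne_zero
  rw [hs, prob_compl_eq_one_sub (measurableSet_singleton _), measure_singleton]
  simp

theorem integral_inner_pow_eight (v : E) :
    Integrable (fun x => ⟪v, x⟫ ^ 8) (stdGaussian E) ∧
      ∫ x, ⟪v, x⟫ ^ 8 ∂stdGaussian E = ‖v‖ ^ 8 * moment8 := by
  have hm : AEMeasurable (fun x => ⟪v, x⟫) (stdGaussian E) := by fun_prop
  have hv : AEMeasurable (fun x : ℝ => ‖v‖ * x) (gaussianReal 0 1) := by fun_prop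
  constructor
  · have : Integrable (fun y : ℝ => y ^ 8) ((stdGaussian E).map fun x => ⟪v, x⟫) := by
      rw [stdGaussian_map_inner, integrable_map_measure (by fun_prop) hv]
      simpa [Function.comp_def, mul_pow] using (integrable_pow_gaussianReal 8).const_mul (‖v‖ ^ 8)
    exact (integrable_map_measure (by fun_prop) hm).1 this
  · rw [← integral_map (f := fun y : ℝ => y ^ 8) hm (by fun_prop), stdGaussian_map_inner,
      integral_map hv (by fun_prop)]
    simp_rw [mul_pow]
    rw [integral_const_mul, moment8]

theorem integral_abs_inner (v : E) : ∫ x, |⟪v, x⟫| ∂stdGaussian E = ‖v‖ * absMoment := by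
  have hm : AEMeasurable (fun x => ⟪v, x⟫) (stdGaussian E) := by fun_prop
  have hv : AEMeasurable (fun x : ℝ => ‖v‖ * x) (gaussianReal 0 1) := by fun_prop
  rw [← integral_map (f := fun y : ℝ => |y|) hm (by fun_prop), stdGaussian_map_inner,
      integral_map hv (by fun_prop)]
  simp_rw [abs_mul, abs_norm]
  rw [integral_const_mul, absMoment]

/-- The Gaussian quadratic form with the frame `b`. -/
def quadForm {N : ℕ} (b : Fin N → E) (x : E) : ℝ := ∑ i, ⟪b i, x⟫ ^ 2

theorem quadForm_nonneg {N : ℕ} (b : Fin N → E) (x : E) : 0 ≤ quadForm b x :=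
  Finset.sum_nonneg fun _ _ => sq_nonneg _

theorem measurable_quadForm {N : ℕ} (b : Fin N → E) : Measurable (quadForm b) := by
  unfold quadForm; fun_prop

theorem quadForm_smul {N : ℕ} (b : Fin N → E) (c : ℝ) (x : E) :
    quadForm b (c • x) = c ^ 2 * quadForm b x := by
  simp [quadForm, real_inner_smul_right, mul_pow, Finset.mul_sum]

@[simp] theorem quadForm_zero {N : ℕ} (b : Fin N → E) : quadForm b 0 = 0 := by simp [quadForm]

/-- The vectors `b` are bounded below as a frame by `c`. -/
def FrameBound {N : ℕ} (c : ℝ) (b : Fin N → E) : Prop :=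
  ∀ u : Fin N → ℝ, c * ∑ i, u i ^ 2 ≤ ‖∑ i, u i • b i‖ ^ 2

/-- The isometry enumerates an orthonormal basis of the span of `b`, so its adjoint `w` of `x` holds
the coordinates of the projection. Writing the projection as `∑ u_j b_j` gives `‖w‖² = ∑ u_j ⟪b_j,
x⟫`. Cauchy-Schwarz and the frame bound then yield `‖w‖⁴ ≤ (‖w‖² / c) · quadForm b x`. Under a
standard Gaussian `x`, the vector `w` is a standard Gaussian in dimension `N`. -/
theorem FrameBound.exists_isometry {N : ℕ} {c : ℝ} (hc : 0 < c) {b : Fin N → E}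
    (hb : FrameBound c b) : ∃ i : EuclideanSpace ℝ (Fin N) →ₗᵢ[ℝ] E,
      ∀ x, c * ‖ContinuousLinearMap.adjoint i.toContinuousLinearMap x‖ ^ 2 ≤ quadForm b x := by
  have hli : LinearIndependent ℝ b := by
    rw [Fintype.linearIndependent_iff]
    intro u hu i
    have h := hb u
    rw [hu] at h
    have h1 : ∑ i, u i ^ 2 ≤ 0 := by
      by_contra hne; push Not at hne
      have := mul_pos hc hne
      simp at h; linarith
    have := (Finset.sum_eq_zero_iff_of_nonneg fun i _ => sq_nonneg (u i)).1
      (le_antisymm h1 (Finset.sum_nonneg fun i _ => sq_nonneg (u i))) i (Finset.mem_univ _)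
    exact pow_eq_zero_iff (two_ne_zero) |>.1 this
  set S := Submodule.span ℝ (Set.range b)
  have hd : Module.finrank ℝ S = N := by
    rw [finrank_span_eq_card hli, Fintype.card_fin]
  let ob : OrthonormalBasis (Fin N) ℝ S := (stdOrthonormalBasis ℝ S).reindex (finCongr hd)
  let i : EuclideanSpace ℝ (Fin N) →ₗᵢ[ℝ] E := S.subtypeₗᵢ.comp ob.repr.symm.toLinearIsometry
  refine ⟨i, fun x => ?_⟩
  set w := ContinuousLinearMap.adjoint i.toContinuousLinearMap x
  have hw : ‖w‖ ^ 2 = ⟪i w, x⟫ := by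
    rw [← real_inner_self_eq_norm_sq]
    exact ContinuousLinearMap.adjoint_inner_right i.toContinuousLinearMap w x
  have hmem : i w ∈ S := (ob.repr.symm w).2
  obtain ⟨u, hu⟩ := (Submodule.mem_span_range_iff_exists_fun ℝ).1 hmem
  have hub : c * ∑ j, u j ^ 2 ≤ ‖w‖ ^ 2 := by
    have := hb u
    rwa [hu, i.norm_map] at this
  have hin : ‖w‖ ^ 2 = ∑ j, u j * ⟪b j, x⟫ := by
    rw [hw, ← hu, sum_inner]; simp [real_inner_smul_left]
  have hcs : (‖w‖ ^ 2) ^ 2 ≤ (∑ j, u j ^ 2) * quadForm b x := by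
    rw [hin]; exact Finset.sum_mul_sq_le_sq_mul_sq _ _ _
  by_cases hw0 : ‖w‖ ^ 2 = 0
  · rw [hw0, mul_zero]; exact quadForm_nonneg _ _
  have hwp : 0 < ‖w‖ ^ 2 := lt_of_le_of_ne (sq_nonneg _) (Ne.symm hw0)
  have hq := quadForm_nonneg b x
  refine le_of_mul_le_mul_left ?_ hwp
  nlinarith

/-- Fourth inverse moments of Gaussian quadratic forms. -/
theorem integral_inv_quadForm {N : ℕ} (hN : 9 ≤ N) {c : ℝ} (hc : 0 < c) {b : Fin N → E}
    (hb : FrameBound c b) :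
    Integrable (fun x => (N / quadForm b x) ^ 4) (stdGaussian E) ∧
      ∫ x, (N / quadForm b x) ^ 4 ∂stdGaussian E ≤ invMoment ^ 9 / c ^ 4 := by
  obtain ⟨i, hi⟩ := hb.exists_isometry hc
  set a := ContinuousLinearMap.adjoint i.toContinuousLinearMap with ha
  have hmap : (stdGaussian E).map a = stdGaussian (EuclideanSpace ℝ (Fin N)) :=
    stdGaussian_map_adjoint i
  have ham : AEMeasurable a (stdGaussian E) := by fun_prop
  have hpi := map_pi_eq_stdGaussian (ι := Fin N)
  have hlp : AEMeasurable (WithLp.toLp 2 : (Fin N → ℝ) → EuclideanSpace ℝ (Fin N))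
    (Measure.pi fun _ => gaussianReal 0 1) := by fun_prop
  obtain ⟨h1, h2⟩ := integral_pi_card_div_sum_sq hN
  have hms : Measurable fun y : EuclideanSpace ℝ (Fin N) => (N / ‖y‖ ^ 2) ^ 4 := by fun_prop
  have hcomp : ∀ x : Fin N → ℝ, ‖(WithLp.toLp 2 x : EuclideanSpace ℝ (Fin N))‖ ^ 2
      = ∑ j, x j ^ 2 := fun x => by rw [EuclideanSpace.real_norm_sq_eq]
  have hI : Integrable (fun x => (N / ‖a x‖ ^ 2) ^ 4) (stdGaussian E) := by
    refine (integrable_map_measure (f := a) (g := fun y => (N / ‖y‖ ^ 2) ^ 4)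
      hms.aestronglyMeasurable ham).1 ?_
    rw [hmap, ← hpi, integrable_map_measure hms.aestronglyMeasurable hlp]
    simpa [Function.comp_def, hcomp] using h1
  have hV : ∫ x, (N / ‖a x‖ ^ 2) ^ 4 ∂stdGaussian E ≤ invMoment ^ 9 := by
    rw [← integral_map (f := fun y => (N / ‖y‖ ^ 2) ^ 4) ham hms.aestronglyMeasurable, hmap, ← hpi,
      integral_map hlp hms.aestronglyMeasurable]
    simpa [hcomp] using h2
  have hae : ∀ᵐ x ∂stdGaussian E, a x ≠ 0 := by
    have : Nontrivial (EuclideanSpace ℝ (Fin N)) := by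
      have : Nonempty (Fin N) := ⟨⟨0, by omega⟩⟩
      infer_instance
    have h0 : ∀ᵐ y ∂(stdGaussian E).map a, y ≠ 0 := by
      rw [hmap, ae_iff]; simpa using stdGaussian_singleton_zero
    exact ae_of_ae_map ham h0
  have hle : ∀ᵐ x ∂stdGaussian E, (N / quadForm b x) ^ 4 ≤ (1 / c ^ 4) * (N / ‖a x‖ ^ 2) ^ 4 := by
    filter_upwards [hae] with x hx
    have hp : 0 < ‖a x‖ ^ 2 := by have := norm_pos_iff.2 hx; positivity
    have : N / quadForm b x ≤ (1 / c) * (N / ‖a x‖ ^ 2) := by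
      calc N / quadForm b x ≤ N / (c * ‖a x‖ ^ 2) := by
            gcongr
            exact hi x
        _ = _ := by field_simp
    calc (N / quadForm b x) ^ 4 ≤ ((1 / c) * (N / ‖a x‖ ^ 2)) ^ 4 := by
          have := quadForm_nonneg b x
          gcongr
      _ = _ := by ring
  have hI' := hI.const_mul (1 / c ^ 4)
  have hintg : Integrable (fun x => (N / quadForm b x) ^ 4) (stdGaussian E) := by
    refine hI'.mono' ((measurable_quadForm b).const_div _ |>.pow_const _).aestronglyMeasurable ?_
    filter_upwards [hle] with x hx
    rwa [Real.norm_of_nonneg (by positivity)]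
  refine ⟨hintg, (integral_mono_ae hintg hI' hle).trans ?_⟩
  rw [integral_const_mul, one_div, inv_mul_eq_div]
  gcongr

/-- Repeated use of `2 x y ≤ x² + y²`. It separates four linear forms and two inverse quadratic
forms, so only eighth moments and inverse fourth moments of single forms are needed, without
independence. -/
theorem abs_mul_four_le (a b c d u w : ℝ) : |a * b * c * d| * (u * w) ≤
    (a ^ 8 + b ^ 8 + c ^ 8 + d ^ 8) / 8 + (u ^ 4 + w ^ 4) / 4 := by
  have h1 : |a * b * c * d| * (u * w) ≤ ((a * b * c * d) ^ 2 + (u * w) ^ 2) / 2 := by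
    nlinarith [sq_nonneg (|a * b * c * d| - u * w), sq_abs (a * b * c * d)]
  have h2 : (a * b * c * d) ^ 2 ≤ ((a * b) ^ 4 + (c * d) ^ 4) / 2 := by
    nlinarith [sq_nonneg ((a * b) ^ 2 - (c * d) ^ 2)]
  have h3 : (a * b) ^ 4 ≤ (a ^ 8 + b ^ 8) / 2 := by nlinarith [sq_nonneg (a ^ 4 - b ^ 4)]
  have h4 : (c * d) ^ 4 ≤ (c ^ 8 + d ^ 8) / 2 := by nlinarith [sq_nonneg (c ^ 4 - d ^ 4)]
  have h5 : (u * w) ^ 2 ≤ (u ^ 4 + w ^ 4) / 2 := by nlinarith [sq_nonneg (u ^ 2 - w ^ 2)]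
  linarith

/-- A bound for the moments of normalized Gaussian ratios. -/
def ratioMoment (c : ℝ) : ℝ := moment8 + invMoment ^ 9 / c ^ 4 + 1

theorem ratioMoment_pos {c : ℝ} (hc : 0 < c) : 0 < ratioMoment c := by
  have := moment8_nonneg
  have := invMoment_nonneg
  unfold ratioMoment; positivity

theorem inner_normalize (p x : E) : ⟪p, x⟫ = ‖p‖ * ⟪‖p‖⁻¹ • p, x⟫ := by
  by_cases hp : p = 0
  · simp [hp]
  · rw [real_inner_smul_left, mul_inv_cancel_left₀ (norm_ne_zero_iff.2 hp)]

theorem integral_inner_normalize_pow_eight_le (p : E) :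
    Integrable (fun x => ⟪‖p‖⁻¹ • p, x⟫ ^ 8) (stdGaussian E) ∧
      ∫ x, ⟪‖p‖⁻¹ • p, x⟫ ^ 8 ∂stdGaussian E ≤ moment8 := by
  obtain ⟨h1, h2⟩ := integral_inner_pow_eight (‖p‖⁻¹ • p)
  refine ⟨h1, h2.trans_le (mul_le_of_le_one_left moment8_nonneg (pow_le_one₀ (norm_nonneg _) ?_))⟩
  rw [norm_smul, norm_inv, norm_norm]
  exact inv_mul_le_one

theorem scaled_four_eq {n : ℝ} (hn : n ≠ 0) (k₁ k₂ k₃ k₄ A B C D U W : ℝ) :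
    k₁ * A * (k₂ * B) * (k₃ * C) * (k₄ * D) * (U * W) =
      k₁ * k₂ * k₃ * k₄ / n ^ 2 * (A * B * C * D * (n * U * (n * W))) := by
  field_simp

/-- The vectors are normalized before the additive bound is applied; this is what leaves the product
of the norms, rather than a sum of powers, as a prefactor. -/
theorem four_ratio_le {N : ℕ} (hN : 0 < N) (b b' : Fin N → E) (p₁ p₂ p₃ p₄ x : E) :
    |⟪p₁, x⟫ * ⟪p₂, x⟫ * ⟪p₃, x⟫ * ⟪p₄, x⟫| * ((quadForm b x)⁻¹ * (quadForm b' x)⁻¹) ≤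
      ‖p₁‖ * ‖p₂‖ * ‖p₃‖ * ‖p₄‖ / N ^ 2 * ((⟪‖p₁‖⁻¹ • p₁, x⟫ ^ 8 + ⟪‖p₂‖⁻¹ • p₂, x⟫ ^ 8 +
        ⟪‖p₃‖⁻¹ • p₃, x⟫ ^ 8 + ⟪‖p₄‖⁻¹ • p₄, x⟫ ^ 8) / 8 +
        ((N / quadForm b x) ^ 4 + (N / quadForm b' x) ^ 4) / 4) := by
  have hN0 : (N : ℝ) ≠ 0 := by exact_mod_cast hN.ne'
  refine le_trans (le_of_eq ?_) (mul_le_mul_of_nonneg_left (abs_mul_four_le _ _ _ _ _ _)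
    (by positivity))
  rw [inner_normalize p₁, inner_normalize p₂, inner_normalize p₃, inner_normalize p₄]
  simp only [abs_mul, abs_norm, div_eq_mul_inv (N : ℝ)]
  exact scaled_four_eq hN0 _ _ _ _ _ _ _ _ _ _

theorem integral_four_ratio {N : ℕ} (hN : 9 ≤ N) {c : ℝ} (hc : 0 < c) {b b' : Fin N → E}
    (hb : FrameBound c b) (hb' : FrameBound c b') (p₁ p₂ p₃ p₄ : E) :
    Integrable (fun x => |⟪p₁, x⟫ * ⟪p₂, x⟫ * ⟪p₃, x⟫ * ⟪p₄, x⟫| *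
      ((quadForm b x)⁻¹ * (quadForm b' x)⁻¹)) (stdGaussian E) ∧
    ∫ x, |⟪p₁, x⟫ * ⟪p₂, x⟫ * ⟪p₃, x⟫ * ⟪p₄, x⟫| *
      ((quadForm b x)⁻¹ * (quadForm b' x)⁻¹) ∂stdGaussian E ≤
      ratioMoment c * (‖p₁‖ * ‖p₂‖ * ‖p₃‖ * ‖p₄‖) / N ^ 2 := by
  have hN0 : (0 : ℝ) < N := by exact_mod_cast (by omega : 0 < N)
  obtain ⟨i₁, j₁⟩ := integral_inner_normalize_pow_eight_le p₁
  obtain ⟨i₂, j₂⟩ := integral_inner_normalize_pow_eight_le p₂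
  obtain ⟨i₃, j₃⟩ := integral_inner_normalize_pow_eight_le p₃
  obtain ⟨i₄, j₄⟩ := integral_inner_normalize_pow_eight_le p₄
  obtain ⟨i₅, j₅⟩ := integral_inv_quadForm hN hc hb
  obtain ⟨i₆, j₆⟩ := integral_inv_quadForm hN hc hb'
  set K := ‖p₁‖ * ‖p₂‖ * ‖p₃‖ * ‖p₄‖ / N ^ 2 with hK
  have hK0 : 0 ≤ K := by positivity
  have hI := ((((i₁.add i₂).add i₃).add i₄).div_const 8).add ((i₅.add i₆).div_const 4)
  have hle := four_ratio_le (by omega : 0 < N) b b' p₁ p₂ p₃ p₄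
  have hintg : Integrable (fun x => |⟪p₁, x⟫ * ⟪p₂, x⟫ * ⟪p₃, x⟫ * ⟪p₄, x⟫| *
      ((quadForm b x)⁻¹ * (quadForm b' x)⁻¹)) (stdGaussian E) := by
    have := measurable_quadForm b
    have := measurable_quadForm b'
    refine (hI.const_mul K).mono' (Measurable.aestronglyMeasurable (by fun_prop))
      (Eventually.of_forall fun x => ?_)
    rw [Real.norm_of_nonneg]
    · exact hle x
    · have := quadForm_nonneg b x
      have := quadForm_nonneg b' x
      positivity
  refine ⟨hintg, (integral_mono hintg (hI.const_mul K) hle).trans ?_⟩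
  rw [integral_const_mul, integral_add', integral_div, integral_div, integral_add', integral_add',
    integral_add', integral_add' i₅ i₆]
  · calc _ ≤ K * ((moment8 + moment8 + moment8 + moment8) / 8 +
          (invMoment ^ 9 / c ^ 4 + invMoment ^ 9 / c ^ 4) / 4) := by gcongr
      _ ≤ K * ratioMoment c := by
          refine mul_le_mul_of_nonneg_left ?_ hK0
          have := moment8_nonneg
          have : 0 ≤ invMoment ^ 9 / c ^ 4 := by have := invMoment_nonneg; positivity
          unfold ratioMoment; linarith
      _ = _ := by rw [hK]; ring
  all_goals first
    | exact i₁ | exact i₂ | exact i₃ | exact i₄ | exact i₁.add i₂ | exact (i₁.add i₂).add i₃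
    | exact (((i₁.add i₂).add i₃).add i₄).div_const 8 | exact (i₅.add i₆).div_const 4

theorem integral_two_ratio {N : ℕ} (hN : 9 ≤ N) {c : ℝ} (hc : 0 < c) {b : Fin N → E}
    (hb : FrameBound c b) (p₁ p₂ : E) :
    Integrable (fun x => |⟪p₁, x⟫ * ⟪p₂, x⟫| * (quadForm b x)⁻¹) (stdGaussian E) ∧
    ∫ x, |⟪p₁, x⟫ * ⟪p₂, x⟫| * (quadForm b x)⁻¹ ∂stdGaussian E ≤
      ratioMoment c * (‖p₁‖ * ‖p₂‖) / N := by
  have hN0 : (0 : ℝ) < N := by exact_mod_cast (by omega : 0 < N)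
  obtain ⟨i₁, j₁⟩ := integral_inner_normalize_pow_eight_le p₁
  obtain ⟨i₂, j₂⟩ := integral_inner_normalize_pow_eight_le p₂
  obtain ⟨i₅, j₅⟩ := integral_inv_quadForm hN hc hb
  set K := ‖p₁‖ * ‖p₂‖ / N with hK
  have hK0 : 0 ≤ K := by positivity
  have i₀ : Integrable (fun _ : E => (1 / 2 : ℝ)) (stdGaussian E) := integrable_const _
  have hI := (((i₁.add i₂).div_const 8).add (i₅.div_const 4)).add i₀
  have hle : ∀ x, |⟪p₁, x⟫ * ⟪p₂, x⟫| * (quadForm b x)⁻¹ ≤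
      K * ((⟪‖p₁‖⁻¹ • p₁, x⟫ ^ 8 + ⟪‖p₂‖⁻¹ • p₂, x⟫ ^ 8) / 8 + (N / quadForm b x) ^ 4 / 4
        + 1 / 2) := by
    intro x
    -- With the remaining arguments equal to one, the constants contribute `2/8 + 1/4 = 1/2`.
    have h := abs_mul_four_le ⟪‖p₁‖⁻¹ • p₁, x⟫ ⟪‖p₂‖⁻¹ • p₂, x⟫ 1 1 (N / quadForm b x) 1
    refine le_trans (le_of_eq ?_) (mul_le_mul_of_nonneg_left (h.trans (le_of_eq (by ring))) hK0)
    rw [inner_normalize p₁, inner_normalize p₂, hK]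
    simp only [abs_mul, abs_norm, mul_one, div_eq_mul_inv (N : ℝ)]
    generalize (quadForm b x)⁻¹ = U
    generalize |⟪‖p₁‖⁻¹ • p₁, x⟫| = A
    generalize |⟪‖p₂‖⁻¹ • p₂, x⟫| = B
    field_simp
  have hintg : Integrable (fun x => |⟪p₁, x⟫ * ⟪p₂, x⟫| * (quadForm b x)⁻¹) (stdGaussian E) := by
    have := measurable_quadForm b
    refine (hI.const_mul K).mono' (Measurable.aestronglyMeasurable (by fun_prop))
      (Eventually.of_forall fun x => ?_)
    rw [Real.norm_of_nonneg]
    · exact hle x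
    · have := quadForm_nonneg b x
      positivity
  refine ⟨hintg, (integral_mono hintg (hI.const_mul K) hle).trans ?_⟩
  rw [integral_const_mul, integral_add', integral_add', integral_div, integral_div, integral_add',
    integral_const]
  · calc _ ≤ K * ((moment8 + moment8) / 8 + (invMoment ^ 9 / c ^ 4) / 4 + 1 / 2) := by
          simp only [probReal_univ, one_smul]
          gcongr
      _ ≤ K * ratioMoment c := by
          refine mul_le_mul_of_nonneg_left ?_ hK0
          have := moment8_nonneg
          have : 0 ≤ invMoment ^ 9 / c ^ 4 := by have := invMoment_nonneg; positivity
          unfold ratioMoment; linarith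
      _ = _ := by rw [hK]; ring
  all_goals first
    | exact i₁ | exact i₂ | exact (i₁.add i₂).div_const 8 | exact i₅.div_const 4 | exact i₀
    | exact ((i₁.add i₂).div_const 8).add (i₅.div_const 4)

end GaussianMoments

end GroupedFactor

namespace GroupedFactor

/-! ### Averages over pairs: U-statistics of order two -/

section PairAverages

variable {T : ℕ}

/-- The average of `x t s` over the pairs `t < s`. -/
def pairAvg (x : Fin T → Fin T → ℝ) : ℝ :=
  (2 / ((T : ℝ) * ((T : ℝ) - 1))) * ∑ t : Fin T, ∑ s ∈ Finset.Ioi t, x t s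

theorem pairAvg_weight_nonneg (hT : 2 ≤ T) : (0 : ℝ) ≤ 2 / ((T : ℝ) * ((T : ℝ) - 1)) := by
  have : (2 : ℝ) ≤ T := by exact_mod_cast hT
  exact div_nonneg (by norm_num) (mul_nonneg (by linarith) (by linarith))

theorem sum_card_Ioi (T : ℕ) :
    ∑ t : Fin T, ((Finset.Ioi t).card : ℝ) = (T : ℝ) * ((T : ℝ) - 1) / 2 := by
  have h : (∑ t : Fin T, (Finset.Ioi t).card) * 2 = T * (T - 1) := by
    simp only [Fin.card_Ioi]
    rw [Fin.sum_univ_eq_sum_range (fun i => T - 1 - i) T, Finset.sum_range_reflect (fun i => i) T,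
      Finset.sum_range_id_mul_two]
  have h' : (∑ t : Fin T, ((Finset.Ioi t).card : ℝ)) * 2 = T * ((T - 1 : ℕ) : ℝ) := by
    exact_mod_cast h
  rcases Nat.eq_zero_or_pos T with h0 | h0
  · subst h0; simp
  · rw [Nat.cast_pred h0] at h'
    linarith

theorem pairAvg_const (hT : 2 ≤ T) (c : ℝ) : pairAvg (fun _ _ : Fin T => c) = c := by
  have h2 : (2 : ℝ) ≤ T := by exact_mod_cast hT
  simp only [pairAvg, Finset.sum_const, nsmul_eq_mul, ← Finset.sum_mul, sum_card_Ioi]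
  have : (T : ℝ) - 1 ≠ 0 := by linarith
  field_simp

theorem pairAvg_mono (hT : 2 ≤ T) {x y : Fin T → Fin T → ℝ} (h : ∀ t s, t < s → x t s ≤ y t s) :
    pairAvg x ≤ pairAvg y :=
  mul_le_mul_of_nonneg_left (Finset.sum_le_sum fun t _ => Finset.sum_le_sum fun s hs =>
    h t s (Finset.mem_Ioi.1 hs)) (pairAvg_weight_nonneg hT)

theorem pairAvg_le (hT : 2 ≤ T) {x : Fin T → Fin T → ℝ} {c : ℝ} (h : ∀ t s, t < s → x t s ≤ c) :
    pairAvg x ≤ c := (pairAvg_mono hT h).trans_eq (pairAvg_const hT c)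

theorem le_pairAvg (hT : 2 ≤ T) {x : Fin T → Fin T → ℝ} {c : ℝ} (h : ∀ t s, t < s → c ≤ x t s) :
    c ≤ pairAvg x := (pairAvg_const hT c).symm.trans_le (pairAvg_mono hT h)

theorem abs_pairAvg_le (hT : 2 ≤ T) (x : Fin T → Fin T → ℝ) :
    |pairAvg x| ≤ pairAvg fun t s => |x t s| := by
  unfold pairAvg
  rw [abs_mul, abs_of_nonneg (pairAvg_weight_nonneg hT)]
  refine mul_le_mul_of_nonneg_left ((Finset.abs_sum_le_sum_abs _ _).trans ?_)
    (pairAvg_weight_nonneg hT)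
  exact Finset.sum_le_sum fun t _ => Finset.abs_sum_le_sum_abs _ _

theorem pairAvg_sum {ι : Type*} (S : Finset ι) (x : ι → Fin T → Fin T → ℝ) :
    pairAvg (fun t s => ∑ i ∈ S, x i t s) = ∑ i ∈ S, pairAvg (x i) := by
  unfold pairAvg
  rw [← Finset.mul_sum, Finset.sum_comm]
  simp_rw [Finset.sum_comm (s := S)]

theorem pairAvg_const_mul (c : ℝ) (x : Fin T → Fin T → ℝ) :
    pairAvg (fun t s => c * x t s) = c * pairAvg x := by
  unfold pairAvg
  simp_rw [← Finset.mul_sum]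
  ring

theorem pairAvg_add (x y : Fin T → Fin T → ℝ) :
    pairAvg (fun t s => x t s + y t s) = pairAvg x + pairAvg y := by
  unfold pairAvg
  simp_rw [Finset.sum_add_distrib, mul_add]

variable {Ω : Type*} [MeasurableSpace Ω] {P : Measure Ω}

theorem integrable_pairAvg {X : Fin T → Fin T → Ω → ℝ}
    (h : ∀ t s, t < s → Integrable (X t s) P) : Integrable (fun ω => pairAvg fun t s => X t s ω) P :=
  (integrable_finsetSum _ fun t _ => integrable_finsetSum _ fun s hs =>
    h t s (Finset.mem_Ioi.1 hs)).const_mul _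

theorem integral_pairAvg {X : Fin T → Fin T → Ω → ℝ} (h : ∀ t s, t < s → Integrable (X t s) P) :
    ∫ ω, pairAvg (fun t s => X t s ω) ∂P = pairAvg fun t s => ∫ ω, X t s ω ∂P := by
  unfold pairAvg
  rw [integral_const_mul, integral_finsetSum _ fun t _ => integrable_finsetSum _ fun s hs =>
    h t s (Finset.mem_Ioi.1 hs)]
  congr 1
  exact Finset.sum_congr rfl fun t _ => integral_finsetSum _ fun s hs => h t s (Finset.mem_Ioi.1 hs)

/-- The variance of `X - Y` is nonnegative, so twice the covariance is at most the sum of the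
variances. -/
theorem covariance_le_of_sq_le [IsProbabilityMeasure P] {X Y : Ω → ℝ} {V : ℝ} (hX : MemLp X 2 P)
    (hY : MemLp Y 2 P) (hXV : ∫ ω, X ω ^ 2 ∂P ≤ V) (hYV : ∫ ω, Y ω ^ 2 ∂P ≤ V) :
    cov[X, Y; P] ≤ V := by
  have hvX : Var[X; P] ≤ V := (variance_le_expectation_sq hX.1).trans hXV
  have hvY : Var[Y; P] ≤ V := (variance_le_expectation_sq hY.1).trans hYV
  have h := variance_nonneg (X - Y) P
  rw [variance_sub hX hY] at h
  linarith

/-- Second moment of the deviation of a U-statistic of order two from its mean. -/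
theorem integral_sq_pairAvg_sub_le [IsProbabilityMeasure P] {β : Type*} [MeasurableSpace β]
    (hT : 2 ≤ T) {Z : Fin T → Ω → β} (hZ : ∀ t, AEMeasurable (Z t) P) (hind : iIndepFun Z P)
    {h : β × β → ℝ} (hm : Measurable h) {V : ℝ} (hV : 0 ≤ V)
    (hL : ∀ t s, t < s → MemLp (fun ω => h (Z t ω, Z s ω)) 2 P)
    (hle : ∀ t s, t < s → ∫ ω, h (Z t ω, Z s ω) ^ 2 ∂P ≤ V) :
    Integrable (fun ω => (pairAvg (fun t s => h (Z t ω, Z s ω)) -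
      ∫ ω, pairAvg (fun t s => h (Z t ω, Z s ω)) ∂P) ^ 2) P ∧
    ∫ ω, (pairAvg (fun t s => h (Z t ω, Z s ω)) -
      ∫ ω, pairAvg (fun t s => h (Z t ω, Z s ω)) ∂P) ^ 2 ∂P ≤ 16 / T * V := by
  have h2 : (2 : ℝ) ≤ T := by exact_mod_cast hT
  set Q : Finset (Fin T × Fin T) := Finset.univ.filter fun p => p.1 < p.2 with hQ
  set X : Fin T × Fin T → Ω → ℝ := fun p ω => h (Z p.1 ω, Z p.2 ω) with hX
  have hsum : ∀ f : Fin T × Fin T → ℝ,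
      ∑ t : Fin T, ∑ s ∈ Finset.Ioi t, f (t, s) = ∑ p ∈ Q, f p := by
    intro f
    rw [hQ, Finset.sum_filter, Fintype.sum_prod_type]
    refine Finset.sum_congr rfl fun t _ => ?_
    rw [← Finset.sum_filter]
    refine Finset.sum_congr ?_ fun _ _ => rfl
    ext s; simp
  have hcard : (Q.card : ℝ) = T * ((T : ℝ) - 1) / 2 := by
    have := hsum fun _ => 1
    simp only [Finset.sum_const, nsmul_eq_mul, mul_one] at this
    rw [← this, sum_card_Ioi]
  set k : ℝ := 2 / ((T : ℝ) * ((T : ℝ) - 1)) with hk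
  have hU : (fun ω => pairAvg (fun t s => h (Z t ω, Z s ω))) = fun ω => k * ∑ p ∈ Q, X p ω := by
    funext ω
    rw [pairAvg, ← hsum fun p => X p ω]
  have hXL : ∀ p ∈ Q, MemLp (X p) 2 P := fun p hp => hL _ _ (Finset.mem_filter.1 hp).2
  have hXV : ∀ p ∈ Q, ∫ ω, X p ω ^ 2 ∂P ≤ V := fun p hp => hle _ _ (Finset.mem_filter.1 hp).2
  have hUL : MemLp (fun ω => k * ∑ p ∈ Q, X p ω) 2 P := (memLp_finsetSum Q hXL).const_mul k
  -- Pairs without a common index are independent and contribute nothing. The overlap is bounded by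
  -- a sum of four indicators, so that summing over all `q` gives `4 T V` without counting cases.
  have hcov : ∀ p ∈ Q, ∀ q ∈ Q, cov[X p, X q; P] ≤
      ((if q.1 = p.1 then V else 0) + (if q.1 = p.2 then V else 0)) +
      ((if q.2 = p.1 then V else 0) + (if q.2 = p.2 then V else 0)) := by
    intro p hp q hq
    have hi : ∀ c : Prop, [Decidable c] → 0 ≤ if c then V else 0 := by
      intro c _; split_ifs <;> simp [hV]
    by_cases ho : q.1 = p.1 ∨ q.1 = p.2 ∨ q.2 = p.1 ∨ q.2 = p.2
    · have hc := covariance_le_of_sq_le (hXL p hp) (hXL q hq) (hXV p hp) (hXV q hq)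
      have h1 := hi (q.1 = p.1)
      have h2 := hi (q.1 = p.2)
      have h3 := hi (q.2 = p.1)
      have h4 := hi (q.2 = p.2)
      rcases ho with ho | ho | ho | ho <;> simp only [ho, if_true] at h1 h2 h3 h4 ⊢ <;> linarith
    · push Not at ho
      have hind2 := (hind.indepFun_prodMk_prodMk₀ hZ p.1 p.2 q.1 q.2 (Ne.symm ho.1)
        (Ne.symm ho.2.2.1) (Ne.symm ho.2.1) (Ne.symm ho.2.2.2)).comp hm hm
      have h0 : cov[X p, X q; P] = 0 := hind2.covariance_eq_zero (hXL p hp) (hXL q hq)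
      rw [h0]
      have h1 := hi (q.1 = p.1)
      have h2 := hi (q.1 = p.2)
      have h3 := hi (q.2 = p.1)
      have h4 := hi (q.2 = p.2)
      linarith
  have hcount : ∀ p : Fin T × Fin T, ∑ q : Fin T × Fin T,
      (((if q.1 = p.1 then V else 0) + (if q.1 = p.2 then V else 0)) +
      ((if q.2 = p.1 then V else 0) + (if q.2 = p.2 then V else 0))) = 4 * T * V := by
    intro p
    have hfst : ∀ a : Fin T, ∑ q : Fin T × Fin T, (if q.1 = a then V else 0) = T * V := by
      intro a; rw [Fintype.sum_prod_type, Finset.sum_comm]; simp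
    have hsnd : ∀ a : Fin T, ∑ q : Fin T × Fin T, (if q.2 = a then V else 0) = T * V := by
      intro a; rw [Fintype.sum_prod_type]; simp
    rw [Finset.sum_add_distrib, Finset.sum_add_distrib, Finset.sum_add_distrib, hfst, hfst, hsnd,
      hsnd]
    ring
  have hvar : Var[fun ω => k * ∑ p ∈ Q, X p ω; P] ≤ 16 / T * V := by
    rw [variance_const_mul, variance_fun_sum' hXL]
    have h1 : ∑ p ∈ Q, ∑ q ∈ Q, cov[X p, X q; P] ≤ Q.card * (4 * T * V) := by
      rw [← nsmul_eq_mul, ← Finset.sum_const]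
      refine Finset.sum_le_sum fun p hp => ?_
      refine (Finset.sum_le_sum fun q hq => hcov p hp q hq).trans ?_
      rw [← hcount p]
      refine Finset.sum_le_sum_of_subset_of_nonneg (Finset.subset_univ _) fun q _ _ => ?_
      have hi : ∀ c : Prop, [Decidable c] → 0 ≤ if c then V else 0 := by
        intro c _; split_ifs <;> simp [hV]
      exact add_nonneg (add_nonneg (hi _) (hi _)) (add_nonneg (hi _) (hi _))
    refine (mul_le_mul_of_nonneg_left h1 (sq_nonneg k)).trans ?_
    have hT1 : (0 : ℝ) < T - 1 := by linarith
    have hT0 : (0 : ℝ) < T := by linarith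
    -- Normalization times number of pairs times overlap. The remaining `8/(T-1)` is at most `16/T`
    -- because `T ≥ 2`.
    have : k ^ 2 * (Q.card * (4 * T * V)) = 8 / ((T : ℝ) - 1) * V := by
      rw [hcard, hk]; field_simp; ring
    rw [this]
    refine mul_le_mul_of_nonneg_right ?_ hV
    rw [div_le_div_iff₀ hT1 hT0]
    linarith
  have hU' : ∀ ω, pairAvg (fun t s => h (Z t ω, Z s ω)) = k * ∑ p ∈ Q, X p ω :=
    fun ω => congrFun hU ω
  simp_rw [hU']
  rw [variance_eq_integral hUL.1.aemeasurable] at hvar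
  exact ⟨(hUL.sub (memLp_const _)).integrable_sq, hvar⟩

end PairAverages

end GroupedFactor

namespace GroupedFactor

/-! ### Complete-linkage clustering of separated groups -/

section Clustering

variable {N : ℕ} {d : Fin N → Fin N → ℝ}

theorem finite_linkage_set (d : Fin N → Fin N → ℝ) (A B : Finset (Fin N)) :
    {x | ∃ i ∈ A, ∃ j ∈ B, x = d i j}.Finite := by
  refine (Set.finite_range fun p : Fin N × Fin N => d p.1 p.2).subset ?_
  rintro x ⟨i, _, j, _, rfl⟩
  exact ⟨(i, j), rfl⟩

theorem le_linkage {A B : Finset (Fin N)} {i j : Fin N} (hi : i ∈ A) (hj : j ∈ B) :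
    d i j ≤ linkage d A B :=
  le_csSup (finite_linkage_set d A B).bddAbove ⟨i, hi, j, hj, rfl⟩

theorem exists_linkage_eq {A B : Finset (Fin N)} (hA : A.Nonempty) (hB : B.Nonempty) :
    ∃ i ∈ A, ∃ j ∈ B, linkage d A B = d i j := by
  obtain ⟨i, hi⟩ := hA
  obtain ⟨j, hj⟩ := hB
  exact Set.Nonempty.csSup_mem (s := {x | ∃ i ∈ A, ∃ j ∈ B, x = d i j}) ⟨_, i, hi, j, hj, rfl⟩
    (finite_linkage_set d A B)

variable {P Q : Finpartition (Finset.univ : Finset (Fin N))}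

theorem part_mem_parts (P : Finpartition (Finset.univ : Finset (Fin N))) (i : Fin N) :
    P.part i ∈ P.parts := P.part_mem.2 (Finset.mem_univ i)

theorem mem_part_self (P : Finpartition (Finset.univ : Finset (Fin N))) (i : Fin N) :
    i ∈ P.part i := P.mem_part (Finset.mem_univ i)

theorem IsClosestMerge.card_parts (h : IsClosestMerge d P Q) :
    Q.parts.card + 1 = P.parts.card := by
  obtain ⟨A, hA, B, hB, hAB, -, hQ⟩ := h
  have hU : A ∪ B ∉ P.parts := by
    intro hU
    have hA' := P.eq_of_mem_parts hA hU (P.nonempty_of_mem_parts hA).choose_spec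
      (Finset.mem_union_left _ (P.nonempty_of_mem_parts hA).choose_spec)
    have hB' := P.eq_of_mem_parts hB hU (P.nonempty_of_mem_parts hB).choose_spec
      (Finset.mem_union_right _ (P.nonempty_of_mem_parts hB).choose_spec)
    exact hAB (hA'.trans hB'.symm)
  have h2 : 1 < P.parts.card := Finset.one_lt_card.2 ⟨A, hA, B, hB, hAB⟩
  rw [hQ, Finset.card_insert_of_notMem (fun h => hU (Finset.mem_of_mem_erase
    (Finset.mem_of_mem_erase h))), Finset.card_erase_of_mem (Finset.mem_erase.2 ⟨hAB.symm, hB⟩),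
    Finset.card_erase_of_mem hA]
  omega

theorem IsClosestMerge.part_eq (h : IsClosestMerge d P Q) {i j : Fin N}
    (hij : P.part i = P.part j) : Q.part i = Q.part j := by
  obtain ⟨A, hA, B, hB, -, -, hQ⟩ := h
  have hj : j ∈ P.part i := hij ▸ mem_part_self P j
  suffices ∃ C ∈ Q.parts, P.part i ⊆ C by
    obtain ⟨C, hC, hs⟩ := this
    rw [Q.part_eq_of_mem hC (hs (mem_part_self P i)), Q.part_eq_of_mem hC (hs hj)]
  by_cases h1 : P.part i = A
  · exact ⟨A ∪ B, by simp [hQ], h1 ▸ Finset.subset_union_left⟩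
  by_cases h2 : P.part i = B
  · exact ⟨A ∪ B, by simp [hQ], h2 ▸ Finset.subset_union_right⟩
  · exact ⟨P.part i, by simp [hQ, h1, h2], subset_rfl⟩

variable {G : ℕ → Finpartition (Finset.univ : Finset (Fin N))}

theorem IsAHCRun.card_parts (h : IsAHCRun d G) {K : ℕ} (h1 : 1 ≤ K) (hK : K ≤ N) :
    (G K).parts.card = K := by
  refine Nat.decreasingInduction' (P := fun K => 1 ≤ K → (G K).parts.card = K) ?_ hK ?_ h1
  · intro k hk _ ih h1
    have := (h.2 k h1 hk).card_parts
    rw [ih (by omega)] at this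
    omega
  · intro _
    rw [h.1]
    simp

theorem IsAHCRun.part_eq (h : IsAHCRun d G) {K L : ℕ} (h1 : 1 ≤ K) (hKL : K ≤ L) (hL : L ≤ N)
    {i j : Fin N} (hij : (G L).part i = (G L).part j) : (G K).part i = (G K).part j := by
  refine Nat.decreasingInduction' (P := fun K => 1 ≤ K → (G K).part i = (G K).part j) ?_ hKL ?_ h1
  · intro k hk _ ih h1
    exact (h.2 k h1 (by omega)).part_eq (ih (by omega))
  · exact fun _ => hij

variable {K₀ : ℕ} {grp : Fin N → Fin K₀}

/-- With more clusters than groups, two clusters lie in the same group. By complete linkage their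
distance is the distance of two units of one group, which lies below every between-group distance.
The closest pair therefore cannot mix groups. -/
theorem IsClosestMerge.refines (h : IsClosestMerge d P Q)
    (hsep : ∀ i j k l, grp i = grp j → grp k ≠ grp l → d i j < d k l)
    (hcard : K₀ < P.parts.card) (hP : ∀ C ∈ P.parts, ∀ i ∈ C, ∀ j ∈ C, grp i = grp j) :
    ∀ C ∈ Q.parts, ∀ i ∈ C, ∀ j ∈ C, grp i = grp j := by
  obtain ⟨A, hA, B, hB, hAB, hmin, hQ⟩ := h
  have hne : ∀ C ∈ P.parts, C.Nonempty := fun C hC => P.nonempty_of_mem_parts hC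
  obtain ⟨a, ha⟩ := hne A hA
  obtain ⟨b, hb⟩ := hne B hB
  have hab : grp a = grp b := by
    by_contra hab
    -- The value on the empty set is arbitrary, since parts are nonempty.
    let rep : Finset (Fin N) → Fin K₀ := fun C => if hC : C.Nonempty then grp hC.choose else grp a
    obtain ⟨C, hC, E, hE, hCE, hrep⟩ := Finset.exists_ne_map_eq_of_card_lt_of_maps_to
      (s := P.parts) (t := Finset.univ) (f := rep) (by simpa using hcard) (fun _ _ => by simp)
    obtain ⟨i, hi, j, hj, hl⟩ := exists_linkage_eq (d := d) (hne C hC) (hne E hE)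
    have hij : grp i = grp j := by
      have h1 : rep C = grp (hne C hC).choose := dif_pos (hne C hC)
      have h2 : rep E = grp (hne E hE).choose := dif_pos (hne E hE)
      rw [hP C hC i hi _ (hne C hC).choose_spec, hP E hE j hj _ (hne E hE).choose_spec, ← h1, ← h2,
        hrep]
    have h3 := hmin C hC E hE hCE
    have h4 := le_linkage (d := d) ha hb
    have h5 := hsep i j a b hij hab
    linarith
  have hAall : ∀ i ∈ A ∪ B, grp i = grp a := by
    intro i hi
    rcases Finset.mem_union.1 hi with hi | hi
    · exact hP A hA i hi a ha
    · rw [hab]; exact hP B hB i hi b hb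
  intro C hC i hi j hj
  rw [hQ, Finset.mem_insert] at hC
  rcases hC with rfl | hC
  · rw [hAall i hi, hAall j hj]
  · exact hP C (Finset.mem_of_mem_erase (Finset.mem_of_mem_erase hC)) i hi j hj

theorem IsAHCRun.refines (h : IsAHCRun d G)
    (hsep : ∀ i j k l, grp i = grp j → grp k ≠ grp l → d i j < d k l) (h1 : 1 ≤ K₀)
    (hN : K₀ ≤ N) : ∀ C ∈ (G K₀).parts, ∀ i ∈ C, ∀ j ∈ C, grp i = grp j := by
  refine Nat.decreasingInduction'
    (P := fun K => ∀ C ∈ (G K).parts, ∀ i ∈ C, ∀ j ∈ C, grp i = grp j) ?_ hN ?_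
  · intro k hk hk0 ih
    refine (h.2 k (by omega) hk).refines hsep ?_ ih
    rw [h.card_parts (by omega) (by omega)]
    omega
  · intro C hC i hi j hj
    rw [h.1, Finpartition.parts_bot] at hC
    obtain ⟨a, -, rfl⟩ := Finset.mem_map.1 hC
    simp only [Function.Embedding.coeFn_mk, Finset.mem_singleton] at hi hj
    rw [hi, hj]

/-- Complete linkage recovers well separated groups. -/
theorem IsAHCRun.part_eq_group (h : IsAHCRun d G)
    (hsep : ∀ i j k l, grp i = grp j → grp k ≠ grp l → d i j < d k l) (h1 : 1 ≤ K₀)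
    (hN : K₀ ≤ N) (hsurj : Function.Surjective grp) (i : Fin N) :
    (G K₀).part i = Finset.univ.filter fun j => grp j = grp i := by
  have href := h.refines hsep h1 hN
  choose r hr using hsurj
  have hinj : Set.InjOn (fun k => (G K₀).part (r k)) (Finset.univ : Finset (Fin K₀)) := by
    intro k _ l _ hkl
    have := href _ (part_mem_parts (G K₀) (r k)) _ (mem_part_self _ (r k)) (r l)
      (by simp only at hkl; rw [hkl]; exact mem_part_self _ _)
    rwa [hr, hr] at this
  -- Every cluster lies in one group, so groups inject into clusters. There are `K₀` of each, so
  -- each cluster is hit and is an entire group.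
  have hsur := Finset.surj_on_of_inj_on_of_card_le (s := Finset.univ) (t := (G K₀).parts)
    (fun k _ => (G K₀).part (r k)) (fun k _ => part_mem_parts _ _)
    (fun k l _ _ hkl => hinj (Finset.mem_coe.2 (Finset.mem_univ k))
      (Finset.mem_coe.2 (Finset.mem_univ l)) hkl)
    (by rw [h.card_parts h1 hN]; simp)
  have hcell : ∀ j, (G K₀).part j = (G K₀).part (r (grp j)) := by
    intro j
    obtain ⟨k, -, hk⟩ := hsur _ (part_mem_parts _ j)
    have : grp j = k := by
      have := href _ (part_mem_parts (G K₀) j) _ (mem_part_self _ j) (r k)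
        (by rw [hk]; exact mem_part_self _ _)
      rwa [hr] at this
    rw [this]; exact hk
  ext j
  simp only [Finset.mem_filter, Finset.mem_univ, true_and]
  constructor
  · intro hj
    exact (href _ (part_mem_parts (G K₀) i) _ (mem_part_self _ i) j hj).symm
  · intro hj
    rw [hcell i, ← hj, ← hcell j]
    exact mem_part_self _ _

/-- With fewer than `K₀` clusters, two of the groups are merged. -/
theorem IsAHCRun.exists_merged (h : IsAHCRun d G)
    (hsep : ∀ i j k l, grp i = grp j → grp k ≠ grp l → d i j < d k l)
    (hN : K₀ ≤ N) (hsurj : Function.Surjective grp) {K : ℕ} (hK1 : 1 ≤ K) (hK : K < K₀) :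
    ∃ i j, grp i ≠ grp j ∧ ∀ i', grp i' = grp i ∨ grp i' = grp j →
      (G K).part i' = (G K).part i := by
  have hpart := h.part_eq_group hsep (by omega) hN hsurj
  choose r hr using hsurj
  obtain ⟨k, -, l, -, hkl, hp⟩ := Finset.exists_ne_map_eq_of_card_lt_of_maps_to
    (s := (Finset.univ : Finset (Fin K₀))) (t := (G K).parts) (f := fun k => (G K).part (r k))
    (by rw [h.card_parts hK1 (by omega)]; simpa using hK) (fun _ _ => part_mem_parts _ _)
  have hsame : ∀ i' i, grp i' = grp i → (G K).part i' = (G K).part i := by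
    intro i' i hi
    refine h.part_eq hK1 hK.le hN ?_
    rw [hpart, hpart, hi]
  refine ⟨r k, r l, by rwa [hr, hr], fun i' hi' => ?_⟩
  rcases hi' with hi' | hi'
  · exact hsame _ _ hi'
  · exact (hsame _ _ hi').trans hp.symm

end Clustering

end GroupedFactor

namespace GroupedFactor

/-! ### Frobenius norm -/

section Frobenius

open scoped Matrix.Norms.Frobenius

variable {a b c : Type*} [Fintype a] [Fintype b] [Fintype c]

theorem frob_sq (A : Matrix a b ℝ) : ‖A‖ ^ 2 = ∑ i, ∑ j, A i j ^ 2 := by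
  rw [Matrix.frobenius_norm_def, ← Real.sqrt_eq_rpow, Real.sq_sqrt]
  · simp
  · exact Finset.sum_nonneg fun _ _ => Finset.sum_nonneg fun _ _ => by positivity

theorem frob_entry_le (A : Matrix a b ℝ) (i : a) (j : b) : |A i j| ≤ ‖A‖ := by
  refine abs_le_of_sq_le_sq ?_ (norm_nonneg _)
  rw [frob_sq]
  exact (Finset.single_le_sum (f := fun j => A i j ^ 2) (fun _ _ => sq_nonneg _)
    (Finset.mem_univ j)).trans (Finset.single_le_sum (f := fun i => ∑ j, A i j ^ 2)
      (fun _ _ => Finset.sum_nonneg fun _ _ => sq_nonneg _) (Finset.mem_univ i))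

theorem trace_transpose_mul (A B : Matrix a b ℝ) :
    (A.transpose * B).trace = ∑ i, ∑ j, A i j * B i j := by
  simp only [Matrix.trace, Matrix.diag, Matrix.mul_apply, Matrix.transpose_apply]
  exact Finset.sum_comm

theorem frob_add_sq (A B : Matrix a b ℝ) :
    ‖A + B‖ ^ 2 = ‖A‖ ^ 2 + 2 * (A.transpose * B).trace + ‖B‖ ^ 2 := by
  rw [trace_transpose_mul, frob_sq, frob_sq, frob_sq, Finset.mul_sum, ← Finset.sum_add_distrib,
    ← Finset.sum_add_distrib]
  refine Finset.sum_congr rfl fun i _ => ?_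
  rw [Finset.mul_sum, ← Finset.sum_add_distrib, ← Finset.sum_add_distrib]
  exact Finset.sum_congr rfl fun j _ => by simp; ring

theorem frob_add_sq_of_orthogonal {A B : Matrix a b ℝ} (h : A.transpose * B = 0) :
    ‖A + B‖ ^ 2 = ‖A‖ ^ 2 + ‖B‖ ^ 2 := by
  rw [frob_add_sq, h, Matrix.trace_zero]; ring

theorem frob_trace_self (A : Matrix a b ℝ) : (A.transpose * A).trace = ‖A‖ ^ 2 := by
  rw [trace_transpose_mul, frob_sq]
  simp_rw [sq]

/-- Cauchy-Schwarz, read off from the triangle inequality by expanding `‖A + B‖ ^ 2`. -/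
theorem trace_transpose_mul_le (A B : Matrix a b ℝ) : (A.transpose * B).trace ≤ ‖A‖ * ‖B‖ := by
  have h := norm_add_le A B
  have h1 := frob_add_sq A B
  have h2 : ‖A + B‖ ^ 2 ≤ (‖A‖ + ‖B‖) ^ 2 := by gcongr
  nlinarith

/-- `κ` bounds the smallest singular value of `A` from below. -/
def LowerBound {k : ℕ} (κ : ℝ) (A : Matrix a (Fin k) ℝ) : Prop :=
  ∀ (n : ℕ) (X : Matrix (Fin k) (Fin n) ℝ), κ * ‖X‖ ≤ ‖A * X‖

theorem LowerBound.isUnit_det {k : ℕ} {κ : ℝ} (hκ : 0 < κ) {A : Matrix a (Fin k) ℝ}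
    (hA : LowerBound κ A) : IsUnit (A.transpose * A).det := by
  rw [isUnit_iff_ne_zero]
  intro h0
  obtain ⟨v, hv, hv0⟩ := Matrix.exists_mulVec_eq_zero_iff.2 h0
  set X : Matrix (Fin k) (Fin 1) ℝ := Matrix.of fun i _ => v i with hX
  have hAX : A.transpose * A * X = 0 := by
    ext i j
    have := congrFun hv0 i
    simpa [Matrix.mul_apply, Matrix.mulVec, dotProduct, hX] using this
  have h1 : ‖A * X‖ ^ 2 = 0 := by
    rw [← frob_trace_self, Matrix.transpose_mul, Matrix.mul_assoc, ← Matrix.mul_assoc A.transpose,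
      hAX, Matrix.mul_zero, Matrix.trace_zero]
  have h2 := hA 1 X
  rw [pow_eq_zero_iff two_ne_zero] at h1
  have h3 : ‖X‖ = 0 := by
    have := norm_nonneg X
    nlinarith
  refine hv (funext fun i => ?_)
  have := frob_entry_le X i 0
  rw [h3] at this
  exact abs_nonpos_iff.1 this

theorem LowerBound.isUnit_det_square {k : ℕ} {κ : ℝ} (hκ : 0 < κ) {A : Matrix (Fin k) (Fin k) ℝ}
    (hA : LowerBound κ A) : IsUnit A.det := by
  have := hA.isUnit_det hκ
  rw [Matrix.det_mul, IsUnit.mul_iff] at this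
  exact this.2

end Frobenius

/-! ### Projection on the estimated factors and decomposition of the fit -/

section Projection

open scoped Matrix.Norms.Frobenius

variable {m N T : ℕ}

/-- The projection onto the column space of `Ft`. -/
def colProj (Ft : Matrix (Fin T) (Fin m) ℝ) : Matrix (Fin T) (Fin T) ℝ :=
  Ft * ((Ft.transpose * Ft)⁻¹ * Ft.transpose)

theorem colProj_transpose (Ft : Matrix (Fin T) (Fin m) ℝ) :
    (colProj Ft).transpose = colProj Ft := by
  unfold colProj
  rw [Matrix.transpose_mul, Matrix.transpose_mul, Matrix.transpose_transpose,
    Matrix.transpose_nonsing_inv, Matrix.transpose_mul, Matrix.transpose_transpose,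
    Matrix.mul_assoc]

variable {Ft : Matrix (Fin T) (Fin m) ℝ} {n : ℕ}

theorem colProj_mul_self (h : IsUnit (Ft.transpose * Ft).det) : colProj Ft * Ft = Ft := by
  unfold colProj
  rw [Matrix.mul_assoc, Matrix.mul_assoc, Matrix.nonsing_inv_mul _ h, Matrix.mul_one]

theorem colProj_idem (h : IsUnit (Ft.transpose * Ft).det) :
    colProj Ft * colProj Ft = colProj Ft := by
  conv_lhs => rw [colProj.eq_def Ft, ← Matrix.mul_assoc, ← colProj.eq_def Ft, colProj_mul_self h]
  rfl

theorem colProj_orthogonal (h : IsUnit (Ft.transpose * Ft).det) (X Z : Matrix (Fin T) (Fin n) ℝ) :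
    (X - colProj Ft * X).transpose * (colProj Ft * Z) = 0 := by
  rw [Matrix.transpose_sub, Matrix.transpose_mul, colProj_transpose, Matrix.sub_mul,
    Matrix.mul_assoc, ← Matrix.mul_assoc (colProj Ft), colProj_idem h, sub_self]

theorem colProj_pythagoras (h : IsUnit (Ft.transpose * Ft).det)
    (X Z : Matrix (Fin T) (Fin n) ℝ) :
    ‖X - colProj Ft * Z‖ ^ 2 = ‖X - colProj Ft * X‖ ^ 2 + ‖colProj Ft * (X - Z)‖ ^ 2 := by
  rw [← frob_add_sq_of_orthogonal (colProj_orthogonal h X _), Matrix.mul_sub]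
  congr 2
  abel

theorem colProj_sq_add (h : IsUnit (Ft.transpose * Ft).det) (X : Matrix (Fin T) (Fin n) ℝ) :
    ‖X‖ ^ 2 = ‖X - colProj Ft * X‖ ^ 2 + ‖colProj Ft * X‖ ^ 2 := by
  have := colProj_pythagoras h X 0
  simpa using this

theorem norm_colProj_le (h : IsUnit (Ft.transpose * Ft).det) (X : Matrix (Fin T) (Fin n) ℝ) :
    ‖colProj Ft * X‖ ≤ ‖X‖ := by
  refine le_of_sq_le_sq ?_ (norm_nonneg _)
  rw [colProj_sq_add h X]
  nlinarith [sq_nonneg ‖X - colProj Ft * X‖]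

theorem norm_sub_colProj_le (h : IsUnit (Ft.transpose * Ft).det) (X : Matrix (Fin T) (Fin n) ℝ) :
    ‖X - colProj Ft * X‖ ≤ ‖X‖ := by
  refine le_of_sq_le_sq ?_ (norm_nonneg _)
  rw [colProj_sq_add h X]
  nlinarith [sq_nonneg ‖colProj Ft * X‖]

/-- With `β` the regression coefficients, the normal equations give `‖Ft β‖² = ⟨β, Ftᵀ X⟩ ≤ ‖β‖ ‖Ftᵀ
X‖`, and `κ ‖β‖ ≤ ‖Ft β‖`. This converts small cross products of factors and errors into small
projected errors. -/
theorem LowerBound.norm_colProj_le {κ : ℝ} (hκ : 0 < κ) (hF : LowerBound κ Ft)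
    (X : Matrix (Fin T) (Fin n) ℝ) : κ * ‖colProj Ft * X‖ ≤ ‖Ft.transpose * X‖ := by
  have h := hF.isUnit_det hκ
  set β := (Ft.transpose * Ft)⁻¹ * Ft.transpose * X with hβ
  have e : colProj Ft * X = Ft * β := by rw [hβ, colProj, Matrix.mul_assoc]
  have h1 : ‖Ft * β‖ ^ 2 = (β.transpose * (Ft.transpose * X)).trace := by
    have hn : Ft.transpose * (Ft * β) = Ft.transpose * X := by
      rw [← Matrix.mul_assoc, hβ, Matrix.mul_assoc _ Ft.transpose X,
        ← Matrix.mul_assoc (Ft.transpose * Ft), Matrix.mul_nonsing_inv _ h, Matrix.one_mul]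
    rw [← frob_trace_self, Matrix.transpose_mul, Matrix.mul_assoc, hn]
  have h2 := trace_transpose_mul_le β (Ft.transpose * X)
  have h3 := hF n β
  rw [e]
  by_cases h0 : ‖Ft * β‖ = 0
  · rw [h0, mul_zero]; exact norm_nonneg _
  have hp : 0 < ‖Ft * β‖ := lt_of_le_of_ne (norm_nonneg _) (Ne.symm h0)
  refine le_of_mul_le_mul_left ?_ hp
  calc ‖Ft * β‖ * (κ * ‖Ft * β‖) = κ * ‖Ft * β‖ ^ 2 := by ring
    _ ≤ κ * (‖β‖ * ‖Ft.transpose * X‖) := by rw [h1]; gcongr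
    _ = (κ * ‖β‖) * ‖Ft.transpose * X‖ := by ring
    _ ≤ _ := by gcongr

/-- Averaging over the cells of a grouping. -/
def avgMat (cell : Fin N → Finset (Fin N)) : Matrix (Fin N) (Fin N) ℝ :=
  Matrix.of fun j i => if j ∈ cell i then ((cell i).card : ℝ)⁻¹ else 0

theorem mul_avgMat_apply {a : Type*} (X : Matrix a (Fin N) ℝ) (cell : Fin N → Finset (Fin N))
    (t : a) (i : Fin N) :
    (X * avgMat cell) t i = ((cell i).card : ℝ)⁻¹ * ∑ j ∈ cell i, X t j := by
  simp only [Matrix.mul_apply, avgMat, Matrix.of_apply, mul_ite, mul_zero]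
  rw [Finset.sum_ite_mem, Finset.univ_inter, Finset.mul_sum]
  exact Finset.sum_congr rfl fun j _ => mul_comm _ _

theorem groupedLoading_transpose (Y : Matrix (Fin T) (Fin N) ℝ) (L : Matrix (Fin N) (Fin m) ℝ)
    (cell : Fin N → Finset (Fin N)) : (groupedLoading Y L cell).transpose =
      ((factorEst Y L).transpose * factorEst Y L)⁻¹ * (factorEst Y L).transpose *
        (Y * avgMat cell) := by
  ext k i
  rw [Matrix.transpose_apply, Matrix.mul_apply]
  simp only [groupedLoading, Matrix.of_apply, Pi.smul_apply, smul_eq_mul, Matrix.mulVec,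
    dotProduct, mul_avgMat_apply, Finset.mul_sum, Finset.sum_apply]
  refine Finset.sum_congr rfl fun t _ => Finset.sum_congr rfl fun j _ => ?_
  ring

theorem fitS_eq (Y : Matrix (Fin T) (Fin N) ℝ) (L : Matrix (Fin N) (Fin m) ℝ)
    (cell : Fin N → Finset (Fin N)) : fitS Y L cell =
      ((N : ℝ) * T)⁻¹ * ‖Y - colProj (factorEst Y L) * (Y * avgMat cell)‖ ^ 2 := by
  rw [fitS, frob_sq, Finset.sum_comm]
  congr 1
  refine Finset.sum_congr rfl fun t _ => Finset.sum_congr rfl fun i _ => ?_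
  congr 1
  rw [Matrix.sub_apply, colProj, Matrix.mul_assoc, ← groupedLoading_transpose, Matrix.mul_apply]
  congr 1
  simp only [dotProduct, Matrix.transpose_apply]
  exact Finset.sum_congr rfl fun _ _ => mul_comm _ _

/-- Only the second summand depends on the grouping, so comparisons of groupings reduce to projected
deviations from cell averages. -/
theorem fitS_decomp {Y : Matrix (Fin T) (Fin N) ℝ} {L : Matrix (Fin N) (Fin m) ℝ}
    (h : IsUnit ((factorEst Y L).transpose * factorEst Y L).det)
    (cell : Fin N → Finset (Fin N)) : fitS Y L cell = ((N : ℝ) * T)⁻¹ *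
      (‖Y - colProj (factorEst Y L) * Y‖ ^ 2 +
        ‖colProj (factorEst Y L) * (Y - Y * avgMat cell)‖ ^ 2) := by
  rw [fitS_eq, colProj_pythagoras h]

end Projection

/-! ### Averaging over the true groups -/

section TrueGroups

open scoped Matrix.Norms.Frobenius

variable {N K₀ : ℕ} (grp : Fin N → Fin K₀)

/-- The cells of the grouping given by labels. -/
def labelCell (i : Fin N) : Finset (Fin N) := Finset.univ.filter fun j => grp j = grp i

theorem labelCell_card_pos (i : Fin N) : 0 < ((labelCell grp i).card : ℝ) := by
  have : 0 < (labelCell grp i).card := Finset.card_pos.2 ⟨i, by simp [labelCell]⟩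
  exact_mod_cast this

theorem mul_avgMat_label_of_const {a : Type*} {X : Matrix a (Fin N) ℝ}
    (hX : ∀ t i j, grp i = grp j → X t i = X t j) : X * avgMat (labelCell grp) = X := by
  ext t i
  rw [mul_avgMat_apply, Finset.sum_congr rfl (g := fun _ => X t i), Finset.sum_const, nsmul_eq_mul,
    inv_mul_cancel_left₀ (labelCell_card_pos grp i).ne']
  intro j hj
  exact hX t j i (Finset.mem_filter.1 hj).2

theorem avgMat_label_transpose : (avgMat (labelCell grp)).transpose = avgMat (labelCell grp) := by
  ext i j
  simp only [Matrix.transpose_apply, avgMat, Matrix.of_apply]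
  by_cases h : grp i = grp j
  · simp [labelCell, h]
  · simp [labelCell, h, Ne.symm h]

theorem avgMat_label_idem :
    avgMat (labelCell grp) * avgMat (labelCell grp) = avgMat (labelCell grp) := by
  refine mul_avgMat_label_of_const grp fun t i j hij => ?_
  have : labelCell grp i = labelCell grp j := by simp [labelCell, hij]
  simp [avgMat, this]

/-- Centering within groups does not increase the norm. -/
theorem norm_sub_avgMat_label_le {a : Type*} [Fintype a] (X : Matrix a (Fin N) ℝ) :
    ‖X - X * avgMat (labelCell grp)‖ ≤ ‖X‖ := by
  set J := avgMat (labelCell grp) with hJ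
  have hT : J.transpose = J := avgMat_label_transpose grp
  have hI : J * J = J := avgMat_label_idem grp
  rw [← Matrix.frobenius_norm_transpose (X - X * J), ← Matrix.frobenius_norm_transpose X]
  refine le_of_sq_le_sq ?_ (norm_nonneg _)
  have ho : (X - X * J).transpose.transpose * (X * J).transpose = 0 := by
    rw [Matrix.transpose_transpose, Matrix.transpose_mul, hT, ← Matrix.mul_assoc, Matrix.sub_mul,
      Matrix.mul_assoc X, hI, sub_self, Matrix.zero_mul]
  have := frob_add_sq_of_orthogonal ho
  rw [← Matrix.transpose_add, sub_add_cancel] at this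
  rw [this]
  nlinarith [sq_nonneg ‖(X * J).transpose‖]

end TrueGroups

end GroupedFactor

namespace GroupedFactor

/-! ### Deterministic comparison of fits -/

section Fit

open scoped Matrix.Norms.Frobenius

variable {m N T : ℕ}

/-- Bounds under which the fit of a grouping is controlled; `r` is `1 / N + 1 / T`. -/
structure RegularFit (F : Matrix (Fin T) (Fin m) ℝ) (E : Matrix (Fin T) (Fin N) ℝ)
    (Λ L : Matrix (Fin N) (Fin m) ℝ) (H : Matrix (Fin m) (Fin m) ℝ) (B h s r : ℝ) : Prop where
  B_pos : 0 < B
  h_pos : 0 < h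
  s_pos : 0 < s
  N_pos : 0 < N
  T_pos : 0 < T
  r_N : 1 / (N : ℝ) ≤ r
  r_T : 1 / (T : ℝ) ≤ r
  normalized : L.transpose * L = (N : ℝ) • (1 : Matrix (Fin m) (Fin m) ℝ)
  norm_L : ‖L‖ ≤ B * √N
  norm_Λ : ‖Λ‖ ≤ B * √N
  norm_H : ‖H‖ ≤ h
  norm_sub : ‖L - Λ * H‖ ≤ B * √N * √r
  norm_E : ‖E‖ ≤ B * √N * √T
  norm_EΛ : ‖E * Λ‖ ≤ B * √N * √T
  norm_FE : ‖F.transpose * E‖ ≤ B * √N * √T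
  norm_F : ‖F‖ ≤ B * √T
  lower_F : LowerBound (s * √T) F
  small_rot : B ^ 2 * √r ≤ 1 / 2
  small_err : (B * h + B ^ 2) * √r ≤ s / (4 * h)

variable {F : Matrix (Fin T) (Fin m) ℝ} {E : Matrix (Fin T) (Fin N) ℝ}
  {Λ L : Matrix (Fin N) (Fin m) ℝ} {H : Matrix (Fin m) (Fin m) ℝ} {B h s r : ℝ}

theorem factorEst_eq (F : Matrix (Fin T) (Fin m) ℝ) (E : Matrix (Fin T) (Fin N) ℝ)
    (Λ L : Matrix (Fin N) (Fin m) ℝ) : factorEst (F * Λ.transpose + E) L =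
      F * ((N : ℝ)⁻¹ • (Λ.transpose * L)) + (N : ℝ)⁻¹ • (E * L) := by
  rw [factorEst, Matrix.add_mul, smul_add, Matrix.mul_assoc, Matrix.mul_smul]

namespace RegularFit

theorem r_pos (hR : RegularFit F E Λ L H B h s r) : 0 < r :=
  lt_of_lt_of_le (one_div_pos.2 (by exact_mod_cast hR.N_pos)) hR.r_N

theorem inv_sqrt_N_le (hR : RegularFit F E Λ L H B h s r) : 1 ≤ √r * √N := by
  have hN : (0 : ℝ) < N := by exact_mod_cast hR.N_pos
  rw [← Real.sqrt_mul hR.r_pos.le, Real.one_le_sqrt, ← div_le_iff₀ hN]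
  exact hR.r_N

theorem inv_sqrt_T_le (hR : RegularFit F E Λ L H B h s r) : 1 ≤ √r * √T := by
  have hT : (0 : ℝ) < T := by exact_mod_cast hR.T_pos
  rw [← Real.sqrt_mul hR.r_pos.le, Real.one_le_sqrt, ← div_le_iff₀ hT]
  exact hR.r_T

theorem sqrt_N_mul (hR : RegularFit F E Λ L H B h s r) : (N : ℝ)⁻¹ * (√N * √N) = 1 := by
  have hN : (0 : ℝ) < N := by exact_mod_cast hR.N_pos
  rw [Real.mul_self_sqrt hN.le, inv_mul_cancel₀ hN.ne']

theorem norm_rot (hR : RegularFit F E Λ L H B h s r) :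
    ‖(N : ℝ)⁻¹ • (Λ.transpose * L)‖ ≤ B ^ 2 := by
  rw [norm_smul, Real.norm_of_nonneg (by positivity)]
  have h1 := Matrix.frobenius_norm_mul Λ.transpose L
  rw [Matrix.frobenius_norm_transpose] at h1
  have hB := hR.B_pos
  calc (N : ℝ)⁻¹ * ‖Λ.transpose * L‖ ≤ (N : ℝ)⁻¹ * ((B * √N) * (B * √N)) := by
        gcongr
        exact h1.trans (mul_le_mul hR.norm_Λ hR.norm_L (norm_nonneg _) (by positivity))
    _ = B ^ 2 * ((N : ℝ)⁻¹ * (√N * √N)) := by ring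
    _ = B ^ 2 := by rw [hR.sqrt_N_mul, mul_one]

/-- Loadings are split as `L = Λ H + (L - Λ H)`. The first part uses that `‖E Λ‖` is smaller by a
factor `√N` than the product of the norms would suggest; the second uses that the loading error is
small. -/
theorem norm_err (hR : RegularFit F E Λ L H B h s r) :
    ‖(N : ℝ)⁻¹ • (E * L)‖ ≤ (B * h + B ^ 2) * (√T * √r) := by
  have hB := hR.B_pos
  have hh := hR.h_pos
  have e : E * L = E * Λ * H + E * (L - Λ * H) := by
    rw [Matrix.mul_sub, Matrix.mul_assoc]; abel
  have h1 : ‖E * Λ * H‖ ≤ (B * √N * √T) * h :=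
    (Matrix.frobenius_norm_mul _ _).trans
      (mul_le_mul hR.norm_EΛ hR.norm_H (norm_nonneg _) (by positivity))
  have h2 : ‖E * (L - Λ * H)‖ ≤ (B * √N * √T) * (B * √N * √r) :=
    (Matrix.frobenius_norm_mul _ _).trans
      (mul_le_mul hR.norm_E hR.norm_sub (norm_nonneg _) (by positivity))
  have h3 : √N ≤ √r * (√N * √N) := by
    have := mul_le_mul_of_nonneg_right hR.inv_sqrt_N_le (Real.sqrt_nonneg N)
    nlinarith
  rw [norm_smul, Real.norm_of_nonneg (by positivity), e]
  calc (N : ℝ)⁻¹ * ‖E * Λ * H + E * (L - Λ * H)‖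
      ≤ (N : ℝ)⁻¹ * ((B * √N * √T) * h + (B * √N * √T) * (B * √N * √r)) := by
        gcongr
        exact (norm_add_le _ _).trans (add_le_add h1 h2)
    _ ≤ (N : ℝ)⁻¹ * ((B * (√r * (√N * √N)) * √T) * h + (B * √N * √T) * (B * √N * √r)) := by
        gcongr
    _ = (B * h + B ^ 2) * (√T * √r) * ((N : ℝ)⁻¹ * (√N * √N)) := by ring
    _ = _ := by rw [hR.sqrt_N_mul, mul_one]

/-- The normalization `Lᵀ L = N` reads `Hᵀ R + D = 1` with `R = Λᵀ L / N` and `D = (L - Λ H)ᵀ L /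
N`. As `‖D‖ ≤ 1/2`, the matrix `2 Hᵀ` bounds the inverse of `R`, although no lower bound on `H` is
assumed. -/
theorem lower_rot (hR : RegularFit F E Λ L H B h s r) {n : ℕ} (X : Matrix (Fin m) (Fin n) ℝ) :
    ‖X‖ ≤ 2 * h * ‖((N : ℝ)⁻¹ • (Λ.transpose * L)) * X‖ := by
  have hB := hR.B_pos
  have hN : (0 : ℝ) < N := by exact_mod_cast hR.N_pos
  set R := (N : ℝ)⁻¹ • (Λ.transpose * L) with hRdef
  set D := (N : ℝ)⁻¹ • ((L - Λ * H).transpose * L) with hD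
  have e : X = H.transpose * (R * X) + D * X := by
    have h1 : H.transpose * R + D = 1 := by
      rw [hRdef, hD, Matrix.mul_smul, ← smul_add, ← Matrix.mul_assoc, ← Matrix.transpose_mul,
        ← Matrix.add_mul, ← Matrix.transpose_add, add_sub_cancel, hR.normalized, smul_smul,
        inv_mul_cancel₀ hN.ne', one_smul]
    rw [← Matrix.mul_assoc, ← Matrix.add_mul, h1, Matrix.one_mul]
  have hDn : ‖D‖ ≤ 1 / 2 := by
    rw [hD, norm_smul, Real.norm_of_nonneg (by positivity)]
    have h1 := Matrix.frobenius_norm_mul (L - Λ * H).transpose L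
    rw [Matrix.frobenius_norm_transpose] at h1
    calc (N : ℝ)⁻¹ * ‖(L - Λ * H).transpose * L‖
        ≤ (N : ℝ)⁻¹ * ((B * √N * √r) * (B * √N)) := by
          gcongr
          exact h1.trans (mul_le_mul hR.norm_sub hR.norm_L (norm_nonneg _) (by positivity))
      _ = B ^ 2 * √r * ((N : ℝ)⁻¹ * (√N * √N)) := by ring
      _ ≤ 1 / 2 := by rw [hR.sqrt_N_mul, mul_one]; exact hR.small_rot
  have h2 : ‖H.transpose * (R * X)‖ ≤ h * ‖R * X‖ := by
    refine (Matrix.frobenius_norm_mul _ _).trans ?_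
    rw [Matrix.frobenius_norm_transpose]
    exact mul_le_mul_of_nonneg_right hR.norm_H (norm_nonneg _)
  have h3 : ‖D * X‖ ≤ 1 / 2 * ‖X‖ :=
    (Matrix.frobenius_norm_mul _ _).trans (mul_le_mul_of_nonneg_right hDn (norm_nonneg _))
  have h4 : ‖X‖ ≤ ‖H.transpose * (R * X)‖ + ‖D * X‖ := by
    conv_lhs => rw [e]
    exact norm_add_le _ _
  linarith

/-- The rotation turns the constant `s` of the true factors into `s / (2h)`, and the averaged errors
use up at most half of that. -/
theorem lower_factorEst (hR : RegularFit F E Λ L H B h s r) :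
    LowerBound (s / (4 * h) * √T) (factorEst (F * Λ.transpose + E) L) := by
  intro n X
  have hh := hR.h_pos
  have hs := hR.s_pos
  rw [factorEst_eq, Matrix.add_mul, Matrix.mul_assoc]
  set R := (N : ℝ)⁻¹ • (Λ.transpose * L)
  set D := (N : ℝ)⁻¹ • (E * L)
  have h1 := hR.lower_F n (R * X)
  have h2 := hR.lower_rot X
  have h3 : ‖D * X‖ ≤ (B * h + B ^ 2) * (√T * √r) * ‖X‖ :=
    (Matrix.frobenius_norm_mul _ _).trans (mul_le_mul_of_nonneg_right hR.norm_err (norm_nonneg _))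
  have h4 : ‖F * (R * X)‖ - ‖D * X‖ ≤ ‖F * (R * X) + D * X‖ := norm_sub_le_norm_add _ _
  have h5 : (B * h + B ^ 2) * (√T * √r) * ‖X‖ ≤ s / (4 * h) * √T * ‖X‖ := by
    have := mul_le_mul_of_nonneg_right hR.small_err
      (mul_nonneg (Real.sqrt_nonneg T) (norm_nonneg X))
    linarith
  have h6 : s / (2 * h) * √T * ‖X‖ ≤ s * √T * ‖R * X‖ := by
    calc s / (2 * h) * √T * ‖X‖ ≤ s / (2 * h) * √T * (2 * h * ‖R * X‖) := by gcongr
      _ = _ := by field_simp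
  have h7 : s / (2 * h) * √T * ‖X‖ = 2 * (s / (4 * h) * √T * ‖X‖) := by field_simp; ring
  linarith

theorem isUnit_det (hR : RegularFit F E Λ L H B h s r) :
    IsUnit ((factorEst (F * Λ.transpose + E) L).transpose *
      factorEst (F * Λ.transpose + E) L).det := by
  refine hR.lower_factorEst.isUnit_det ?_
  have hT : (0 : ℝ) < T := by exact_mod_cast hR.T_pos
  have := hR.s_pos
  have := hR.h_pos
  positivity

/-- The constant in the bound for the projected errors. -/
def projConst (B h s : ℝ) : ℝ := B * (B ^ 2 + (B * h + B ^ 2)) / (s / (4 * h))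

/-- Dividing `‖F̃ᵀ E‖` by the lower bound of order `√T` leaves two terms. The one with `Fᵀ E` is of
order `√N ≤ √N √T √r`; the one from the errors in `F̃` carries the factor `√r` by `norm_err`. -/
theorem norm_colProj_err (hR : RegularFit F E Λ L H B h s r) :
    ‖colProj (factorEst (F * Λ.transpose + E) L) * E‖ ≤
      projConst B h s * (√N * √T * √r) := by
  have hT : (0 : ℝ) < T := by exact_mod_cast hR.T_pos
  have hB := hR.B_pos
  have hs := hR.s_pos
  have hh := hR.h_pos
  have hκ : 0 < s / (4 * h) := by positivity
  have hsT : 0 < √(T : ℝ) := Real.sqrt_pos.2 hT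
  have h1 := hR.lower_factorEst.norm_colProj_le (by positivity) E
  have e : (factorEst (F * Λ.transpose + E) L).transpose * E =
      ((N : ℝ)⁻¹ • (Λ.transpose * L)).transpose * (F.transpose * E) +
        ((N : ℝ)⁻¹ • (E * L)).transpose * E := by
    rw [factorEst_eq, Matrix.transpose_add, Matrix.add_mul, Matrix.transpose_mul F,
      Matrix.mul_assoc]
  have h2 : ‖((N : ℝ)⁻¹ • (Λ.transpose * L)).transpose * (F.transpose * E)‖ ≤
      B ^ 2 * (B * √N * √T) := by
    refine (Matrix.frobenius_norm_mul _ _).trans ?_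
    rw [Matrix.frobenius_norm_transpose]
    exact mul_le_mul hR.norm_rot hR.norm_FE (norm_nonneg _) (by positivity)
  have h3 : ‖((N : ℝ)⁻¹ • (E * L)).transpose * E‖ ≤
      ((B * h + B ^ 2) * (√T * √r)) * (B * √N * √T) := by
    refine (Matrix.frobenius_norm_mul _ _).trans ?_
    rw [Matrix.frobenius_norm_transpose]
    exact mul_le_mul hR.norm_err hR.norm_E (norm_nonneg _) (by positivity)
  have h4 : ‖(factorEst (F * Λ.transpose + E) L).transpose * E‖ ≤
      B * (B ^ 2 + (B * h + B ^ 2)) * (√N * √T * √r) * √T := by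
    rw [e]
    refine (norm_add_le _ _).trans ((add_le_add h2 h3).trans ?_)
    have : B ^ 2 * (B * √N * √T) * 1 ≤ B ^ 2 * (B * √N * √T) * (√r * √T) := by
      gcongr
      exact hR.inv_sqrt_T_le
    nlinarith
  have h5 := h1.trans h4
  rw [mul_right_comm] at h5
  have h6 := le_of_mul_le_mul_right h5 hsT
  rw [projConst, div_mul_eq_mul_div, le_div_iff₀ hκ, mul_comm]
  exact h6

/-- With `Z = R⁻¹ X` one has `F X = F̃ Z - D Z`. The projection reproduces `F̃ Z`, so only the small
term `D Z` leaves a residual. -/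
theorem norm_sub_colProj_factor (hR : RegularFit F E Λ L H B h s r) {n : ℕ}
    (X : Matrix (Fin m) (Fin n) ℝ) :
    ‖F * X - colProj (factorEst (F * Λ.transpose + E) L) * (F * X)‖ ≤
      2 * h * (B * h + B ^ 2) * (√T * √r) * ‖X‖ := by
  have hh := hR.h_pos
  have hB := hR.B_pos
  have hu := hR.isUnit_det
  set Ft := factorEst (F * Λ.transpose + E) L with hFt
  set R := (N : ℝ)⁻¹ • (Λ.transpose * L) with hRd
  set D := (N : ℝ)⁻¹ • (E * L) with hD
  have hRl : LowerBound (1 / (2 * h)) R := by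
    intro k Z
    have := hR.lower_rot Z
    rw [one_div, inv_mul_le_iff₀ (by positivity)]
    exact this
  have hRu := hRl.isUnit_det_square (by positivity)
  set Z := R⁻¹ * X with hZ
  have hRZ : R * Z = X := by rw [hZ, ← Matrix.mul_assoc, Matrix.mul_nonsing_inv _ hRu, Matrix.one_mul]
  have hFX : F * X = Ft * Z - D * Z := by
    rw [hFt, factorEst_eq, Matrix.add_mul, Matrix.mul_assoc, ← hRd, hRZ, add_sub_cancel_right]
  have e : F * X - colProj Ft * (F * X) = -(D * Z - colProj Ft * (D * Z)) := by
    rw [hFX, Matrix.mul_sub, ← Matrix.mul_assoc (colProj Ft) Ft, colProj_mul_self hu]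
    abel
  rw [e, norm_neg]
  refine (norm_sub_colProj_le hu _).trans ((Matrix.frobenius_norm_mul _ _).trans ?_)
  have h1 := hR.lower_rot Z
  rw [← hRd, hRZ] at h1
  calc ‖D‖ * ‖Z‖ ≤ ((B * h + B ^ 2) * (√T * √r)) * (2 * h * ‖X‖) :=
        mul_le_mul hR.norm_err h1 (norm_nonneg _) (by positivity)
    _ = _ := by ring

variable {K₀ : ℕ} {grp : Fin N → Fin K₀}

/-- Loadings are constant on the true groups, so averaging reproduces the common component and only
centered errors remain. Projection acts on the left and averaging on the right, so they commute, and
centering is a contraction. -/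
theorem colProj_within_le (F : Matrix (Fin T) (Fin m) ℝ) (E : Matrix (Fin T) (Fin N) ℝ)
    (L : Matrix (Fin N) (Fin m) ℝ) (hΛ : ∀ i j, grp i = grp j → Λ i = Λ j) :
    ‖colProj (factorEst (F * Λ.transpose + E) L) *
      ((F * Λ.transpose + E) - (F * Λ.transpose + E) * avgMat (labelCell grp))‖ ≤
    ‖colProj (factorEst (F * Λ.transpose + E) L) * E‖ := by
  have e : (F * Λ.transpose + E) - (F * Λ.transpose + E) * avgMat (labelCell grp) =
      E - E * avgMat (labelCell grp) := by
    rw [Matrix.add_mul, mul_avgMat_label_of_const grp (X := F * Λ.transpose)]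
    · abel
    · intro t i j hij
      simp only [Matrix.mul_apply, Matrix.transpose_apply, hΛ i j hij]
  rw [e, Matrix.mul_sub, ← Matrix.mul_assoc]
  exact norm_sub_avgMat_label_le grp _

theorem sq_sqrt_NT (hR : RegularFit F E Λ L H B h s r) :
    ((N : ℝ) * T)⁻¹ * (√N * √T * √r) ^ 2 = r := by
  have hN : (0 : ℝ) < N := by exact_mod_cast hR.N_pos
  have hT : (0 : ℝ) < T := by exact_mod_cast hR.T_pos
  rw [mul_pow, mul_pow, Real.sq_sqrt hN.le, Real.sq_sqrt hT.le, Real.sq_sqrt hR.r_pos.le]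
  field_simp

theorem inv_NT_mul_colProj_err (hR : RegularFit F E Λ L H B h s r) :
    ((N : ℝ) * T)⁻¹ * ‖colProj (factorEst (F * Λ.transpose + E) L) * E‖ ^ 2 ≤
      projConst B h s ^ 2 * r := by
  calc _ ≤ ((N : ℝ) * T)⁻¹ * (projConst B h s * (√N * √T * √r)) ^ 2 := by
        gcongr
        exact hR.norm_colProj_err
    _ = projConst B h s ^ 2 * (((N : ℝ) * T)⁻¹ * (√N * √T * √r) ^ 2) := by ring
    _ = _ := by rw [hR.sq_sqrt_NT]

/-- No grouping fits much better than the true one. -/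
theorem fitS_true_sub_le (hR : RegularFit F E Λ L H B h s r)
    (hΛ : ∀ i j, grp i = grp j → Λ i = Λ j) (cell : Fin N → Finset (Fin N)) :
    fitS (F * Λ.transpose + E) L (labelCell grp) - fitS (F * Λ.transpose + E) L cell ≤
      projConst B h s ^ 2 * r := by
  rw [fitS_decomp hR.isUnit_det, fitS_decomp hR.isUnit_det]
  refine le_trans ?_ hR.inv_NT_mul_colProj_err
  rw [← mul_sub]
  refine mul_le_mul_of_nonneg_left ?_ (by positivity)
  have h1 := pow_le_pow_left₀ (norm_nonneg _) (colProj_within_le F E L hΛ) 2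
  have h2 := sq_nonneg ‖colProj (factorEst (F * Λ.transpose + E) L) *
    ((F * Λ.transpose + E) - (F * Λ.transpose + E) * avgMat cell)‖
  linarith

theorem fitS_true_le (hR : RegularFit F E Λ L H B h s r)
    (hΛ : ∀ i j, grp i = grp j → Λ i = Λ j) :
    fitS (F * Λ.transpose + E) L (labelCell grp) ≤ (B ^ 2 + B) ^ 2 + B ^ 2 := by
  have hB := hR.B_pos
  have hN : (0 : ℝ) < N := by exact_mod_cast hR.N_pos
  have hT : (0 : ℝ) < T := by exact_mod_cast hR.T_pos
  rw [fitS_decomp hR.isUnit_det, inv_mul_le_iff₀ (by positivity)]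
  have h1 := (norm_sub_colProj_le hR.isUnit_det (F * Λ.transpose + E))
  have h2 := (colProj_within_le F E L hΛ).trans (norm_colProj_le hR.isUnit_det E)
  have h3 : ‖F * Λ.transpose + E‖ ≤ (B ^ 2 + B) * (√N * √T) := by
    refine (norm_add_le _ _).trans ?_
    have := Matrix.frobenius_norm_mul F Λ.transpose
    rw [Matrix.frobenius_norm_transpose] at this
    have h4 := this.trans (mul_le_mul hR.norm_F hR.norm_Λ (norm_nonneg _) (by positivity))
    have := hR.norm_E
    linarith
  have h5 := pow_le_pow_left₀ (norm_nonneg _) (h1.trans h3) 2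
  have h6 := pow_le_pow_left₀ (norm_nonneg _) (h2.trans hR.norm_E) 2
  have h7 : (√N * √T) ^ 2 = (N : ℝ) * T := by
    rw [mul_pow, Real.sq_sqrt hN.le, Real.sq_sqrt hT.le]
  rw [mul_assoc, mul_pow, h7] at h6
  rw [mul_pow, h7] at h5
  linarith

/-- The residual of `Y` differs from `E` by the projected errors and the residual of the common
component. Both carry a factor `√r`, so half of the size of `E` survives. -/
theorem le_fitS (hR : RegularFit F E Λ L H B h s r) {e : ℝ} (he : 0 ≤ e)
    (hE : e * √N * √T ≤ ‖E‖)
    (hsmall : (projConst B h s + 2 * h * (B * h + B ^ 2) * B) * √r ≤ e / 2)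
    (cell : Fin N → Finset (Fin N)) : e ^ 2 / 4 ≤ fitS (F * Λ.transpose + E) L cell := by
  have hB := hR.B_pos
  have hh := hR.h_pos
  have hN : (0 : ℝ) < N := by exact_mod_cast hR.N_pos
  have hT : (0 : ℝ) < T := by exact_mod_cast hR.T_pos
  have hu := hR.isUnit_det
  set Q := colProj (factorEst (F * Λ.transpose + E) L)
  have h1 : ‖E‖ - ‖Q * E‖ ≤ ‖E - Q * E‖ := norm_sub_norm_le _ _
  have h2 := hR.norm_colProj_err
  have h3 := hR.norm_sub_colProj_factor Λ.transpose
  rw [Matrix.frobenius_norm_transpose] at h3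
  have h4 : 2 * h * (B * h + B ^ 2) * (√T * √r) * ‖Λ‖ ≤
      2 * h * (B * h + B ^ 2) * (√T * √r) * (B * √N) := by
    gcongr
    exact hR.norm_Λ
  have h5 : ‖E - Q * E‖ - ‖F * Λ.transpose - Q * (F * Λ.transpose)‖ ≤
      ‖(F * Λ.transpose + E) - Q * (F * Λ.transpose + E)‖ := by
    have : (F * Λ.transpose + E) - Q * (F * Λ.transpose + E) =
        (E - Q * E) + (F * Λ.transpose - Q * (F * Λ.transpose)) := by
      rw [Matrix.mul_add]; abel
    rw [this]
    exact norm_sub_le_norm_add _ _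
  have h6 := mul_le_mul_of_nonneg_right hsmall
    (mul_nonneg (Real.sqrt_nonneg (N : ℝ)) (Real.sqrt_nonneg (T : ℝ)))
  have h7 : e / 2 * (√N * √T) ≤ ‖(F * Λ.transpose + E) - Q * (F * Λ.transpose + E)‖ := by
    nlinarith
  have h8 := pow_le_pow_left₀ (by positivity) h7 2
  have h9 : (√N * √T) ^ 2 = (N : ℝ) * T := by
    rw [mul_pow, Real.sq_sqrt hN.le, Real.sq_sqrt hT.le]
  rw [mul_pow, h9] at h8
  rw [fitS_decomp hu, ← div_eq_inv_mul, le_div_iff₀ (by positivity)]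
  have := sq_nonneg ‖Q * ((F * Λ.transpose + E) - (F * Λ.transpose + E) * avgMat cell)‖
  nlinarith

/-- A grouping that merges two true groups has a worse fit. -/
theorem fitS_merged_ge (hR : RegularFit F E Λ L H B h s r)
    (hΛ : ∀ i j, grp i = grp j → Λ i = Λ j) {cell : Fin N → Finset (Fin N)} {i j : Fin N}
    (hij : grp i ≠ grp j)
    (hcell : ∀ i', grp i' = grp i ∨ grp i' = grp j → cell i' = cell i) {τ : ℝ} (hτ : 0 ≤ τ)
    (hτi : τ * N ≤ (labelCell grp i).card) (hτj : τ * N ≤ (labelCell grp j).card) :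
    τ * s ^ 2 / 16 * (∑ a, (Λ i a - Λ j a) ^ 2) - 2 * (projConst B h s ^ 2 * r) ≤
      fitS (F * Λ.transpose + E) L cell - fitS (F * Λ.transpose + E) L (labelCell grp) := by
  have hB := hR.B_pos
  have hh := hR.h_pos
  have hs := hR.s_pos
  have hN : (0 : ℝ) < N := by exact_mod_cast hR.N_pos
  have hT : (0 : ℝ) < T := by exact_mod_cast hR.T_pos
  have hu := hR.isUnit_det
  set Y := F * Λ.transpose + E with hY
  set Q := colProj (factorEst Y L) with hQ
  set δ : Matrix (Fin m) (Fin 1) ℝ := Matrix.of fun a _ => Λ i a - Λ j a with hδ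
  have hδn : ‖δ‖ ^ 2 = ∑ a, (Λ i a - Λ j a) ^ 2 := by
    rw [frob_sq]; simp [hδ]
  have hsep : s / 2 * √T * ‖δ‖ ≤ ‖Q * (F * δ)‖ := by
    have h1 := hR.lower_F 1 δ
    have h2 := hR.norm_sub_colProj_factor δ
    have h3 : ‖F * δ‖ - ‖F * δ - Q * (F * δ)‖ ≤ ‖Q * (F * δ)‖ := by
      have := norm_sub_norm_le (F * δ) (F * δ - Q * (F * δ))
      rwa [sub_sub_cancel] at this
    -- The constant in `small_err` is chosen so that projecting `F δ` loses at most half of its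
    -- lower bound.
    have h4 : 2 * h * (B * h + B ^ 2) * (√T * √r) * ‖δ‖ ≤ s / 2 * √T * ‖δ‖ := by
      have h5 := mul_le_mul_of_nonneg_left hR.small_err (by positivity : 0 ≤ 2 * h * √T * ‖δ‖)
      have h6 : 2 * h * √T * ‖δ‖ * (s / (4 * h)) = s / 2 * √T * ‖δ‖ := by field_simp; ring
      nlinarith
    linarith
  set u : Fin T → Fin N → ℝ := fun t i => (Q * (F * Λ.transpose)) t i with hu'
  set e : Fin T → Fin N → ℝ := fun t i => (Q * E) t i with he
  set c : Fin T → ℝ := fun t => (Q * (Y * avgMat cell)) t i with hc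
  have huconst : ∀ t i' k, grp i' = grp k → u t i' = u t k := by
    intro t i' k hk
    simp only [hu', Matrix.mul_apply, Matrix.transpose_apply, hΛ i' k hk]
  have hentry : ∀ t i', grp i' = grp i ∨ grp i' = grp j →
      (Q * (Y - Y * avgMat cell)) t i' = u t i' + e t i' - c t := by
    intro t i' hi'
    rw [Matrix.mul_sub, Matrix.sub_apply, hY, Matrix.mul_add, Matrix.add_apply]
    congr 1
    simp only [hc, Matrix.mul_apply]
    refine Finset.sum_congr rfl fun t' _ => ?_
    congr 1
    simp only [avgMat, Matrix.of_apply, hcell i' hi', ← hY]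
  have hdiff : ∀ t, (Q * (F * δ)) t 0 = u t i - u t j := by
    intro t
    have : ∀ t', (F * δ) t' 0 = (F * Λ.transpose) t' i - (F * Λ.transpose) t' j := by
      intro t'
      simp only [Matrix.mul_apply, hδ, Matrix.of_apply, Matrix.transpose_apply,
        ← Finset.sum_sub_distrib, mul_sub]
    simp only [hu']
    rw [Matrix.mul_apply, Matrix.mul_apply, Matrix.mul_apply, ← Finset.sum_sub_distrib]
    exact Finset.sum_congr rfl fun t' _ => by rw [this, mul_sub]
  have hQδ : ‖Q * (F * δ)‖ ^ 2 = ∑ t, (u t i - u t j) ^ 2 := by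
    rw [frob_sq]; simp [hdiff]
  have hdisj : Disjoint (labelCell grp i) (labelCell grp j) := by
    rw [Finset.disjoint_left]
    intro k hk hk'
    exact hij ((Finset.mem_filter.1 hk).2.symm.trans (Finset.mem_filter.1 hk').2)
  have hlow : ∀ t, τ * N / 4 * (u t i - u t j) ^ 2 - ∑ k, e t k ^ 2 ≤
      ∑ k, ((Q * (Y - Y * avgMat cell)) t k) ^ 2 := by
    intro t
    have h1 : ∑ k ∈ labelCell grp i ∪ labelCell grp j, ((Q * (Y - Y * avgMat cell)) t k) ^ 2 ≤
        ∑ k, ((Q * (Y - Y * avgMat cell)) t k) ^ 2 :=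
      Finset.sum_le_sum_of_subset_of_nonneg (Finset.subset_univ _) fun _ _ _ => sq_nonneg _
    have h2 : ∑ k ∈ labelCell grp i ∪ labelCell grp j, e t k ^ 2 ≤ ∑ k, e t k ^ 2 :=
      Finset.sum_le_sum_of_subset_of_nonneg (Finset.subset_univ _) fun _ _ _ => sq_nonneg _
    rw [Finset.sum_union hdisj] at h1 h2
    have hcellsum : ∀ l, (l = i ∨ l = j) → τ * N ≤ (labelCell grp l).card →
        τ * N / 2 * (u t l - c t) ^ 2 - ∑ k ∈ labelCell grp l, e t k ^ 2 ≤
        ∑ k ∈ labelCell grp l, ((Q * (Y - Y * avgMat cell)) t k) ^ 2 := by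
      intro l hl hcard
      have h3 : ∑ k ∈ labelCell grp l, ((u t l - c t) ^ 2 / 2 - e t k ^ 2) ≤
          ∑ k ∈ labelCell grp l, ((Q * (Y - Y * avgMat cell)) t k) ^ 2 := by
        refine Finset.sum_le_sum fun k hk => ?_
        have hk' : grp k = grp l := (Finset.mem_filter.1 hk).2
        rw [hentry t k (by rcases hl with rfl | rfl <;> simp [hk']), huconst t k l hk']
        -- The inequality `(x + e)² ≥ x² / 2 - e²`, whose defect is `(x + 2 e)² / 2`.
        nlinarith [sq_nonneg (u t l - c t + 2 * e t k)]
      rw [Finset.sum_sub_distrib, Finset.sum_const, nsmul_eq_mul] at h3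
      have h4 := mul_le_mul_of_nonneg_right hcard (by positivity : 0 ≤ (u t l - c t) ^ 2 / 2)
      linarith
    have h5 := hcellsum i (Or.inl rfl) hτi
    have h6 := hcellsum j (Or.inr rfl) hτj
    -- Both groups share the fitted value `c t`, so it cannot be close to the two distinct signals
    -- at once.
    have h7 : τ * N / 4 * (u t i - u t j) ^ 2 ≤
        τ * N / 2 * (u t i - c t) ^ 2 + τ * N / 2 * (u t j - c t) ^ 2 := by
      have : (u t i - u t j) ^ 2 ≤ 2 * (u t i - c t) ^ 2 + 2 * (u t j - c t) ^ 2 := by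
        nlinarith [sq_nonneg ((u t i - c t) + (u t j - c t))]
      have := mul_le_mul_of_nonneg_left this (by positivity : 0 ≤ τ * N / 4)
      linarith
    linarith
  have hW : τ * N / 4 * ‖Q * (F * δ)‖ ^ 2 - ‖Q * E‖ ^ 2 ≤
      ‖Q * (Y - Y * avgMat cell)‖ ^ 2 := by
    rw [hQδ, frob_sq (Q * E), frob_sq (Q * (Y - Y * avgMat cell)), Finset.mul_sum,
      ← Finset.sum_sub_distrib]
    exact Finset.sum_le_sum fun t _ => hlow t
  have hS : τ * N / 4 * (s / 2 * √T * ‖δ‖) ^ 2 ≤ τ * N / 4 * ‖Q * (F * δ)‖ ^ 2 := by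
    gcongr
  have hw := pow_le_pow_left₀ (norm_nonneg _) (colProj_within_le F E L hΛ) 2
  have hPE := hR.inv_NT_mul_colProj_err
  rw [fitS_decomp hu, fitS_decomp hu, ← mul_sub]
  have hfin : ((N : ℝ) * T)⁻¹ * (τ * N / 4 * (s / 2 * √T * ‖δ‖) ^ 2 - 2 * ‖Q * E‖ ^ 2) ≤
      ((N : ℝ) * T)⁻¹ * (‖Y - Q * Y‖ ^ 2 + ‖Q * (Y - Y * avgMat cell)‖ ^ 2 -
        (‖Y - Q * Y‖ ^ 2 + ‖Q * (Y - Y * avgMat (labelCell grp))‖ ^ 2)) := by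
    refine mul_le_mul_of_nonneg_left ?_ (by positivity)
    linarith
  refine le_trans ?_ hfin
  have e1 : ((N : ℝ) * T)⁻¹ * (τ * N / 4 * (s / 2 * √T * ‖δ‖) ^ 2) =
      τ * s ^ 2 / 16 * ‖δ‖ ^ 2 := by
    rw [mul_pow, mul_pow, Real.sq_sqrt hT.le]
    field_simp
    ring
  rw [mul_sub, e1, ← hδn]
  linarith

end RegularFit

end Fit

end GroupedFactor

namespace GroupedFactor

/-! ### Variational bounds for the leading eigenvalues -/

section LeadingEigen

open scoped Matrix.Norms.Frobenius

variable {m N : ℕ}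

/-- Only eigenvectors orthogonal to `L` are controlled by `leading`, so `v j₀ - K` is shifted along
the columns of `L` until it is positive semidefinite. An eigenvector of the shifted matrix
orthogonal to `L` is one of `K`, with eigenvalue at most `v j₀`. Any other has eigenvalue `v i₀ - v
j` for some `j`, which is nonnegative. Finally `w` splits into a part orthogonal to `L`, on which
the shift vanishes, and a multiple of column `j₀`, an eigenvector for `v j₀`; the two do not
interact. -/
theorem IsLeadingEigen.dotProduct_le {K : Matrix (Fin N) (Fin N) ℝ} {v : Fin m → ℝ}
    {L : Matrix (Fin N) (Fin m) ℝ} (h : IsLeadingEigen K v L) (hK : K.transpose = K) (hN : 0 < N)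
    {i₀ j₀ : Fin m} (hi₀ : ∀ j, v j ≤ v i₀) (w : Fin N → ℝ)
    (hw : ∀ j, j ≠ j₀ → L.transpose.mulVec w j = 0) : w ⬝ᵥ K.mulVec w ≤ v j₀ * (w ⬝ᵥ w) := by
  have hN0 : (N : ℝ) ≠ 0 := by exact_mod_cast hN.ne'
  set t : ℝ := (v i₀ - v j₀) / N with ht
  set u : Fin N → ℝ := w - (N : ℝ)⁻¹ • L.mulVec (L.transpose.mulVec w) with hu
  set M : Matrix (Fin N) (Fin N) ℝ :=
    v j₀ • (1 : Matrix (Fin N) (Fin N) ℝ) - K + t • (L * L.transpose) with hM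
  have hLK : L.transpose * K = Matrix.diagonal v * L.transpose := by
    have := congrArg Matrix.transpose h.eigen
    rwa [Matrix.transpose_mul, Matrix.transpose_mul, hK, Matrix.diagonal_transpose] at this
  have hherm : M.IsHermitian := by
    rw [Matrix.IsHermitian, Matrix.conjTranspose_eq_transpose_of_trivial, hM]
    simp [Matrix.transpose_sub, Matrix.transpose_mul, hK]
  have hMx : ∀ x, M.mulVec x = v j₀ • x - K.mulVec x + t • L.mulVec (L.transpose.mulVec x) := by
    intro x
    rw [hM, Matrix.add_mulVec, Matrix.sub_mulVec, Matrix.smul_mulVec, Matrix.one_mulVec,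
      Matrix.smul_mulVec, Matrix.mulVec_mulVec]
  have hpsd : M.PosSemidef := by
    rw [hherm.posSemidef_iff_eigenvalues_nonneg]
    intro i
    set x : Fin N → ℝ := ⇑(hherm.eigenvectorBasis i) with hx
    have hx0 : x ≠ 0 := by
      intro h0
      have h1 := hherm.eigenvectorBasis.orthonormal.ne_zero i
      exact h1 (by ext k; exact congrFun h0 k)
    have hev : M.mulVec x = hherm.eigenvalues i • x := hherm.mulVec_eigenvectorBasis i
    by_cases hLx : L.transpose.mulVec x = 0
    · have hKx : K.mulVec x = (v j₀ - hherm.eigenvalues i) • x := by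
        rw [hMx, hLx, Matrix.mulVec_zero, smul_zero, add_zero] at hev
        rw [sub_smul, ← hev]; abel
      have := h.leading x _ hx0 hKx hLx j₀
      simp only [Pi.zero_apply]
      linarith
    · obtain ⟨j, hj⟩ := Function.ne_iff.1 hLx
      have h1 : L.transpose.mulVec (M.mulVec x) j =
          (v j₀ - v j + t * N) * L.transpose.mulVec x j := by
        rw [hMx, Matrix.mulVec_add, Matrix.mulVec_sub, Matrix.mulVec_smul, Matrix.mulVec_smul,
          Matrix.mulVec_mulVec, hLK, Matrix.mulVec_mulVec, h.normalized, Matrix.smul_mulVec,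
          Matrix.one_mulVec, ← Matrix.mulVec_mulVec]
        simp only [Pi.add_apply, Pi.sub_apply, Pi.smul_apply, smul_eq_mul, Matrix.mulVec_diagonal]
        ring
      rw [hev, Matrix.mulVec_smul, Pi.smul_apply, smul_eq_mul] at h1
      have h2 := mul_right_cancel₀ hj h1
      have h3 : t * N = v i₀ - v j₀ := by rw [ht]; field_simp
      simp only [Pi.zero_apply]
      rw [h2, h3]
      linarith [hi₀ j]
  have hLu : L.transpose.mulVec u = 0 := by
    rw [hu, Matrix.mulVec_sub, Matrix.mulVec_smul, Matrix.mulVec_mulVec, h.normalized,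
      Matrix.smul_mulVec, Matrix.one_mulVec, smul_smul, inv_mul_cancel₀ hN0, one_smul, sub_self]
  have hquad : u ⬝ᵥ K.mulVec u ≤ v j₀ * (u ⬝ᵥ u) := by
    have h1 := hpsd.dotProduct_mulVec_nonneg u
    rw [star_trivial, hMx, hLu, Matrix.mulVec_zero, smul_zero, add_zero, dotProduct_sub,
      dotProduct_smul, smul_eq_mul] at h1
    linarith
  set α : Fin m → ℝ := L.transpose.mulVec w with hα
  set p : Fin N → ℝ := L.mulVec α with hp
  have hwu : w = u + (N : ℝ)⁻¹ • p := by rw [hu]; abel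
  have hKp : K.mulVec p = v j₀ • p := by
    rw [hp, Matrix.mulVec_mulVec, h.eigen, ← Matrix.mulVec_mulVec, ← Matrix.mulVec_smul]
    congr 1
    ext j
    rw [Matrix.mulVec_diagonal, Pi.smul_apply, smul_eq_mul]
    by_cases hj : j = j₀
    · rw [hj]
    · rw [hw j hj]; simp
  have hup : u ⬝ᵥ p = 0 := by
    rw [hp, Matrix.dotProduct_mulVec, ← Matrix.mulVec_transpose, hLu, zero_dotProduct]
  have hpu : p ⬝ᵥ u = 0 := by rw [dotProduct_comm, hup]
  have hpKu : p ⬝ᵥ K.mulVec u = 0 := by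
    rw [Matrix.dotProduct_mulVec, ← Matrix.mulVec_transpose, hK, hKp, smul_dotProduct, hpu,
      smul_zero]
  rw [hwu, Matrix.mulVec_add, Matrix.mulVec_smul, hKp]
  simp only [add_dotProduct, dotProduct_add, smul_dotProduct, dotProduct_smul, hup, hpu, hpKu,
    smul_eq_mul, mul_zero, add_zero, zero_add]
  linarith

/-- The leading eigenvalues are bounded below by the quadratic form on the range of `Λ`. -/
theorem IsLeadingEigen.le_eigenvalue {K : Matrix (Fin N) (Fin N) ℝ} {v : Fin m → ℝ}
    {L Λ : Matrix (Fin N) (Fin m) ℝ} (h : IsLeadingEigen K v L) (hK : K.transpose = K)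
    (hN : 0 < N) {c : ℝ} (hΛ : ∀ a, Λ.mulVec a = 0 → a = 0)
    (hc : ∀ a, c * (Λ.mulVec a ⬝ᵥ Λ.mulVec a) ≤ Λ.mulVec a ⬝ᵥ K.mulVec (Λ.mulVec a)) (j : Fin m) :
    c ≤ v j := by
  have hm : 0 < m := j.pos
  set i₀ : Fin m := ⟨0, hm⟩
  -- The dimension count of the min-max principle: deleting row `j` of `Lᵀ Λ` makes it singular.
  -- Hence some nonzero `Λ a` is orthogonal to all columns of `L` except the `j`-th.
  set M : Matrix (Fin m) (Fin m) ℝ :=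
    Matrix.of fun k b => if k = j then 0 else (L.transpose * Λ) k b with hM
  have hdet : M.det = 0 := Matrix.det_eq_zero_of_row_eq_zero j fun b => by simp [hM]
  obtain ⟨a, ha, hMa⟩ := Matrix.exists_mulVec_eq_zero_iff.2 hdet
  set w := Λ.mulVec a with hw
  have hw0 : w ≠ 0 := fun h0 => ha (hΛ a h0)
  have hLw : ∀ k, k ≠ j → L.transpose.mulVec w k = 0 := by
    intro k hk
    rw [hw, Matrix.mulVec_mulVec]
    have := congrFun hMa k
    simpa [hM, Matrix.mulVec, dotProduct, hk] using this
  have h1 := h.dotProduct_le hK hN (i₀ := i₀) (j₀ := j)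
    (fun k => h.descending (Fin.le_def.2 (Nat.zero_le _))) w hLw
  have h2 := hc a
  have hpos : 0 < w ⬝ᵥ w := by
    have : 0 ≤ w ⬝ᵥ w := by
      simp only [dotProduct]
      exact Finset.sum_nonneg fun i _ => mul_self_nonneg _
    exact lt_of_le_of_ne this (Ne.symm fun h0 => hw0 (dotProduct_self_eq_zero.1 h0))
  exact le_of_mul_le_mul_right (h2.trans h1) hpos

end LeadingEigen

/-! ### Errors of the estimated loadings -/

section LoadingError

open scoped Matrix.Norms.Frobenius

variable {m N T : ℕ}

theorem frob_le_of_entry_le {a b : Type*} [Fintype a] [Fintype b] {A : Matrix a b ℝ} {C : ℝ}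
    (hC : 0 ≤ C) (h : ∀ i j, |A i j| ≤ C) :
    ‖A‖ ≤ √(Fintype.card a) * √(Fintype.card b) * C := by
  refine le_of_sq_le_sq ?_ (by positivity)
  rw [frob_sq, mul_pow, mul_pow, Real.sq_sqrt (by positivity), Real.sq_sqrt (by positivity)]
  calc ∑ i, ∑ j, A i j ^ 2 ≤ ∑ _i : a, ∑ _j : b, C ^ 2 :=
        Finset.sum_le_sum fun i _ => Finset.sum_le_sum fun j _ => by
          rw [← sq_abs]; exact pow_le_pow_left₀ (abs_nonneg _) (h i j) 2
    _ = _ := by simp; ring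

theorem inv_diagonal_eq {v : Fin m → ℝ} (hv : ∀ j, v j ≠ 0) :
    (Matrix.diagonal v)⁻¹ = Matrix.diagonal fun j => (v j)⁻¹ := by
  refine Matrix.inv_eq_right_inv ?_
  rw [Matrix.diagonal_mul_diagonal, ← Matrix.diagonal_one]
  congr 1
  ext j
  exact mul_inv_cancel₀ (hv j)

theorem norm_mul_inv_diagonal_le {a : Type*} [Fintype a] {v : Fin m → ℝ} {c : ℝ} (hc : 0 < c)
    (hv : ∀ j, c ≤ v j) (A : Matrix a (Fin m) ℝ) : ‖A * (Matrix.diagonal v)⁻¹‖ ≤ ‖A‖ / c := by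
  rw [inv_diagonal_eq fun j => (hc.trans_le (hv j)).ne']
  refine le_of_sq_le_sq ?_ (by positivity)
  rw [div_pow, le_div_iff₀ (by positivity), frob_sq, frob_sq, Finset.sum_mul]
  refine Finset.sum_le_sum fun i _ => ?_
  rw [Finset.sum_mul]
  refine Finset.sum_le_sum fun j _ => ?_
  rw [Matrix.mul_diagonal, mul_pow, mul_assoc]
  refine mul_le_of_le_one_right (sq_nonneg _) ?_
  rw [← mul_pow, inv_mul_eq_div]
  refine pow_le_one₀ (div_nonneg hc.le (hc.le.trans (hv j))) ?_
  exact (div_le_one (hc.trans_le (hv j))).2 (hv j)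

/-- A matrix with the decomposition of the sample Kendall's tau matrix of a factor model, and
bounds on its parts. -/
structure EigenBounds (K : Matrix (Fin N) (Fin N) ℝ) (Λ : Matrix (Fin N) (Fin m) ℝ)
    (M₁ : Matrix (Fin m) (Fin m) ℝ) (C₂ E₂ : Matrix (Fin N) (Fin m) ℝ)
    (C₃ E₃ : Matrix (Fin N) (Fin N) ℝ) (T : ℕ) (B : ℝ) : Prop where
  B_pos : 0 < B
  N_pos : 0 < N
  T_pos : 0 < T
  decomp : K = Λ * M₁ * Λ.transpose + Λ * (C₂ + E₂).transpose + (C₂ + E₂) * Λ.transpose + (C₃ + E₃)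
  Λ_entry : ∀ i a, |Λ i a| ≤ B
  norm_Λ : ‖Λ‖ ≤ B * √N
  M₁_entry : ∀ a b, |M₁ a b| ≤ B / N
  norm_C₂ : ‖C₂‖ ≤ B / (√N * √T)
  norm_C₃ : ‖C₃‖ ≤ B / √T
  E₂_entry : ∀ i a, |E₂ i a| ≤ B / (N * √N)
  E₃_row : ∀ i (y : Fin N → ℝ), |∑ j, E₃ i j * y j| ≤ B / N * √(∑ j, y j ^ 2)

variable {K : Matrix (Fin N) (Fin N) ℝ} {Λ L : Matrix (Fin N) (Fin m) ℝ}
  {M₁ : Matrix (Fin m) (Fin m) ℝ} {C₂ E₂ : Matrix (Fin N) (Fin m) ℝ}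
  {C₃ E₃ : Matrix (Fin N) (Fin N) ℝ} {B : ℝ} {v : Fin m → ℝ}

namespace EigenBounds

/-- The constant in the bounds for the loading errors. -/
def errConst (m : ℕ) (B : ℝ) : ℝ := m ^ 2 * B ^ 3 + m * B ^ 3 + 2 * B ^ 3 + B ^ 2

theorem errConst_nonneg {B : ℝ} (hB : 0 ≤ B) : 0 ≤ errConst m B := by
  unfold errConst; positivity

theorem sqrt_card_le : √(m : ℝ) ≤ m := by
  rcases Nat.eq_zero_or_pos m with h | h
  · simp [h]
  · have : (1 : ℝ) ≤ m := by exact_mod_cast h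
    rw [Real.sqrt_le_left (by linarith)]
    nlinarith

theorem norm_centered (hb : EigenBounds K Λ M₁ C₂ E₂ C₃ E₃ T B) (hL : ‖L‖ ≤ B * √N) :
    ‖Λ * C₂.transpose * L + C₂ * Λ.transpose * L + C₃ * L‖ ≤ errConst m B * (√N / √T) := by
  have hB := hb.B_pos
  have hN : (0 : ℝ) < √N := Real.sqrt_pos.2 (by exact_mod_cast hb.N_pos)
  have hT : (0 : ℝ) < √T := Real.sqrt_pos.2 (by exact_mod_cast hb.T_pos)
  have h1 : ‖Λ * C₂.transpose * L‖ ≤ (B * √N) * (B / (√N * √T)) * (B * √N) := by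
    refine (Matrix.frobenius_norm_mul _ _).trans (mul_le_mul ?_ hL (norm_nonneg _) (by positivity))
    refine (Matrix.frobenius_norm_mul _ _).trans ?_
    rw [Matrix.frobenius_norm_transpose]
    exact mul_le_mul hb.norm_Λ hb.norm_C₂ (norm_nonneg _) (by positivity)
  have h2 : ‖C₂ * Λ.transpose * L‖ ≤ (B / (√N * √T)) * (B * √N) * (B * √N) := by
    refine (Matrix.frobenius_norm_mul _ _).trans (mul_le_mul ?_ hL (norm_nonneg _) (by positivity))
    refine (Matrix.frobenius_norm_mul _ _).trans ?_
    rw [Matrix.frobenius_norm_transpose]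
    exact mul_le_mul hb.norm_C₂ hb.norm_Λ (norm_nonneg _) (by positivity)
  have h3 : ‖C₃ * L‖ ≤ (B / √T) * (B * √N) :=
    (Matrix.frobenius_norm_mul _ _).trans (mul_le_mul hb.norm_C₃ hL (norm_nonneg _) (by positivity))
  have h4 := (norm_add_le (Λ * C₂.transpose * L + C₂ * Λ.transpose * L) (C₃ * L)).trans
    (add_le_add ((norm_add_le _ _).trans (add_le_add h1 h2)) h3)
  refine h4.trans ?_
  have e : (B * √N) * (B / (√N * √T)) * (B * √N) + (B / (√N * √T)) * (B * √N) * (B * √N) +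
      (B / √T) * (B * √N) = (2 * B ^ 3 + B ^ 2) * (√N / √T) := by
    field_simp; ring
  rw [e]
  refine mul_le_mul_of_nonneg_right ?_ (by positivity)
  unfold errConst
  have : 0 ≤ (m : ℝ) ^ 2 * B ^ 3 + m * B ^ 3 := by positivity
  linarith

/-- The means are treated entry by entry. Bounding an entry by the Frobenius norm of the whole
matrix would lose a factor `√N`, and the result would not be small. -/
theorem entry_bias (hb : EigenBounds K Λ M₁ C₂ E₂ C₃ E₃ T B) (hL : ‖L‖ ≤ B * √N) (i : Fin N)
    (a : Fin m) :
    |(Λ * E₂.transpose * L + E₂ * Λ.transpose * L + E₃ * L) i a| ≤ errConst m B / √N := by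
  have hB := hb.B_pos
  have hN' : (0 : ℝ) < N := by exact_mod_cast hb.N_pos
  have hN : (0 : ℝ) < √N := Real.sqrt_pos.2 hN'
  have hE₂ : ‖E₂‖ ≤ m * (B / N) := by
    refine (frob_le_of_entry_le (by positivity) hb.E₂_entry).trans ?_
    rw [Fintype.card_fin, Fintype.card_fin]
    calc √N * √m * (B / (N * √N)) = √m * (B / N) := by field_simp
      _ ≤ m * (B / N) := by gcongr; exact sqrt_card_le
  have h1 : |(Λ * E₂.transpose * L) i a| ≤ m ^ 2 * B ^ 3 / √N := by
    rw [Matrix.mul_assoc, Matrix.mul_apply]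
    have hEL : ‖E₂.transpose * L‖ ≤ m * (B / N) * (B * √N) := by
      refine (Matrix.frobenius_norm_mul _ _).trans ?_
      rw [Matrix.frobenius_norm_transpose]
      exact mul_le_mul hE₂ hL (norm_nonneg _) (by positivity)
    calc |∑ b, Λ i b * (E₂.transpose * L) b a| ≤ ∑ _b : Fin m, B * (m * (B / N) * (B * √N)) := by
          refine (Finset.abs_sum_le_sum_abs _ _).trans (Finset.sum_le_sum fun b _ => ?_)
          rw [abs_mul]
          exact mul_le_mul (hb.Λ_entry i b) ((frob_entry_le _ _ _).trans hEL) (abs_nonneg _) hB.le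
      _ = m ^ 2 * B ^ 3 / √N := by
          simp only [Finset.sum_const, Finset.card_univ, Fintype.card_fin, nsmul_eq_mul]
          field_simp
          rw [Real.sq_sqrt hN'.le]
  have h2 : |(E₂ * Λ.transpose * L) i a| ≤ m * B ^ 3 / √N := by
    rw [Matrix.mul_assoc, Matrix.mul_apply]
    have hEL : ‖Λ.transpose * L‖ ≤ (B * √N) * (B * √N) := by
      refine (Matrix.frobenius_norm_mul _ _).trans ?_
      rw [Matrix.frobenius_norm_transpose]
      exact mul_le_mul hb.norm_Λ hL (norm_nonneg _) (by positivity)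
    calc |∑ b, E₂ i b * (Λ.transpose * L) b a|
        ≤ ∑ _b : Fin m, (B / (N * √N)) * ((B * √N) * (B * √N)) := by
          refine (Finset.abs_sum_le_sum_abs _ _).trans (Finset.sum_le_sum fun b _ => ?_)
          rw [abs_mul]
          exact mul_le_mul (hb.E₂_entry i b) ((frob_entry_le _ _ _).trans hEL) (abs_nonneg _)
            (by positivity)
      _ = m * B ^ 3 / √N := by
          simp only [Finset.sum_const, Finset.card_univ, Fintype.card_fin, nsmul_eq_mul]
          field_simp
          rw [Real.sq_sqrt hN'.le]
  have h3 : |(E₃ * L) i a| ≤ B ^ 2 / √N := by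
    rw [Matrix.mul_apply]
    refine (hb.E₃_row i fun j => L j a).trans ?_
    have : √(∑ j, L j a ^ 2) ≤ B * √N := by
      refine le_trans (Real.sqrt_le_left (norm_nonneg L) |>.2 ?_) hL
      rw [frob_sq]
      exact Finset.sum_le_sum fun j _ =>
        Finset.single_le_sum (f := fun a => L j a ^ 2) (fun _ _ => sq_nonneg _) (Finset.mem_univ a)
    calc B / N * √(∑ j, L j a ^ 2) ≤ B / N * (B * √N) := by gcongr
      _ = B ^ 2 / √N := by
          field_simp
          rw [Real.sq_sqrt hN'.le]
  rw [Matrix.add_apply, Matrix.add_apply]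
  refine (abs_add_le _ _).trans ((add_le_add ((abs_add_le _ _).trans (add_le_add h1 h2)) h3).trans ?_)
  rw [← add_div, ← add_div]
  refine div_le_div_of_nonneg_right ?_ hN.le
  unfold errConst
  have : 0 < B ^ 3 := by positivity
  linarith

/-- The eigenvector equation reads `L = K L V⁻¹`. The leading term of the decomposition of `K` is
exactly `Λ` times the rotation; what remains is linear in the deviations and the means. -/
theorem sub_eq (hb : EigenBounds K Λ M₁ C₂ E₂ C₃ E₃ T B) (hv : ∀ j, v j ≠ 0)
    (hKL : K * L = L * Matrix.diagonal v) :
    L - Λ * (M₁ * Λ.transpose * L * (Matrix.diagonal v)⁻¹) =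
      ((Λ * C₂.transpose * L + C₂ * Λ.transpose * L + C₃ * L) +
        (Λ * E₂.transpose * L + E₂ * Λ.transpose * L + E₃ * L)) * (Matrix.diagonal v)⁻¹ := by
  have hL : L = K * L * (Matrix.diagonal v)⁻¹ := by
    rw [hKL, Matrix.mul_assoc, Matrix.mul_nonsing_inv, Matrix.mul_one]
    rw [Matrix.det_diagonal, isUnit_iff_ne_zero]
    exact Finset.prod_ne_zero_iff.2 fun j _ => hv j
  have hK : K * L = Λ * (M₁ * Λ.transpose * L) +
      ((Λ * C₂.transpose * L + C₂ * Λ.transpose * L + C₃ * L) +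
        (Λ * E₂.transpose * L + E₂ * Λ.transpose * L + E₃ * L)) := by
    rw [hb.decomp, Matrix.transpose_add]
    simp only [Matrix.add_mul, Matrix.mul_add, Matrix.mul_assoc]
    abel
  have h := hL
  rw [hK, Matrix.add_mul, Matrix.mul_assoc Λ (M₁ * Λ.transpose * L)] at h
  rw [sub_eq_iff_eq_add']
  exact h

theorem norm_rotation (hb : EigenBounds K Λ M₁ C₂ E₂ C₃ E₃ T B) (hL : ‖L‖ ≤ B * √N) {c : ℝ}
    (hc : 0 < c) (hv : ∀ j, c ≤ v j) :
    ‖M₁ * Λ.transpose * L * (Matrix.diagonal v)⁻¹‖ ≤ m * B ^ 3 / c := by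
  have hB := hb.B_pos
  have hN' : (0 : ℝ) < N := by exact_mod_cast hb.N_pos
  refine (norm_mul_inv_diagonal_le hc hv _).trans (div_le_div_of_nonneg_right ?_ hc.le)
  have hM : ‖M₁‖ ≤ m * (B / N) := by
    refine (frob_le_of_entry_le (by positivity) hb.M₁_entry).trans ?_
    rw [Fintype.card_fin, Real.mul_self_sqrt (by positivity)]
  calc ‖M₁ * Λ.transpose * L‖ ≤ m * (B / N) * (B * √N) * (B * √N) := by
        refine (Matrix.frobenius_norm_mul _ _).trans
          (mul_le_mul ?_ hL (norm_nonneg _) (by positivity))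
        refine (Matrix.frobenius_norm_mul _ _).trans ?_
        rw [Matrix.frobenius_norm_transpose]
        exact mul_le_mul hM hb.norm_Λ (norm_nonneg _) (by positivity)
    _ = m * B ^ 3 := by
        field_simp
        rw [Real.sq_sqrt hN'.le]

theorem entry_sub_le (hb : EigenBounds K Λ M₁ C₂ E₂ C₃ E₃ T B) (hL : ‖L‖ ≤ B * √N) {c : ℝ}
    (hc : 0 < c) (hv : ∀ j, c ≤ v j) (hKL : K * L = L * Matrix.diagonal v) (i : Fin N)
    (a : Fin m) :
    |(L - Λ * (M₁ * Λ.transpose * L * (Matrix.diagonal v)⁻¹)) i a| ≤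
      errConst m B / c * (√N / √T + 1 / √N) := by
  have hv0 : ∀ j, v j ≠ 0 := fun j => (hc.trans_le (hv j)).ne'
  have hC := errConst_nonneg (m := m) hb.B_pos.le
  rw [hb.sub_eq hv0 hKL, inv_diagonal_eq hv0, Matrix.mul_diagonal, abs_mul, Matrix.add_apply]
  have h1 := ((frob_entry_le _ i a).trans (hb.norm_centered hL))
  have h2 := hb.entry_bias hL i a
  have h3 := (abs_add_le _ _).trans (add_le_add h1 h2)
  have h4 : |(v a)⁻¹| ≤ 1 / c := by
    rw [abs_inv, abs_of_pos (hc.trans_le (hv a)), one_div]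
    exact inv_anti₀ hc (hv a)
  calc _ ≤ (errConst m B * (√N / √T) + errConst m B / √N) * (1 / c) :=
        mul_le_mul h3 h4 (abs_nonneg _) (by positivity)
    _ = _ := by ring

theorem norm_sub_le (hb : EigenBounds K Λ M₁ C₂ E₂ C₃ E₃ T B) (hL : ‖L‖ ≤ B * √N) {c : ℝ}
    (hc : 0 < c) (hv : ∀ j, c ≤ v j) (hKL : K * L = L * Matrix.diagonal v) {r : ℝ}
    (hrN : 1 ≤ √r * √N) (hrT : 1 ≤ √r * √T) :
    ‖L - Λ * (M₁ * Λ.transpose * L * (Matrix.diagonal v)⁻¹)‖ ≤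
      (1 + m) * errConst m B / c * √N * √r := by
  have hv0 : ∀ j, v j ≠ 0 := fun j => (hc.trans_le (hv j)).ne'
  have hC := errConst_nonneg (m := m) hb.B_pos.le
  have hN : (0 : ℝ) < √N := Real.sqrt_pos.2 (by exact_mod_cast hb.N_pos)
  have hT : (0 : ℝ) < √T := Real.sqrt_pos.2 (by exact_mod_cast hb.T_pos)
  rw [hb.sub_eq hv0 hKL]
  refine (norm_mul_inv_diagonal_le hc hv _).trans ?_
  have h1 := hb.norm_centered hL
  have h2 := frob_le_of_entry_le (by positivity) (hb.entry_bias hL)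
  rw [Fintype.card_fin, Fintype.card_fin] at h2
  have h3 : √N / √T ≤ √N * √r := by
    rw [div_le_iff₀ hT]
    nlinarith
  have h4 : √N * √m * (errConst m B / √N) ≤ m * errConst m B * (√N * √r) := by
    have e : √N * √m * (errConst m B / √N) = √m * errConst m B := by field_simp
    rw [e]
    calc √m * errConst m B ≤ m * errConst m B * 1 := by
          rw [mul_one]; exact mul_le_mul_of_nonneg_right sqrt_card_le hC
      _ ≤ _ := by
          refine mul_le_mul_of_nonneg_left ?_ (by positivity)
          linarith
  have h5 : errConst m B * (√N / √T) ≤ errConst m B * (√N * √r) := by gcongr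
  have h6 := (norm_add_le _ _).trans (add_le_add (h1.trans h5) (h2.trans h4))
  calc _ ≤ (errConst m B * (√N * √r) + m * errConst m B * (√N * √r)) / c :=
        div_le_div_of_nonneg_right h6 hc.le
    _ = _ := by ring

end EigenBounds

end LoadingError

end GroupedFactor

namespace GroupedFactor

/-! ### Differences of independent spherical vectors -/

section SphericalSample

open scoped RealInnerProductSpace ENNReal

set_option linter.unusedSectionVars false

variable {E : Type*} [NormedAddCommGroup E] [InnerProductSpace ℝ E] [FiniteDimensional ℝ E]
  [MeasurableSpace E] [BorelSpace E]

theorem IsSpherical.sub {μ₁ μ₂ : Measure E} [IsProbabilityMeasure μ₁] [IsProbabilityMeasure μ₂]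
    (h₁ : IsSpherical μ₁) (h₂ : IsSpherical μ₂) :
    IsSpherical ((μ₁.prod μ₂).map fun p => p.1 - p.2) := by
  intro φ
  have hp : (μ₁.prod μ₂).map (Prod.map φ φ) = μ₁.prod μ₂ := by
    rw [← Measure.map_prod_map _ _ (by fun_prop) (by fun_prop), h₁ φ, h₂ φ]
  rw [Measure.map_map (by fun_prop) (by fun_prop)]
  conv_rhs => rw [← hp, Measure.map_map (by fun_prop) (by fun_prop)]
  congr 1
  ext p
  simp

/-- By symmetry of the second law, the two vectors coincide with the same probability as they are
opposite. Both happen only at the origin, which is null for `μ₂`, so each probability is at most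
1/2. Atoms of the radial law are thus harmless. -/
theorem IsSpherical.half_le_sub_compl_zero {μ₁ μ₂ : Measure E} [IsProbabilityMeasure μ₁]
    [IsProbabilityMeasure μ₂] (h₂ : IsSpherical μ₂) (h0 : μ₂ {0} = 0) :
    1 / 2 ≤ ((μ₁.prod μ₂).map fun p => p.1 - p.2).real {0}ᶜ := by
  set ρ := μ₁.prod μ₂ with hρ
  have hneg : ρ.map (Prod.map id fun x => -x) = ρ := by
    have : μ₂.map (fun x => -x) = μ₂ := h₂ (LinearIsometryEquiv.neg ℝ)
    rw [hρ, ← Measure.map_prod_map _ _ (by fun_prop) (by fun_prop), this, Measure.map_id]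
  have hmsub : Measurable fun p : E × E => p.1 - p.2 := by fun_prop
  have hmadd : Measurable fun p : E × E => p.1 + p.2 := by fun_prop
  have hs0 := measurableSet_singleton (0 : E)
  set S : Set (E × E) := (fun p => p.1 - p.2) ⁻¹' {0} with hS
  set S' : Set (E × E) := (fun p => p.1 + p.2) ⁻¹' {0} with hS'
  have hSm : MeasurableSet S := hmsub hs0
  have hSm' : MeasurableSet S' := hmadd hs0
  have heq : ρ S' = ρ S := by
    conv_lhs => rw [← hneg, Measure.map_apply (by fun_prop) hSm']
    congr 1
    ext p
    simp [hS, hS', sub_eq_add_neg]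
  have hnull : ρ (S ∩ S') = 0 := by
    refine measure_mono_null (t := Set.univ ×ˢ {0}) ?_ ?_
    · rintro ⟨x, y⟩ ⟨h1, h2⟩
      simp only [hS, hS', Set.mem_preimage, Set.mem_singleton_iff] at h1 h2
      rw [sub_eq_zero] at h1
      subst h1
      have : (2 : ℝ) • x = 0 := by rw [two_smul, h2]
      simpa using this
    · rw [hρ, Measure.prod_prod, h0, mul_zero]
  have hle : ρ.real S + ρ.real S' ≤ 1 := by
    have hu := measure_union_add_inter S hSm' (μ := ρ)
    rw [hnull, add_zero] at hu
    have : ρ S + ρ S' ≤ 1 := hu ▸ prob_le_one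
    rw [measureReal_def, measureReal_def, ← ENNReal.toReal_add (measure_ne_top _ _)
      (measure_ne_top _ _)]
    exact ENNReal.toReal_le_of_le_ofReal zero_le_one (by simpa using this)
  have heq' : ρ.real S' = ρ.real S := by rw [measureReal_def, heq, ← measureReal_def]
  have : IsProbabilityMeasure (ρ.map fun p => p.1 - p.2) :=
    Measure.isProbabilityMeasure_map hmsub.aemeasurable
  rw [probReal_compl_eq_one_sub hs0, map_measureReal_apply hmsub hs0]
  linarith

/-- Independent random vectors with spherical laws without mass at the origin. -/
structure SphericalSample {T : ℕ} {Ω : Type*} [MeasurableSpace Ω] (Z : Fin T → Ω → E)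
    (P : Measure Ω) : Prop where
  aemeasurable : ∀ t, AEMeasurable (Z t) P
  indep : iIndepFun Z P
  spherical : ∀ t, IsSpherical (P.map (Z t))
  zero : ∀ t, P.map (Z t) {0} = 0

variable {T : ℕ} {Ω : Type*} [MeasurableSpace Ω] {Z : Fin T → Ω → E} {P : Measure Ω}
  [IsProbabilityMeasure P]

namespace SphericalSample

theorem map_sub (hZ : SphericalSample Z P) {t s : Fin T} (hts : t ≠ s) :
    P.map (fun ω => Z t ω - Z s ω) =
      ((P.map (Z t)).prod (P.map (Z s))).map fun p => p.1 - p.2 := by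
  have hi := (indepFun_iff_map_prod_eq_prod_map_map (hZ.aemeasurable t) (hZ.aemeasurable s)).1
    (hZ.indep.indepFun hts)
  rw [← hi, AEMeasurable.map_map_of_aemeasurable (by fun_prop)
    ((hZ.aemeasurable t).prodMk (hZ.aemeasurable s))]
  rfl

theorem aemeasurable_sub (hZ : SphericalSample Z P) (t s : Fin T) :
    AEMeasurable (fun ω => Z t ω - Z s ω) P := (hZ.aemeasurable t).sub (hZ.aemeasurable s)

theorem spherical_sub (hZ : SphericalSample Z P) {t s : Fin T} (hts : t ≠ s) :
    IsSpherical (P.map fun ω => Z t ω - Z s ω) := by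
  have := Measure.isProbabilityMeasure_map (μ := P) (hZ.aemeasurable t)
  have := Measure.isProbabilityMeasure_map (μ := P) (hZ.aemeasurable s)
  rw [hZ.map_sub hts]
  exact (hZ.spherical t).sub (hZ.spherical s)

/-- Means of functions of the direction of a difference compare with Gaussian means. -/
theorem compare [Nontrivial E] (hZ : SphericalSample Z P) {t s : Fin T} (hts : t ≠ s) {h : E → ℝ}
    (hm : Measurable h) (hh : ∀ c : ℝ, 0 < c → ∀ x, h (c • x) = h x) (h0 : h 0 = 0)
    (hpos : ∀ x, 0 ≤ h x) (hi : Integrable h (stdGaussian E)) :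
    Integrable (fun ω => h (Z t ω - Z s ω)) P ∧
      ∫ ω, h (Z t ω - Z s ω) ∂P ≤ ∫ x, h x ∂stdGaussian E ∧
      1 / 2 * ∫ x, h x ∂stdGaussian E ≤ ∫ ω, h (Z t ω - Z s ω) ∂P := by
  have := Measure.isProbabilityMeasure_map (μ := P) (hZ.aemeasurable t)
  have := Measure.isProbabilityMeasure_map (μ := P) (hZ.aemeasurable s)
  have hms := hZ.aemeasurable_sub t s
  have := Measure.isProbabilityMeasure_map (μ := P) hms
  obtain ⟨h1, h2⟩ := (hZ.spherical_sub hts).integrable_and_le isSpherical_stdGaussian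
    stdGaussian_singleton_zero hm hh h0 hpos hi
  have hintg : 0 ≤ ∫ x, h x ∂stdGaussian E := integral_nonneg hpos
  rw [integral_map hms hm.aestronglyMeasurable] at h2
  refine ⟨(integrable_map_measure hm.aestronglyMeasurable hms).1 h1, ?_, ?_⟩
  · rw [h2]; exact mul_le_of_le_one_left hintg measureReal_le_one
  · rw [h2]
    refine mul_le_mul_of_nonneg_right ?_ hintg
    rw [hZ.map_sub hts]
    exact (hZ.spherical s).half_le_sub_compl_zero (hZ.zero s)

end SphericalSample

/-- The normalized product `⟪p, x⟫ ⟪q, x⟫ / ∑ i, ⟪b i, x⟫ ^ 2`. -/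
def ratio {N : ℕ} (b : Fin N → E) (p q x : E) : ℝ := (quadForm b x)⁻¹ * (⟪p, x⟫ * ⟪q, x⟫)

theorem measurable_ratio {N : ℕ} (b : Fin N → E) (p q : E) : Measurable (ratio b p q) := by
  have := measurable_quadForm b
  unfold ratio; fun_prop

theorem ratio_smul {N : ℕ} (b : Fin N → E) (p q : E) {c : ℝ} (hc : 0 < c) (x : E) :
    ratio b p q (c • x) = ratio b p q x := by
  unfold ratio
  rw [quadForm_smul, real_inner_smul_right, real_inner_smul_right, mul_inv]
  field_simp

@[simp] theorem ratio_zero {N : ℕ} (b : Fin N → E) (p q : E) : ratio b p q 0 = 0 := by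
  simp [ratio]

theorem ratio_add_left {N : ℕ} (b : Fin N → E) (p p' q x : E) :
    ratio b (p + p') q x = ratio b p q x + ratio b p' q x := by
  simp only [ratio, inner_add_left]; ring

theorem ratio_comm {N : ℕ} (b : Fin N → E) (p q x : E) : ratio b p q x = ratio b q p x := by
  simp only [ratio]; ring

theorem ratio_sum_left {N : ℕ} {ι : Type*} (S : Finset ι) (b : Fin N → E) (c : ι → ℝ) (p : ι → E)
    (q x : E) : ratio b (∑ i ∈ S, c i • p i) q x = ∑ i ∈ S, c i * ratio b (p i) q x := by
  simp only [ratio, sum_inner, real_inner_smul_left, Finset.sum_mul, Finset.mul_sum]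
  exact Finset.sum_congr rfl fun i _ => by ring

theorem integral_abs_ratio_le {N : ℕ} (hN : 9 ≤ N) {c : ℝ} (hc : 0 < c) {b : Fin N → E}
    (hb : FrameBound c b) (p q : E) : Integrable (fun x => |ratio b p q x|) (stdGaussian E) ∧
      ∫ x, |ratio b p q x| ∂stdGaussian E ≤ ratioMoment c * (‖p‖ * ‖q‖) / N := by
  have e : ∀ x, |ratio b p q x| = |⟪p, x⟫ * ⟪q, x⟫| * (quadForm b x)⁻¹ := by
    intro x
    rw [ratio, abs_mul, abs_of_nonneg (inv_nonneg.2 (quadForm_nonneg b x)), mul_comm]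
  simp_rw [e]
  exact integral_two_ratio hN hc hb p q

theorem integral_sq_ratio_le {N : ℕ} (hN : 9 ≤ N) {c : ℝ} (hc : 0 < c) {b : Fin N → E}
    (hb : FrameBound c b) (p q : E) : Integrable (fun x => ratio b p q x ^ 2) (stdGaussian E) ∧
      ∫ x, ratio b p q x ^ 2 ∂stdGaussian E ≤ ratioMoment c * (‖p‖ ^ 2 * ‖q‖ ^ 2) / N ^ 2 := by
  have e : ∀ x, ratio b p q x ^ 2 =
      |⟪p, x⟫ * ⟪q, x⟫ * ⟪p, x⟫ * ⟪q, x⟫| * ((quadForm b x)⁻¹ * (quadForm b x)⁻¹) := by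
    intro x
    have : ⟪p, x⟫ * ⟪q, x⟫ * ⟪p, x⟫ * ⟪q, x⟫ = (⟪p, x⟫ * ⟪q, x⟫) ^ 2 := by ring
    rw [ratio, this, abs_of_nonneg (sq_nonneg _)]
    ring
  simp_rw [e]
  have h := integral_four_ratio hN hc hb hb p q p q
  refine ⟨h.1, h.2.trans (le_of_eq ?_)⟩
  ring

/-- The Gaussian second moment. -/
def moment2 : ℝ := ∫ x : ℝ, x ^ 2 ∂gaussianReal 0 1

theorem moment2_nonneg : 0 ≤ moment2 := integral_nonneg fun _ => sq_nonneg _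

theorem integral_inner_sq (v : E) : Integrable (fun x => ⟪v, x⟫ ^ 2) (stdGaussian E) ∧
    ∫ x, ⟪v, x⟫ ^ 2 ∂stdGaussian E = ‖v‖ ^ 2 * moment2 := by
  have hm : AEMeasurable (fun x => ⟪v, x⟫) (stdGaussian E) := by fun_prop
  have hv : AEMeasurable (fun x : ℝ => ‖v‖ * x) (gaussianReal 0 1) := by fun_prop
  constructor
  · have : Integrable (fun y : ℝ => y ^ 2) ((stdGaussian E).map fun x => ⟪v, x⟫) := by
      rw [stdGaussian_map_inner, integrable_map_measure (by fun_prop) hv]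
      simpa [Function.comp_def, mul_pow] using (integrable_pow_gaussianReal 2).const_mul (‖v‖ ^ 2)
    exact (integrable_map_measure (by fun_prop) hm).1 this
  · rw [← integral_map (f := fun y : ℝ => y ^ 2) hm (by fun_prop), stdGaussian_map_inner,
      integral_map hv (by fun_prop)]
    simp_rw [mul_pow]
    rw [integral_const_mul, moment2]

theorem integral_quadForm {N : ℕ} (b : Fin N → E) : Integrable (quadForm b) (stdGaussian E) ∧
    ∫ x, quadForm b x ∂stdGaussian E = (∑ i, ‖b i‖ ^ 2) * moment2 := by
  constructor
  · exact integrable_finsetSum _ fun i _ => (integral_inner_sq (b i)).1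
  · unfold quadForm
    rw [integral_finsetSum _ fun i _ => (integral_inner_sq (b i)).1, Finset.sum_mul]
    exact Finset.sum_congr rfl fun i _ => (integral_inner_sq (b i)).2

/-- The bound `a² / q ≥ 2 l a - l² q` is linear in `q`, so only the mean of the denominator is
needed, and `l` is its optimal value. Where `q = 0` the numerator vanishes too, because `p` lies in
the span of `b`. -/
theorem le_integral_ratio {N : ℕ} {b : Fin N → E} (u : Fin N → ℝ) {S : ℝ} (hS : 0 < S)
    (hb : (∑ i, ‖b i‖ ^ 2) * moment2 ≤ S)
    (hi : Integrable (fun x => ratio b (∑ i, u i • b i) (∑ i, u i • b i) x) (stdGaussian E)) :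
    (absMoment * ‖∑ i, u i • b i‖) ^ 2 / S ≤
      ∫ x, ratio b (∑ i, u i • b i) (∑ i, u i • b i) x ∂stdGaussian E := by
  set p := ∑ i, u i • b i with hp
  obtain ⟨hq, hqe⟩ := integral_quadForm b
  set l := absMoment * ‖p‖ / S with hl
  have hiabs : Integrable (fun x => |⟪p, x⟫|) (stdGaussian E) := by
    have h2 := (integral_inner_sq p).1
    refine (h2.add (integrable_const (1 : ℝ))).mono' (Measurable.aestronglyMeasurable
      (by fun_prop)) (Eventually.of_forall fun x => ?_)
    simp only [Real.norm_eq_abs, abs_abs, Pi.add_apply]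
    nlinarith [sq_abs ⟪p, x⟫, sq_nonneg (|⟪p, x⟫| - 1)]
  have hpt : ∀ x, 2 * l * |⟪p, x⟫| - l ^ 2 * quadForm b x ≤ ratio b p p x := by
    intro x
    rcases (quadForm_nonneg b x).eq_or_lt with h0 | h0
    · have hbx : ∀ i, ⟪b i, x⟫ = 0 := by
        intro i
        have := (Finset.sum_eq_zero_iff_of_nonneg fun i _ => sq_nonneg ⟪b i, x⟫).1 h0.symm i
          (Finset.mem_univ i)
        exact pow_eq_zero_iff two_ne_zero |>.1 this
      have : ⟪p, x⟫ = 0 := by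
        rw [hp, sum_inner]
        exact Finset.sum_eq_zero fun i _ => by rw [real_inner_smul_left, hbx, mul_zero]
      simp [ratio, this, ← h0]
    · have h1 : ratio b p p x = |⟪p, x⟫| ^ 2 / quadForm b x := by
        rw [ratio, sq_abs]; field_simp
      rw [h1, le_div_iff₀ h0]
      nlinarith [sq_nonneg (|⟪p, x⟫| - l * quadForm b x)]
  have h1 := integral_mono ((hiabs.const_mul (2 * l)).sub (hq.const_mul (l ^ 2))) hi hpt
  rw [integral_sub' (hiabs.const_mul (2 * l)) (hq.const_mul (l ^ 2)), integral_const_mul,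
    integral_const_mul, integral_abs_inner, hqe] at h1
  refine le_trans ?_ h1
  have h2 : l ^ 2 * ((∑ i, ‖b i‖ ^ 2) * moment2) ≤ l ^ 2 * S := by gcongr
  have h3 : (absMoment * ‖p‖) ^ 2 / S = 2 * l * (‖p‖ * absMoment) - l ^ 2 * S := by
    rw [hl]; field_simp; ring
  linarith

end SphericalSample

end GroupedFactor

namespace GroupedFactor

/-! ### Means and variances of averaged ratios -/

section PairRatio

open scoped RealInnerProductSpace ENNReal

set_option linter.unusedSectionVars false

variable {E : Type*} [NormedAddCommGroup E] [InnerProductSpace ℝ E] [FiniteDimensional ℝ E]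
  [MeasurableSpace E] [BorelSpace E]

theorem stdGaussian_inner_ne_zero {v : E} (hv : v ≠ 0) : ∀ᵐ x ∂stdGaussian E, ⟪v, x⟫ ≠ 0 := by
  have hm : AEMeasurable (fun x => ⟪v, x⟫) (stdGaussian E) := by fun_prop
  have h : ∀ᵐ y ∂(stdGaussian E).map (fun x => ⟪v, x⟫), y ≠ 0 := by
    rw [stdGaussian_map_inner]
    refine (ae_map_iff (by fun_prop) (measurableSet_singleton (0 : ℝ)).compl).2 ?_
    have := nullSingletonClass_gaussianReal (μ := 0) (v := 1) one_ne_zero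
    have h0 : ∀ᵐ y ∂gaussianReal 0 1, y ≠ 0 := by
      rw [ae_iff]; simp
    filter_upwards [h0] with y hy
    exact mul_ne_zero (norm_ne_zero_iff.2 hv) hy
  exact (ae_map_iff hm (measurableSet_singleton (0 : ℝ)).compl).1 h

theorem FrameBound.ne_zero {N : ℕ} {c : ℝ} (hc : 0 < c) {b : Fin N → E} (hb : FrameBound c b)
    (i : Fin N) : b i ≠ 0 := by
  intro h
  have := hb (Pi.single i 1)
  simp [Pi.single_apply, h] at this
  linarith

theorem FrameBound.quadForm_pos_ae {N : ℕ} (hN : 0 < N) {c : ℝ} (hc : 0 < c) {b : Fin N → E}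
    (hb : FrameBound c b) : ∀ᵐ x ∂stdGaussian E, 0 < quadForm b x := by
  filter_upwards [stdGaussian_inner_ne_zero (hb.ne_zero hc ⟨0, hN⟩)] with x hx
  exact lt_of_lt_of_le (by positivity)
    (Finset.single_le_sum (f := fun i => ⟪b i, x⟫ ^ 2) (fun i _ => sq_nonneg _)
      (Finset.mem_univ (⟨0, hN⟩ : Fin N)))

variable {T : ℕ} {Ω : Type*} [MeasurableSpace Ω] {Z : Fin T → Ω → E} {P : Measure Ω}
  [IsProbabilityMeasure P] {N : ℕ} {c : ℝ} {b b' : Fin N → E}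

/-- The average of `ratio b p q` over the differences of a sample. -/
def pairRatio (Z : Fin T → Ω → E) (b : Fin N → E) (p q : E) (ω : Ω) : ℝ :=
  pairAvg fun t s => ratio b p q (Z t ω - Z s ω)

theorem pairRatio_add_left (p p' q : E) (ω : Ω) :
    pairRatio Z b (p + p') q ω = pairRatio Z b p q ω + pairRatio Z b p' q ω := by
  simp only [pairRatio, ratio_add_left, pairAvg_add]

theorem pairRatio_comm (p q : E) (ω : Ω) : pairRatio Z b p q ω = pairRatio Z b q p ω := by
  simp only [pairRatio, ratio_comm b p q]

theorem pairRatio_sum_left {ι : Type*} (S : Finset ι) (k : ι → ℝ) (p : ι → E) (q : E) (ω : Ω) :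
    pairRatio Z b (∑ i ∈ S, k i • p i) q ω = ∑ i ∈ S, k i * pairRatio Z b (p i) q ω := by
  simp only [pairRatio, ratio_sum_left, pairAvg_sum, pairAvg_const_mul]

namespace SphericalSample

theorem abs_ratio_sub [Nontrivial E] (hZ : SphericalSample Z P) (hN : 9 ≤ N) (hc : 0 < c)
    (hb : FrameBound c b) (p q : E) {t s : Fin T} (hts : t ≠ s) :
    Integrable (fun ω => ratio b p q (Z t ω - Z s ω)) P ∧
      ∫ ω, |ratio b p q (Z t ω - Z s ω)| ∂P ≤ ratioMoment c * (‖p‖ * ‖q‖) / N := by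
  obtain ⟨h1, h2⟩ := integral_abs_ratio_le hN hc hb p q
  obtain ⟨h3, h4, -⟩ := hZ.compare hts (h := fun x => |ratio b p q x|)
    (measurable_ratio b p q).abs (fun k hk x => by rw [ratio_smul b p q hk]) (by simp)
    (fun x => abs_nonneg _) h1
  have hm : AEStronglyMeasurable (fun ω => ratio b p q (Z t ω - Z s ω)) P :=
    ((measurable_ratio b p q).comp_aemeasurable (hZ.aemeasurable_sub t s)).aestronglyMeasurable
  exact ⟨(integrable_norm_iff hm).1 h3, h4.trans h2⟩

theorem sq_ratio_sub [Nontrivial E] (hZ : SphericalSample Z P) (hN : 9 ≤ N) (hc : 0 < c)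
    (hb : FrameBound c b) (p q : E) {t s : Fin T} (hts : t ≠ s) :
    Integrable (fun ω => ratio b p q (Z t ω - Z s ω) ^ 2) P ∧
      ∫ ω, ratio b p q (Z t ω - Z s ω) ^ 2 ∂P ≤
        ratioMoment c * (‖p‖ ^ 2 * ‖q‖ ^ 2) / N ^ 2 := by
  obtain ⟨h1, h2⟩ := integral_sq_ratio_le hN hc hb p q
  obtain ⟨h3, h4, -⟩ := hZ.compare hts (h := fun x => ratio b p q x ^ 2)
    ((measurable_ratio b p q).pow_const 2) (fun k hk x => by rw [ratio_smul b p q hk]) (by simp)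
    (fun x => sq_nonneg _) h1
  exact ⟨h3, h4.trans h2⟩

theorem integrable_pairRatio [Nontrivial E] (hZ : SphericalSample Z P) (hN : 9 ≤ N) (hc : 0 < c)
    (hb : FrameBound c b) (p q : E) : Integrable (pairRatio Z b p q) P :=
  integrable_pairAvg fun _ _ h => (hZ.abs_ratio_sub hN hc hb p q h.ne).1

theorem integral_pairRatio_eq [Nontrivial E] (hZ : SphericalSample Z P) (hN : 9 ≤ N) (hc : 0 < c)
    (hb : FrameBound c b) (p q : E) : ∫ ω, pairRatio Z b p q ω ∂P =
      pairAvg fun t s => ∫ ω, ratio b p q (Z t ω - Z s ω) ∂P :=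
  integral_pairAvg fun _ _ h => (hZ.abs_ratio_sub hN hc hb p q h.ne).1

theorem abs_integral_pairRatio_le [Nontrivial E] (hZ : SphericalSample Z P) (hT : 2 ≤ T)
    (hN : 9 ≤ N) (hc : 0 < c) (hb : FrameBound c b) (p q : E) :
    |∫ ω, pairRatio Z b p q ω ∂P| ≤ ratioMoment c * (‖p‖ * ‖q‖) / N := by
  rw [hZ.integral_pairRatio_eq hN hc hb]
  refine (abs_pairAvg_le hT _).trans (pairAvg_le hT fun t s h => ?_)
  exact (abs_integral_le_integral_abs).trans (hZ.abs_ratio_sub hN hc hb p q h.ne).2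

theorem integral_abs_pairRatio_le [Nontrivial E] (hZ : SphericalSample Z P) (hT : 2 ≤ T)
    (hN : 9 ≤ N) (hc : 0 < c) (hb : FrameBound c b) (p q : E) :
    ∫ ω, |pairRatio Z b p q ω| ∂P ≤ ratioMoment c * (‖p‖ * ‖q‖) / N := by
  have hi := fun t s (h : t < s) => (hZ.abs_ratio_sub hN hc hb p q (t := t) (s := s) h.ne).1.abs
  refine (integral_mono (hZ.integrable_pairRatio hN hc hb p q).abs (integrable_pairAvg hi)
    fun ω => abs_pairAvg_le hT _).trans ?_
  rw [integral_pairAvg hi]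
  exact pairAvg_le hT fun t s h => (hZ.abs_ratio_sub hN hc hb p q h.ne).2

theorem integral_sq_pairRatio_sub_le [Nontrivial E] (hZ : SphericalSample Z P) (hT : 2 ≤ T)
    (hN : 9 ≤ N) (hc : 0 < c) (hb : FrameBound c b) (p q : E) :
    Integrable (fun ω => (pairRatio Z b p q ω - ∫ ω, pairRatio Z b p q ω ∂P) ^ 2) P ∧
    ∫ ω, (pairRatio Z b p q ω - ∫ ω, pairRatio Z b p q ω ∂P) ^ 2 ∂P ≤
      16 / T * (ratioMoment c * (‖p‖ ^ 2 * ‖q‖ ^ 2) / N ^ 2) := by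
  have hr := (ratioMoment_pos hc).le
  refine integral_sq_pairAvg_sub_le hT hZ.aemeasurable hZ.indep
    (h := fun x => ratio b p q (x.1 - x.2))
    ((measurable_ratio b p q).comp (by fun_prop)) (by positivity) (fun t s h => ?_)
    (fun t s h => (hZ.sq_ratio_sub hN hc hb p q h.ne).2)
  refine (memLp_two_iff_integrable_sq
    ((measurable_ratio b p q).comp_aemeasurable (hZ.aemeasurable_sub t s)).aestronglyMeasurable).2 ?_
  exact (hZ.sq_ratio_sub hN hc hb p q h.ne).1

theorem le_integral_pairRatio [Nontrivial E] (hZ : SphericalSample Z P) (hT : 2 ≤ T)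
    (hN : 9 ≤ N) (hc : 0 < c) (hb : FrameBound c b) (u : Fin N → ℝ) {S : ℝ} (hS : 0 < S)
    (hbS : (∑ i, ‖b i‖ ^ 2) * moment2 ≤ S) :
    1 / 2 * ((absMoment * ‖∑ i, u i • b i‖) ^ 2 / S) ≤
      ∫ ω, pairRatio Z b (∑ i, u i • b i) (∑ i, u i • b i) ω ∂P := by
  set p := ∑ i, u i • b i with hp
  have hpos : ∀ x, 0 ≤ ratio b p p x := fun x =>
    mul_nonneg (inv_nonneg.2 (quadForm_nonneg b x)) (mul_self_nonneg _)
  have hi : Integrable (ratio b p p) (stdGaussian E) := by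
    have := (integral_abs_ratio_le hN hc hb p p).1
    simpa only [abs_of_nonneg (hpos _)] using this
  rw [hZ.integral_pairRatio_eq hN hc hb]
  refine le_pairAvg hT fun t s h => ?_
  refine le_trans ?_ (hZ.compare h.ne (measurable_ratio b p p)
    (fun k hk x => ratio_smul b p p hk x) (by simp) hpos hi).2.2
  exact mul_le_mul_of_nonneg_left (le_integral_ratio u hS hbS hi) (by norm_num)

/-- If a reflection fixes `e`, negates `f` and turns the frame `b` into `b'`, then the mean of
`ratio b e f` is small, of the order of the difference of the two quadratic forms. -/
theorem abs_integral_pairRatio_reflect [Nontrivial E] (hZ : SphericalSample Z P) (hT : 2 ≤ T)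
    (hN : 9 ≤ N) (hc : 0 < c) (hb : FrameBound c b) (hb' : FrameBound c b')
    (φ : E ≃ₗᵢ[ℝ] E) {e f : E} (he : ∀ x, ⟪e, φ x⟫ = ⟪e, x⟫) (hf : ∀ x, ⟪f, φ x⟫ = -⟪f, x⟫)
    (hq : ∀ x, quadForm b (φ x) = quadForm b' x) {m : ℕ} (p w : Fin m → E)
    (hd : ∀ x, |quadForm b' x - quadForm b x| ≤ 4 * ∑ a, |⟪p a, x⟫ * ⟪w a, x⟫|) :
    |∫ ω, pairRatio Z b e f ω ∂P| ≤
      2 * ∑ a, ratioMoment c * (‖e‖ * ‖f‖ * ‖p a‖ * ‖w a‖) / N ^ 2 := by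
  rw [hZ.integral_pairRatio_eq hN hc hb]
  refine (abs_pairAvg_le hT _).trans (pairAvg_le hT fun t s h => ?_)
  have hi := (hZ.abs_ratio_sub hN hc hb e f h.ne).1
  have hi' := (hZ.abs_ratio_sub hN hc hb' e f h.ne).1
  have hms := hZ.aemeasurable_sub t s
  -- Sphericity allows replacing the difference by its image under `φ`, which negates the numerator
  -- and exchanges the frames.
  have hflip : ∫ ω, ratio b e f (Z t ω - Z s ω) ∂P = -∫ ω, ratio b' e f (Z t ω - Z s ω) ∂P := by
    rw [← integral_map (f := ratio b e f) hms (measurable_ratio _ _ _).aestronglyMeasurable,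
      ← hZ.spherical_sub h.ne φ, integral_map (by fun_prop)
        (measurable_ratio _ _ _).aestronglyMeasurable,
      integral_map (f := fun x => ratio b e f (φ x)) hms
        ((measurable_ratio b e f).comp φ.continuous.measurable).aestronglyMeasurable,
      ← integral_neg]
    refine integral_congr_ae (Eventually.of_forall fun ω => ?_)
    simp only [ratio, he, hf, hq]
    ring
  set k : E → ℝ := fun x => |ratio b e f x - ratio b' e f x| with hk
  have hkm : Measurable k := ((measurable_ratio b e f).sub (measurable_ratio b' e f)).abs
  have hgi : ∀ {b : Fin N → E}, FrameBound c b → Integrable (ratio b e f) (stdGaussian E) :=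
    fun hb => (integrable_norm_iff (measurable_ratio _ _ _).aestronglyMeasurable).1
      (integral_abs_ratio_le hN hc hb e f).1
  have hki : Integrable k (stdGaussian E) := ((hgi hb).sub (hgi hb')).abs
  have hle := (hZ.compare h.ne hkm (fun l hl x => by
    simp only [hk, ratio_smul _ _ _ hl]) (by simp [hk]) (fun x => abs_nonneg _) hki).2.1
  have hγ : ∫ x, k x ∂stdGaussian E ≤
      4 * ∑ a, ratioMoment c * (‖e‖ * ‖f‖ * ‖p a‖ * ‖w a‖) / N ^ 2 := by
    have hfour := fun a => integral_four_ratio hN hc hb hb' e f (p a) (w a)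
    refine (integral_mono_ae hki ((integrable_finsetSum Finset.univ
      fun a _ => (hfour a).1).const_mul 4) ?_).trans ?_
    · filter_upwards [hb.quadForm_pos_ae (by omega) hc, hb'.quadForm_pos_ae (by omega) hc]
        with x h1 h2
      -- Over the common denominator the difference consists of products of four linear forms over
      -- two quadratic forms, which `integral_four_ratio` bounds.
      have e1 : ratio b e f x - ratio b' e f x =
          (⟪e, x⟫ * ⟪f, x⟫) * (quadForm b' x - quadForm b x) *
            ((quadForm b x)⁻¹ * (quadForm b' x)⁻¹) := by
        unfold ratio; field_simp
      have hqq : 0 ≤ (quadForm b x)⁻¹ * (quadForm b' x)⁻¹ := by positivity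
      simp only [hk, e1, abs_mul _ ((quadForm b x)⁻¹ * (quadForm b' x)⁻¹), abs_of_nonneg hqq]
      rw [← Finset.sum_mul, ← mul_assoc (4 : ℝ)]
      refine mul_le_mul_of_nonneg_right ?_ hqq
      rw [abs_mul]
      refine (mul_le_mul_of_nonneg_left (hd x) (abs_nonneg _)).trans (le_of_eq ?_)
      rw [mul_left_comm, Finset.mul_sum]
      congr 1
      refine Finset.sum_congr rfl fun a _ => ?_
      rw [← abs_mul]; congr 1; ring
    · rw [integral_const_mul, integral_finsetSum _ fun a _ => (hfour a).1]
      exact mul_le_mul_of_nonneg_left (Finset.sum_le_sum fun a _ => (hfour a).2) (by norm_num)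
  have h2 : 2 * |∫ ω, ratio b e f (Z t ω - Z s ω) ∂P| ≤ ∫ ω, k (Z t ω - Z s ω) ∂P := by
    have e2 : 2 * ∫ ω, ratio b e f (Z t ω - Z s ω) ∂P =
        ∫ ω, ratio b e f (Z t ω - Z s ω) - ratio b' e f (Z t ω - Z s ω) ∂P := by
      rw [integral_sub hi hi']; linarith
    rw [← abs_two (α := ℝ), ← abs_mul, e2]
    exact abs_integral_le_integral_abs
  linarith

end SphericalSample

end PairRatio

end GroupedFactor

namespace GroupedFactor

/-! ### The panel in terms of one spherical sample -/

namespace Panel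

open scoped RealInnerProductSpace ENNReal

variable {m K₀ : ℕ} (D : Panel.{u} m K₀)

/-- The Euclidean space of the source vectors. -/
abbrev Space : Type := EuclideanSpace ℝ (Fin m ⊕ Fin D.N)

/-- The spherical vector `ξ_t g_t / ‖g_t‖`. -/
def sph (t : Fin D.T) (ω : D.Ω) : D.Space :=
  (D.ξ t ω / l2norm (D.g t ω)) • WithLp.toLp 2 (D.g t ω)

/-- The coordinate vector of the `a`-th factor. -/
def fvec (a : Fin m) : D.Space := EuclideanSpace.single (Sum.inl a) 1

/-- The coordinate vector of the `i`-th Gaussian source of the errors. -/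
def gvec (i : Fin D.N) : D.Space := EuclideanSpace.single (Sum.inr i) 1

/-- The vector that represents the error of unit `i`. -/
def evec (i : Fin D.N) : D.Space := WithLp.toLp 2 (Sum.elim 0 (D.A i))

/-- The vector that represents the data of unit `i` under the loading matrix `Λ`. -/
def yvec (Λ : Matrix (Fin D.N) (Fin m) ℝ) (i : Fin D.N) : D.Space :=
  D.evec i + ∑ a, Λ i a • D.fvec a

theorem inner_fvec (a : Fin m) (x : D.Space) : ⟪D.fvec a, x⟫ = x (Sum.inl a) := by
  simp [fvec, EuclideanSpace.inner_single_left]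

theorem inner_gvec (i : Fin D.N) (x : D.Space) : ⟪D.gvec i, x⟫ = x (Sum.inr i) := by
  simp [gvec, EuclideanSpace.inner_single_left]

theorem inner_evec (i : Fin D.N) (x : D.Space) : ⟪D.evec i, x⟫ = ∑ k, D.A i k * x (Sum.inr k) := by
  simp [evec, PiLp.inner_apply, mul_comm]

theorem inner_yvec (Λ : Matrix (Fin D.N) (Fin m) ℝ) (i : Fin D.N) (x : D.Space) :
    ⟪D.yvec Λ i, x⟫ = ⟪D.evec i, x⟫ + ∑ a, Λ i a * ⟪D.fvec a, x⟫ := by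
  simp only [yvec, inner_add_left, sum_inner, real_inner_smul_left]

theorem f_eq (t : Fin D.T) (ω : D.Ω) (a : Fin m) : D.f t ω a = ⟪D.fvec a, D.sph t ω⟫ := by
  simp [inner_fvec, f, source, sph, Matrix.mulVec, dotProduct, Fintype.sum_sum_type,
    Matrix.one_apply]

theorem eps_eq (i : Fin D.N) (t : Fin D.T) (ω : D.Ω) : D.eps i t ω = ⟪D.evec i, D.sph t ω⟫ := by
  simp [inner_evec, eps, source, sph, Matrix.mulVec, dotProduct, Fintype.sum_sum_type,
    Finset.mul_sum, mul_left_comm]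

theorem Y_eq (ω : D.Ω) (t : Fin D.T) (i : Fin D.N) : D.Y ω t i = ⟪D.yvec D.Lam i, D.sph t ω⟫ := by
  rw [inner_yvec, ← eps_eq, add_comm]
  simp only [← f_eq]
  rfl

theorem Y_sub_eq (ω : D.Ω) (t s : Fin D.T) (i : Fin D.N) :
    (D.Y ω t - D.Y ω s) i = ⟪D.yvec D.Lam i, D.sph t ω - D.sph s ω⟫ := by
  rw [inner_sub_right, ← Y_eq, ← Y_eq]; rfl

theorem l2norm_sq_eq_sum {ι : Type*} [Fintype ι] (x : ι → ℝ) : l2norm x ^ 2 = ∑ i, x i ^ 2 := by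
  rw [l2norm, EuclideanSpace.real_norm_sq_eq]

theorem l2norm_Y_sub (ω : D.Ω) (t s : Fin D.T) :
    l2norm (D.Y ω t - D.Y ω s) ^ 2 = quadForm (D.yvec D.Lam) (D.sph t ω - D.sph s ω) := by
  simp only [l2norm_sq_eq_sum, Y_sub_eq, quadForm]

/-- Pairwise averages of normalized products in the panel. -/
def avgRatio (p q : D.Space) (ω : D.Ω) : ℝ := pairRatio D.sph (D.yvec D.Lam) p q ω

theorem kendall_apply (ω : D.Ω) (i j : Fin D.N) :
    kendall (D.Y ω) i j = D.avgRatio (D.yvec D.Lam i) (D.yvec D.Lam j) ω := by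
  simp only [kendall, avgRatio, pairRatio, pairAvg, ratio, Matrix.smul_apply, Matrix.sum_apply,
    Matrix.vecMulVec_apply, l2norm_Y_sub, Y_sub_eq, smul_eq_mul]

theorem M1_apply (ω : D.Ω) (a b : Fin m) :
    D.M1 ω a b = D.avgRatio (D.fvec a) (D.fvec b) ω := by
  have e : ∀ t s a, (D.f t ω - D.f s ω) a = ⟪D.fvec a, D.sph t ω - D.sph s ω⟫ := by
    intro t s a
    rw [inner_sub_right, ← f_eq, ← f_eq]; rfl
  simp only [M1, avgRatio, pairRatio, pairAvg, ratio, Matrix.smul_apply, Matrix.sum_apply,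
    Matrix.vecMulVec_apply, l2norm_Y_sub, e, smul_eq_mul]

/-- The error-factor block of the decomposition of the Kendall matrix. -/
def M2 (ω : D.Ω) : Matrix (Fin D.N) (Fin m) ℝ :=
  Matrix.of fun i a => D.avgRatio (D.evec i) (D.fvec a) ω

/-- The error-error block of the decomposition of the Kendall matrix. -/
def M3 (ω : D.Ω) : Matrix (Fin D.N) (Fin D.N) ℝ :=
  Matrix.of fun i j => D.avgRatio (D.evec i) (D.evec j) ω

theorem avgRatio_comm (p q : D.Space) (ω : D.Ω) : D.avgRatio p q ω = D.avgRatio q p ω :=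
  pairRatio_comm p q ω

theorem avgRatio_yvec_left (i : Fin D.N) (q : D.Space) (ω : D.Ω) :
    D.avgRatio (D.yvec D.Lam i) q ω =
      D.avgRatio (D.evec i) q ω + ∑ a, D.Lam i a * D.avgRatio (D.fvec a) q ω := by
  unfold avgRatio
  rw [yvec, pairRatio_add_left, pairRatio_sum_left]

theorem kendall_decomp (ω : D.Ω) : kendall (D.Y ω) =
    D.Lam * D.M1 ω * D.Lam.transpose + D.Lam * (D.M2 ω).transpose + D.M2 ω * D.Lam.transpose
      + D.M3 ω := by
  ext i j
  rw [kendall_apply, avgRatio_yvec_left, avgRatio_comm, avgRatio_yvec_left]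
  simp only [fun a => D.avgRatio_comm (D.fvec a) (D.yvec D.Lam j) ω, avgRatio_yvec_left]
  simp only [Matrix.add_apply, Matrix.mul_apply, Matrix.transpose_apply, M2, M3, Matrix.of_apply,
    M1_apply, mul_add, Finset.sum_add_distrib, Finset.mul_sum, Finset.sum_mul]
  rw [D.avgRatio_comm (D.evec j) (D.evec i),
    Finset.sum_comm (f := fun x y => D.Lam i y * D.avgRatio (D.fvec y) (D.fvec x) ω * D.Lam j x)]
  simp only [fun a => D.avgRatio_comm (D.fvec a) (D.evec i) ω, fun a b =>
    D.avgRatio_comm (D.fvec a) (D.fvec b) ω]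
  have e1 : ∑ a, D.Lam j a * D.avgRatio (D.evec i) (D.fvec a) ω =
      ∑ a, D.avgRatio (D.evec i) (D.fvec a) ω * D.Lam j a :=
    Finset.sum_congr rfl fun _ _ => mul_comm _ _
  have e2 : ∑ a, ∑ b, D.Lam i a * (D.Lam j b * D.avgRatio (D.fvec a) (D.fvec b) ω) =
      ∑ a, ∑ b, D.Lam i a * D.avgRatio (D.fvec a) (D.fvec b) ω * D.Lam j b :=
    Finset.sum_congr rfl fun a _ => Finset.sum_congr rfl fun b _ => by ring
  linarith

/-- The errors as a `T × N` matrix. -/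
def epsMat (ω : D.Ω) : Matrix (Fin D.T) (Fin D.N) ℝ := Matrix.of fun t i => D.eps i t ω

/-- The factors as a `T × m` matrix. -/
def facMat (ω : D.Ω) : Matrix (Fin D.T) (Fin m) ℝ := Matrix.of fun t => D.f t ω

theorem Y_eq_mul (ω : D.Ω) : D.Y ω = D.facMat ω * D.Lam.transpose + D.epsMat ω := by
  ext t i
  simp [Y, facMat, epsMat, Matrix.mul_apply, dotProduct, mul_comm]

/-- Two-sided bounds for the quadratic form of the scatter matrix of the errors, and a bound for
the loadings. -/
structure ScaleBounds (c₁ c₂ B : ℝ) : Prop where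
  pos₁ : 0 < c₁
  pos₂ : 0 < c₂
  B_nonneg : 0 ≤ B
  lower : ∀ u : Fin D.N → ℝ, c₂ * ∑ i, u i ^ 2 ≤ ‖∑ i, u i • D.evec i‖ ^ 2
  upper : ∀ u : Fin D.N → ℝ, ‖∑ i, u i • D.evec i‖ ^ 2 ≤ c₁ * ∑ i, u i ^ 2
  loading : ∀ i, ∑ a, D.Lam i a ^ 2 ≤ B ^ 2

theorem norm_fvec (a : Fin m) : ‖D.fvec a‖ = 1 := by simp [fvec]

theorem norm_sum_fvec (k : Fin m → ℝ) : ‖∑ a, k a • D.fvec a‖ ^ 2 = ∑ a, k a ^ 2 := by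
  rw [EuclideanSpace.real_norm_sq_eq, Fintype.sum_sum_type]
  simp [fvec, Pi.single_apply, WithLp.ofLp_sum]

theorem inner_evec_fvec (i : Fin D.N) (a : Fin m) : ⟪D.evec i, D.fvec a⟫ = 0 := by
  rw [real_inner_comm, inner_fvec]; simp [evec]

theorem norm_sum_yvec (Λ : Matrix (Fin D.N) (Fin m) ℝ) (u : Fin D.N → ℝ) :
    ‖∑ i, u i • D.yvec Λ i‖ ^ 2 =
      ‖∑ i, u i • D.evec i‖ ^ 2 + ∑ a, (∑ i, u i * Λ i a) ^ 2 := by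
  have e : ∑ i, u i • D.yvec Λ i =
      ∑ i, u i • D.evec i + ∑ a, (∑ i, u i * Λ i a) • D.fvec a := by
    simp only [yvec, smul_add, Finset.sum_add_distrib, Finset.smul_sum, Finset.sum_smul, smul_smul]
    rw [Finset.sum_comm]
  have h0 : ⟪∑ i, u i • D.evec i, ∑ a, (∑ i, u i * Λ i a) • D.fvec a⟫ = 0 := by
    simp [sum_inner, inner_sum, real_inner_smul_left, real_inner_smul_right, inner_evec_fvec]
  rw [e, norm_add_sq_real, h0, norm_sum_fvec]
  ring

/-- The reflection of the factor coordinates. -/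
def factorNeg : D.Space ≃ₗᵢ[ℝ] D.Space :=
  LinearIsometryEquiv.piLpCongrRight 2 fun k =>
    Sum.casesOn k (fun _ => LinearIsometryEquiv.neg ℝ) fun _ => LinearIsometryEquiv.refl ℝ ℝ

theorem inner_fvec_factorNeg (a : Fin m) (x : D.Space) :
    ⟪D.fvec a, D.factorNeg x⟫ = -⟪D.fvec a, x⟫ := by
  rw [inner_fvec, inner_fvec]
  simp [factorNeg, LinearIsometryEquiv.piLpCongrRight_apply]

theorem inner_evec_factorNeg (i : Fin D.N) (x : D.Space) :
    ⟪D.evec i, D.factorNeg x⟫ = ⟪D.evec i, x⟫ := by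
  rw [inner_evec, inner_evec]
  simp [factorNeg, LinearIsometryEquiv.piLpCongrRight_apply]

/-- The reflection of the factors has the same effect as a change of sign of the loadings. -/
theorem quadForm_factorNeg (Λ : Matrix (Fin D.N) (Fin m) ℝ) (x : D.Space) :
    quadForm (D.yvec Λ) (D.factorNeg x) = quadForm (D.yvec (-Λ)) x := by
  simp only [quadForm, inner_yvec, inner_fvec_factorNeg, inner_evec_factorNeg, Matrix.neg_apply,
    neg_mul, mul_neg]

/-- Squares cancel and only cross terms of factors and errors survive. Summing over units first
collects the errors in `m` vectors `∑ Λ_ia e_i`, of norm `O(√N)` instead of the trivial `O(N)`. -/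
theorem abs_quadForm_neg_sub_le (Λ : Matrix (Fin D.N) (Fin m) ℝ) (x : D.Space) :
    |quadForm (D.yvec (-Λ)) x - quadForm (D.yvec Λ) x| ≤
      4 * ∑ a, |⟪D.fvec a, x⟫ * ⟪∑ i, Λ i a • D.evec i, x⟫| := by
  have e : quadForm (D.yvec (-Λ)) x - quadForm (D.yvec Λ) x =
      -4 * ∑ a, ⟪D.fvec a, x⟫ * ⟪∑ i, Λ i a • D.evec i, x⟫ := by
    have h1 : ∑ a, ⟪D.fvec a, x⟫ * ⟪∑ i, Λ i a • D.evec i, x⟫ =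
        ∑ i, ⟪D.evec i, x⟫ * ∑ a, Λ i a * ⟪D.fvec a, x⟫ := by
      simp only [sum_inner, real_inner_smul_left, Finset.mul_sum]
      rw [Finset.sum_comm]
      exact Finset.sum_congr rfl fun i _ => Finset.sum_congr rfl fun a _ => by ring
    rw [h1, Finset.mul_sum, quadForm, quadForm, ← Finset.sum_sub_distrib]
    refine Finset.sum_congr rfl fun i _ => ?_
    simp only [inner_yvec, Matrix.neg_apply, neg_mul, Finset.sum_neg_distrib]
    ring
  rw [e, abs_mul, abs_neg, abs_of_pos (by norm_num : (0 : ℝ) < 4)]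
  exact mul_le_mul_of_nonneg_left (Finset.abs_sum_le_sum_abs _ _) (by norm_num)

variable {D}

namespace ScaleBounds

variable {c₁ c₂ B : ℝ}

/-- Errors and factors occupy orthogonal coordinates, so the errors alone give the bound. It holds
for every loading matrix, in particular for `Λ` and `-Λ` with one constant. -/
theorem frameBound (h : D.ScaleBounds c₁ c₂ B) (Λ : Matrix (Fin D.N) (Fin m) ℝ) :
    FrameBound c₂ (D.yvec Λ) := fun u => by
  rw [norm_sum_yvec]
  exact (h.lower u).trans (le_add_of_nonneg_right (Finset.sum_nonneg fun _ _ => sq_nonneg _))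

theorem norm_evec_sq_le (h : D.ScaleBounds c₁ c₂ B) (i : Fin D.N) : ‖D.evec i‖ ^ 2 ≤ c₁ := by
  have := h.upper (Pi.single i 1)
  simpa [Pi.single_apply] using this

theorem le_norm_evec_sq (h : D.ScaleBounds c₁ c₂ B) (i : Fin D.N) : c₂ ≤ ‖D.evec i‖ ^ 2 := by
  have := h.lower (Pi.single i 1)
  simpa [Pi.single_apply] using this

theorem norm_yvec_sq_le (h : D.ScaleBounds c₁ c₂ B) (i : Fin D.N) :
    ‖D.yvec D.Lam i‖ ^ 2 ≤ c₁ + B ^ 2 := by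
  have := D.norm_sum_yvec D.Lam (Pi.single i 1)
  simp only [Pi.single_apply, ite_smul, one_smul, zero_smul, Finset.sum_ite_eq', Finset.mem_univ,
    if_true, ite_mul, one_mul, zero_mul] at this
  rw [this]
  exact add_le_add (h.norm_evec_sq_le i) (h.loading i)

theorem abs_Lam_le (h : D.ScaleBounds c₁ c₂ B) (i : Fin D.N) (a : Fin m) : |D.Lam i a| ≤ B := by
  refine abs_le_of_sq_le_sq ?_ h.B_nonneg
  exact (Finset.single_le_sum (f := fun a => D.Lam i a ^ 2) (fun _ _ => sq_nonneg _)
    (Finset.mem_univ a)).trans (h.loading i)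

theorem norm_loading_sum_le (h : D.ScaleBounds c₁ c₂ B) (a : Fin m) :
    ‖∑ i, D.Lam i a • D.evec i‖ ≤ Real.sqrt c₁ * B * Real.sqrt D.N := by
  have h1 := h.upper fun i => D.Lam i a
  have h2 : ∑ i, D.Lam i a ^ 2 ≤ D.N * B ^ 2 := by
    have : ∑ i : Fin D.N, D.Lam i a ^ 2 ≤ ∑ _i : Fin D.N, B ^ 2 :=
      Finset.sum_le_sum fun i _ => sq_le_sq' (abs_le.1 (h.abs_Lam_le i a)).1
        (abs_le.1 (h.abs_Lam_le i a)).2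
    simpa using this
  have hB := h.B_nonneg
  refine abs_le_of_sq_le_sq' ?_ (by positivity) |>.2
  calc _ ≤ c₁ * (D.N * B ^ 2) := h1.trans (mul_le_mul_of_nonneg_left h2 h.pos₁.le)
    _ = _ := by
      rw [mul_pow, mul_pow, Real.sq_sqrt h.pos₁.le, Real.sq_sqrt (Nat.cast_nonneg _)]; ring

end ScaleBounds

end Panel

end GroupedFactor

namespace GroupedFactor

open scoped RealInnerProductSpace ENNReal

/-! ### Quadratic forms and the spectrum -/

section Spectrum

variable {N : ℕ}

theorem dotProduct_nonneg_of_spectrum {S : Matrix (Fin N) (Fin N) ℝ} (hS : S.IsHermitian)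
    (h : ∀ μ ∈ spectrum ℝ S, 0 ≤ μ) (u : Fin N → ℝ) : 0 ≤ u ⬝ᵥ S.mulVec u := by
  have hp : S.PosSemidef := hS.posSemidef_iff_eigenvalues_nonneg.2 fun i =>
    h _ (hS.spectrum_real_eq_range_eigenvalues ▸ Set.mem_range_self i)
  simpa using hp.dotProduct_mulVec_nonneg u

theorem dotProduct_bounds_of_spectrum {S : Matrix (Fin N) (Fin N) ℝ} (hS : S.IsHermitian)
    {c₁ c₂ : ℝ} (h : ∀ μ ∈ spectrum ℝ S, c₂ ≤ μ ∧ μ ≤ c₁) (u : Fin N → ℝ) :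
    c₂ * ∑ i, u i ^ 2 ≤ u ⬝ᵥ S.mulVec u ∧ u ⬝ᵥ S.mulVec u ≤ c₁ * ∑ i, u i ^ 2 := by
  have hu : u ⬝ᵥ u = ∑ i, u i ^ 2 := by simp [dotProduct, sq]
  have hh : ∀ c : ℝ, (algebraMap ℝ (Matrix (Fin N) (Fin N) ℝ) c).IsHermitian := fun c => by
    simp [Matrix.IsHermitian, Matrix.algebraMap_eq_diagonal]
  have hmul : ∀ c : ℝ, (algebraMap ℝ (Matrix (Fin N) (Fin N) ℝ) c).mulVec u = c • u := fun c => by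
    rw [Algebra.algebraMap_eq_smul_one, Matrix.smul_mulVec, Matrix.one_mulVec]
  constructor
  · have := dotProduct_nonneg_of_spectrum (hS.sub (hh c₂)) (fun μ hμ => by
      rw [← spectrum.sub_singleton_eq] at hμ
      obtain ⟨ν, hν, _, rfl, rfl⟩ := hμ
      exact sub_nonneg.2 (h ν hν).1) u
    rw [Matrix.sub_mulVec, dotProduct_sub, hmul, dotProduct_smul, hu, smul_eq_mul] at this
    linarith
  · have := dotProduct_nonneg_of_spectrum ((hh c₁).sub hS) (fun μ hμ => by
      rw [← spectrum.singleton_sub_eq] at hμ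
      obtain ⟨_, rfl, ν, hν, rfl⟩ := hμ
      exact sub_nonneg.2 (h ν hν).2) u
    rw [Matrix.sub_mulVec, dotProduct_sub, hmul, dotProduct_smul, hu, smul_eq_mul] at this
    linarith

end Spectrum

/-! ### Radius and direction of the sources -/

namespace Panel
variable {m K₀ : ℕ} (D : Panel.{u} m K₀)

theorem norm_sum_evec (u : Fin D.N → ℝ) :
    ‖∑ i, u i • D.evec i‖ ^ 2 = u ⬝ᵥ D.SigmaEps.mulVec u := by
  rw [SigmaEps, ← Matrix.mulVec_mulVec, Matrix.dotProduct_mulVec, ← Matrix.mulVec_transpose,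
    EuclideanSpace.real_norm_sq_eq, Fintype.sum_sum_type]
  simp [evec, WithLp.ofLp_sum, Matrix.mulVec, dotProduct, sq, mul_comm]

theorem scaleBounds {c₁ c₂ B : ℝ} (h₁ : 0 < c₁) (h₂ : 0 < c₂)
    (hs : ∀ μ ∈ spectrum ℝ D.SigmaEps, c₂ ≤ μ ∧ μ ≤ c₁) (hB : ∀ i, l2norm (D.Lam i) ≤ B)
    (hB0 : 0 ≤ B) :
    D.ScaleBounds c₁ c₂ B := by
  have hH : D.SigmaEps.IsHermitian := by
    simpa [SigmaEps] using Matrix.isHermitian_mul_conjTranspose_self D.A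
  refine ⟨h₁, h₂, hB0, fun u => ?_, fun u => ?_, fun i => ?_⟩
  · rw [norm_sum_evec]; exact (dotProduct_bounds_of_spectrum hH hs u).1
  · rw [norm_sum_evec]; exact (dotProduct_bounds_of_spectrum hH hs u).2
  · rw [← l2norm_sq_eq_sum]
    exact pow_le_pow_left₀ (norm_nonneg _) (hB i) 2

/-- The polar recombination `(r, x) ↦ r x / ‖x‖`. -/
def polar {E : Type*} [NormedAddCommGroup E] [NormedSpace ℝ E] (p : ℝ × E) : E :=
  (p.1 / ‖p.2‖) • p.2

theorem measurable_polar {E : Type*} [NormedAddCommGroup E] [InnerProductSpace ℝ E]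
    [FiniteDimensional ℝ E] [MeasurableSpace E] [BorelSpace E] :
    Measurable (polar : ℝ × E → E) := by unfold polar; fun_prop

variable {D}

/-- Independent draws of a radius with law `ν` and a standard Gaussian vector. -/
structure PolarSample (ν : Measure ℝ) : Prop where
  law : ∀ t, HasLaw (fun ω => (D.ξ t ω, D.g t ω))
      (ν.prod (Measure.pi fun _ : Fin m ⊕ Fin D.N => gaussianReal 0 1)) D.P
  indep : iIndepFun (fun t ω => (D.ξ t ω, D.g t ω)) D.P
  pos : ∀ t, ∀ᵐ ω ∂D.P, 0 < D.ξ t ω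

namespace PolarSample

variable {ν : Measure ℝ} [IsProbabilityMeasure ν]

theorem hasLaw (h : PolarSample (D := D) ν) (t : Fin D.T) :
    HasLaw (fun ω => (D.ξ t ω, (WithLp.toLp 2 (D.g t ω) : D.Space)))
      (ν.prod (stdGaussian D.Space)) D.P where
  aemeasurable := by
    have := (h.law t).aemeasurable
    exact (show Measurable fun p : ℝ × (Fin m ⊕ Fin D.N → ℝ) => (p.1, (WithLp.toLp 2 p.2 : D.Space))
      by fun_prop).comp_aemeasurable this
  map_eq := by
    have hm : Measurable (Prod.map id (WithLp.toLp 2) :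
      ℝ × (Fin m ⊕ Fin D.N → ℝ) → ℝ × D.Space) := by fun_prop
    rw [← map_pi_eq_stdGaussian]
    conv_rhs => rw [← Measure.map_id (μ := ν)]
    rw [Measure.map_prod_map _ _ (by fun_prop) (by fun_prop), ← (h.law t).map_eq,
      AEMeasurable.map_map_of_aemeasurable hm.aemeasurable (h.law t).aemeasurable]
    rfl

theorem hasLaw_sph (h : PolarSample (D := D) ν) (t : Fin D.T) :
    HasLaw (D.sph t) ((ν.prod (stdGaussian D.Space)).map polar) D.P where
  aemeasurable := measurable_polar.comp_aemeasurable (h.hasLaw t).aemeasurable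
  map_eq := by
    rw [← (h.hasLaw t).map_eq, AEMeasurable.map_map_of_aemeasurable
      measurable_polar.aemeasurable (h.hasLaw t).aemeasurable]
    rfl

theorem sphericalSample [Nontrivial D.Space] (h : PolarSample (D := D) ν) :
    SphericalSample D.sph D.P where
  aemeasurable t := (h.hasLaw_sph t).aemeasurable
  indep := h.indep.comp (fun _ p => polar (p.1, (WithLp.toLp 2 p.2 : D.Space)))
    fun _ => measurable_polar.comp (by fun_prop)
  spherical t := by
    intro φ
    rw [(h.hasLaw_sph t).map_eq, Measure.map_map (by fun_prop) measurable_polar]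
    have hp : (ν.prod (stdGaussian D.Space)).map (Prod.map id φ) =
        ν.prod (stdGaussian D.Space) := by
      rw [← Measure.map_prod_map _ _ (by fun_prop) (by fun_prop), Measure.map_id,
        isSpherical_stdGaussian φ]
    conv_rhs => rw [← hp, Measure.map_map measurable_polar (by fun_prop)]
    congr 1
    ext1 p
    simp [polar]
  zero t := by
    rw [Measure.map_apply_of_aemeasurable (h.hasLaw_sph t).aemeasurable
      (measurableSet_singleton _)]
    have hg : ∀ᵐ ω ∂D.P, (WithLp.toLp 2 (D.g t ω) : D.Space) ≠ 0 := by
      have h1 : ∀ᵐ p ∂(ν.prod (stdGaussian D.Space)), p.2 ≠ 0 := by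
        rw [ae_iff]
        have : {p : ℝ × D.Space | ¬p.2 ≠ 0} = Set.univ ×ˢ {0} := by ext; simp
        rw [this, Measure.prod_prod, stdGaussian_singleton_zero, mul_zero]
      rw [← (h.hasLaw t).map_eq] at h1
      exact ae_of_ae_map (h.hasLaw t).aemeasurable h1
    have h2 : ∀ᵐ ω ∂D.P, D.sph t ω ≠ 0 := by
      filter_upwards [hg, h.pos t] with ω h1 h2
      exact smul_ne_zero (div_ne_zero h2.ne' (norm_ne_zero_iff.2 h1)) h1
    rw [ae_iff] at h2
    simp only [not_not] at h2
    exact h2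

/-- The mean of a function of degree two factors into a radial and a Gaussian part. -/
theorem lintegral_sq_homogeneous (h : PolarSample (D := D) ν) {k : D.Space → ℝ}
    (hm : Measurable k) (hk : ∀ (c : ℝ) x, k (c • x) = c ^ 2 * k x) (t : Fin D.T) :
    ∫⁻ ω, ENNReal.ofReal (k (D.sph t ω)) ∂D.P = (∫⁻ r, ENNReal.ofReal (r ^ 2) ∂ν) *
      ∫⁻ x, ENNReal.ofReal (k x / ‖x‖ ^ 2) ∂stdGaussian D.Space := by
  have hm' : Measurable fun x : D.Space => ENNReal.ofReal (k x) := hm.ennreal_ofReal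
  rw [← lintegral_map' (f := fun x => ENNReal.ofReal (k x)) hm'.aemeasurable
    (h.hasLaw_sph t).aemeasurable, (h.hasLaw_sph t).map_eq, lintegral_map hm' measurable_polar,
    ← lintegral_prod_mul (by fun_prop) (by fun_prop)]
  refine lintegral_congr fun p => ?_
  rw [polar, hk, ← ENNReal.ofReal_mul (sq_nonneg _)]
  congr 1
  ring

end PolarSample

end Panel

end GroupedFactor

namespace GroupedFactor

open scoped RealInnerProductSpace ENNReal

section MeanLE

variable {Ω : Type*} [MeasurableSpace Ω] {P : Measure Ω} {X X' : Ω → ℝ} {C C' : ℝ}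

/-- `X` is integrable, with mean at most `C`. -/
def MeanLE (P : Measure Ω) (X : Ω → ℝ) (C : ℝ) : Prop := Integrable X P ∧ ∫ ω, X ω ∂P ≤ C

theorem MeanLE.add (h : MeanLE P X C) (h' : MeanLE P X' C') :
    MeanLE P (fun ω => X ω + X' ω) (C + C') :=
  ⟨h.1.add h'.1, by rw [integral_add h.1 h'.1]; exact add_le_add h.2 h'.2⟩

theorem MeanLE.const_mul (h : MeanLE P X C) {k : ℝ} (hk : 0 ≤ k) :
    MeanLE P (fun ω => k * X ω) (k * C) :=
  ⟨h.1.const_mul k, by rw [integral_const_mul]; exact mul_le_mul_of_nonneg_left h.2 hk⟩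

theorem MeanLE.sum {ι : Type*} [Fintype ι] {X : ι → Ω → ℝ} (h : ∀ i, MeanLE P (X i) C) :
    MeanLE P (fun ω => ∑ i, X i ω) (Fintype.card ι * C) :=
  ⟨integrable_finsetSum _ fun i _ => (h i).1, by
    rw [integral_finsetSum _ fun i _ => (h i).1, ← nsmul_eq_mul]
    exact Finset.sum_le_card_nsmul _ _ _ fun i _ => (h i).2⟩

theorem MeanLE.mono (h : MeanLE P X C) (hC : C ≤ C') : MeanLE P X C' := ⟨h.1, h.2.trans hC⟩

end MeanLE

/-! ### Means and deviations of the Kendall matrix -/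

namespace Panel
variable {m K₀ : ℕ} (D : Panel.{u} m K₀)

/-- The mean of `avgRatio`. -/
def meanRatio (p q : D.Space) : ℝ := ∫ ω, D.avgRatio p q ω ∂D.P

/-- The deviation of `avgRatio` from its mean. -/
def devRatio (p q : D.Space) (ω : D.Ω) : ℝ := D.avgRatio p q ω - D.meanRatio p q

/-- The scaled deviations of the parts of the Kendall matrix from their means, and the size of its
factor part. -/
def spectralDev (ω : D.Ω) : ℝ :=
  D.T * ∑ i, ∑ j, D.devRatio (D.yvec D.Lam i) (D.yvec D.Lam j) ω ^ 2 +
  D.N * D.T * ∑ i, ∑ a, D.devRatio (D.evec i) (D.fvec a) ω ^ 2 +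
  D.T * ∑ i, ∑ j, D.devRatio (D.evec i) (D.evec j) ω ^ 2 +
  D.N * ∑ a, ∑ b, |D.avgRatio (D.fvec a) (D.fvec b) ω|

/-- The bound for the mean of `spectralDev`. -/
def spectralConst (m : ℕ) (c₁ c₂ B : ℝ) : ℝ :=
  16 * ratioMoment c₂ * (c₁ + B ^ 2) ^ 2 + 16 * ratioMoment c₂ * c₁ * m +
    16 * ratioMoment c₂ * c₁ ^ 2 + ratioMoment c₂ * m ^ 2

variable {D} {c₁ c₂ B : ℝ}

theorem integral_sum_dev_le [Nontrivial D.Space] (hb : D.ScaleBounds c₁ c₂ B)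
    (hS : SphericalSample D.sph D.P) (hT : 2 ≤ D.T) (hN : 9 ≤ D.N) {ι κ : Type*} [Fintype ι]
    [Fintype κ] {p : ι → D.Space} {q : κ → D.Space} {u v : ℝ} (hu : 0 ≤ u)
    (hp : ∀ i, ‖p i‖ ^ 2 ≤ u) (hq : ∀ j, ‖q j‖ ^ 2 ≤ v) :
    MeanLE D.P (fun ω => ∑ i, ∑ j, D.devRatio (p i) (q j) ω ^ 2)
      (Fintype.card ι * (Fintype.card κ * (16 / D.T * (ratioMoment c₂ * (u * v) / D.N ^ 2)))) := by
  have hr := (ratioMoment_pos hb.pos₂).le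
  refine MeanLE.sum fun i => MeanLE.sum fun j => MeanLE.mono
    (hS.integral_sq_pairRatio_sub_le hT hN hb.pos₂ (hb.frameBound D.Lam) (p i) (q j)) ?_
  have := mul_le_mul (hp i) (hq j) (sq_nonneg _) hu
  gcongr

theorem integral_spectralDev_le [Nontrivial D.Space] (hb : D.ScaleBounds c₁ c₂ B)
    (hS : SphericalSample D.sph D.P) (hT : 2 ≤ D.T) (hN : 9 ≤ D.N) :
    MeanLE D.P D.spectralDev (spectralConst m c₁ c₂ B) := by
  have hT0 : (0 : ℝ) < D.T := by exact_mod_cast (show 0 < D.T by omega)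
  have hN0 : (0 : ℝ) < D.N := by exact_mod_cast (show 0 < D.N by omega)
  have h1 := integral_sum_dev_le hb hS hT hN (add_nonneg hb.pos₁.le (sq_nonneg B))
    hb.norm_yvec_sq_le hb.norm_yvec_sq_le
  have h2 := integral_sum_dev_le hb hS hT hN hb.pos₁.le hb.norm_evec_sq_le
    (q := D.fvec) (v := 1) (fun a => by rw [norm_fvec]; norm_num)
  have h3 := integral_sum_dev_le hb hS hT hN hb.pos₁.le hb.norm_evec_sq_le hb.norm_evec_sq_le
  have h4 : MeanLE D.P (fun ω => ∑ a, ∑ b, |D.avgRatio (D.fvec a) (D.fvec b) ω|) _ :=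
    MeanLE.sum fun a => MeanLE.sum fun b => ⟨(hS.integrable_pairRatio hN hb.pos₂
      (hb.frameBound D.Lam) (D.fvec a) (D.fvec b)).abs, (hS.integral_abs_pairRatio_le hT hN hb.pos₂
        (hb.frameBound D.Lam) (D.fvec a) (D.fvec b)).trans_eq (by rw [norm_fvec, norm_fvec])⟩
  refine MeanLE.mono ((((h1.const_mul hT0.le).add
    (h2.const_mul (mul_nonneg hN0.le hT0.le))).add (h3.const_mul hT0.le)).add
      (h4.const_mul hN0.le)) (le_of_eq ?_)
  simp only [Fintype.card_fin, spectralConst]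
  field_simp

/-- Negating the factors fixes the error and flips the factor. The resulting bound with four forms
is of order `√N / N²`, a factor `√N` better than the direct bound of order `1/N`. -/
theorem abs_meanRatio_evec_fvec_le [Nontrivial D.Space] (hb : D.ScaleBounds c₁ c₂ B)
    (hS : SphericalSample D.sph D.P) (hT : 2 ≤ D.T) (hN : 9 ≤ D.N) (i : Fin D.N) (a : Fin m) :
    |D.meanRatio (D.evec i) (D.fvec a)| ≤
      2 * m * ratioMoment c₂ * c₁ * B / (D.N * Real.sqrt D.N) := by
  have hN0 : (0 : ℝ) < D.N := by exact_mod_cast (show 0 < D.N by omega)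
  have hr := (ratioMoment_pos hb.pos₂).le
  have hB := hb.B_nonneg
  have he : ‖D.evec i‖ ≤ Real.sqrt c₁ := Real.le_sqrt_of_sq_le (hb.norm_evec_sq_le i)
  refine (hS.abs_integral_pairRatio_reflect hT hN hb.pos₂ (hb.frameBound D.Lam)
    (hb.frameBound (-D.Lam)) D.factorNeg (D.inner_evec_factorNeg i) (D.inner_fvec_factorNeg a)
    (D.quadForm_factorNeg D.Lam) D.fvec (fun a => ∑ i, D.Lam i a • D.evec i)
    (D.abs_quadForm_neg_sub_le D.Lam)).trans ?_
  have h1 : ∀ b ∈ Finset.univ, ratioMoment c₂ * (‖D.evec i‖ * ‖D.fvec a‖ * ‖D.fvec b‖ *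
      ‖∑ i, D.Lam i b • D.evec i‖) / (D.N : ℝ) ^ 2 ≤
      ratioMoment c₂ * c₁ * B / (D.N * Real.sqrt D.N) := by
    intro b _
    rw [norm_fvec, norm_fvec, mul_one, mul_one]
    calc _ ≤ ratioMoment c₂ * (Real.sqrt c₁ * (Real.sqrt c₁ * B * Real.sqrt D.N)) /
        (D.N : ℝ) ^ 2 := by
          gcongr
          exact hb.norm_loading_sum_le b
      _ = _ := by
        have h2 := Real.mul_self_sqrt hb.pos₁.le
        have h3 := Real.mul_self_sqrt hN0.le
        have h4 := Real.sqrt_pos.2 hN0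
        rw [div_eq_div_iff (by positivity) (by positivity)]
        calc _ = ratioMoment c₂ * (Real.sqrt c₁ * Real.sqrt c₁) * B * D.N *
              (Real.sqrt D.N * Real.sqrt D.N) := by ring
          _ = _ := by rw [h2, h3]; ring
  refine (mul_le_mul_of_nonneg_left (Finset.sum_le_card_nsmul _ _ _ h1) (by norm_num)).trans
    (le_of_eq ?_)
  simp only [Finset.card_univ, Fintype.card_fin, nsmul_eq_mul]
  ring

theorem meanRatio_sum_right [Nontrivial D.Space] (hb : D.ScaleBounds c₁ c₂ B)
    (hS : SphericalSample D.sph D.P) (hN : 9 ≤ D.N) {ι : Type*} (S : Finset ι)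
    (k : ι → ℝ) (p : D.Space) (q : ι → D.Space) :
    D.meanRatio p (∑ j ∈ S, k j • q j) = ∑ j ∈ S, k j * D.meanRatio p (q j) := by
  have e : ∀ ω, D.avgRatio p (∑ j ∈ S, k j • q j) ω = ∑ j ∈ S, k j * D.avgRatio p (q j) ω := by
    intro ω
    rw [avgRatio_comm, avgRatio, pairRatio_sum_left]
    simp only [fun j => D.avgRatio_comm p (q j) ω]
    rfl
  simp only [meanRatio, e]
  rw [integral_finsetSum _ fun j _ => ?_]
  · simp only [integral_const_mul]
  · exact (hS.integrable_pairRatio hN hb.pos₂ (hb.frameBound D.Lam) p (q j)).const_mul (k j)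

theorem meanRatio_comm (p q : D.Space) : D.meanRatio p q = D.meanRatio q p := by
  simp only [meanRatio, D.avgRatio_comm p q]

/-- By linearity the sum is a single mean ratio with the vector `∑ y_j e_j`, whose norm is
controlled by the largest eigenvalue of the error scatter. Summing bounds of single entries would
lose a factor `√N`. -/
theorem abs_sum_meanRatio_evec_le [Nontrivial D.Space] (hb : D.ScaleBounds c₁ c₂ B)
    (hS : SphericalSample D.sph D.P) (hT : 2 ≤ D.T) (hN : 9 ≤ D.N) (i : Fin D.N)
    (y : Fin D.N → ℝ) :
    |∑ j, D.meanRatio (D.evec i) (D.evec j) * y j| ≤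
      ratioMoment c₂ * c₁ / D.N * Real.sqrt (∑ j, y j ^ 2) := by
  have hr := (ratioMoment_pos hb.pos₂).le
  have e : ∑ j, D.meanRatio (D.evec i) (D.evec j) * y j =
      D.meanRatio (D.evec i) (∑ j, y j • D.evec j) := by
    rw [meanRatio_sum_right hb hS hN]
    exact Finset.sum_congr rfl fun _ _ => mul_comm _ _
  rw [e]
  refine (hS.abs_integral_pairRatio_le hT hN hb.pos₂ (hb.frameBound D.Lam) _ _).trans ?_
  have h1 : ‖D.evec i‖ ≤ Real.sqrt c₁ := Real.le_sqrt_of_sq_le (hb.norm_evec_sq_le i)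
  have h2 : ‖∑ j, y j • D.evec j‖ ≤ Real.sqrt c₁ * Real.sqrt (∑ j, y j ^ 2) := by
    rw [← Real.sqrt_mul hb.pos₁.le]
    exact Real.le_sqrt_of_sq_le (hb.upper y)
  calc _ ≤ ratioMoment c₂ * (Real.sqrt c₁ * (Real.sqrt c₁ * Real.sqrt (∑ j, y j ^ 2))) / D.N := by
        gcongr
    _ = ratioMoment c₂ * (Real.sqrt c₁ * Real.sqrt c₁) / D.N * Real.sqrt (∑ j, y j ^ 2) := by ring
    _ = _ := by rw [Real.mul_self_sqrt hb.pos₁.le]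

/-- The mean Kendall matrix is bounded below in the direction of `u` by the signal of `u`. -/
theorem le_sum_meanRatio_yvec [Nontrivial D.Space] (hb : D.ScaleBounds c₁ c₂ B)
    (hS : SphericalSample D.sph D.P) (hT : 2 ≤ D.T) (hN : 9 ≤ D.N) (u : Fin D.N → ℝ) :
    absMoment ^ 2 * (∑ a, (∑ i, u i * D.Lam i a) ^ 2) /
        (2 * (D.N * ((c₁ + B ^ 2) * (moment2 + 1)))) ≤
      ∑ i, ∑ j, u i * u j * D.meanRatio (D.yvec D.Lam i) (D.yvec D.Lam j) := by
  have hN0 : (0 : ℝ) < D.N := by exact_mod_cast (show 0 < D.N by omega)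
  have hm2 := moment2_nonneg
  have hc1 := hb.pos₁
  set S : ℝ := D.N * ((c₁ + B ^ 2) * (moment2 + 1)) with hSdef
  have hS0 : 0 < S := by positivity
  have hbS : (∑ i, ‖D.yvec D.Lam i‖ ^ 2) * moment2 ≤ S := by
    have h1 : ∑ i, ‖D.yvec D.Lam i‖ ^ 2 ≤ D.N * (c₁ + B ^ 2) := by
      refine (Finset.sum_le_card_nsmul _ _ _ fun i _ => hb.norm_yvec_sq_le i).trans (le_of_eq ?_)
      rw [nsmul_eq_mul, Finset.card_univ, Fintype.card_fin]
    calc _ ≤ D.N * (c₁ + B ^ 2) * (moment2 + 1) :=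
          mul_le_mul h1 (by linarith) hm2 (by positivity)
      _ = S := by rw [hSdef]; ring
  have h := hS.le_integral_pairRatio hT hN hb.pos₂ (hb.frameBound D.Lam) u hS0 hbS
  have e : ∫ ω, pairRatio D.sph (D.yvec D.Lam) (∑ i, u i • D.yvec D.Lam i)
      (∑ i, u i • D.yvec D.Lam i) ω ∂D.P =
      ∑ i, ∑ j, u i * u j * D.meanRatio (D.yvec D.Lam i) (D.yvec D.Lam j) := by
    change D.meanRatio _ _ = _
    rw [meanRatio_sum_right hb hS hN]
    refine Finset.sum_congr rfl fun i _ => ?_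
    rw [meanRatio_comm, meanRatio_sum_right hb hS hN, Finset.mul_sum]
    exact Finset.sum_congr rfl fun j _ => by ring
  rw [e] at h
  refine le_trans ?_ h
  rw [mul_pow, norm_sum_yvec, one_div, ← div_eq_inv_mul, div_div, mul_comm S]
  gcongr
  exact le_add_of_nonneg_left (sq_nonneg _)

/-- The lower bound for the Kendall matrix on the column space of the loadings. -/
def signalConst (c₁ B γ : ℝ) : ℝ := absMoment ^ 2 * γ / (2 * ((c₁ + B ^ 2) * (moment2 + 1)))

/-- For `x = Λ a`, Cauchy-Schwarz applied to `‖x‖² = ⟨a, Λᵀ x⟩` gives `‖x‖⁴ ≤ ‖a‖² ‖Λᵀ x‖²`, and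
`‖a‖²` is at most `‖x‖² / k`. -/
theorem sum_sq_transpose_mulVec_ge {N : ℕ} {Λ : Matrix (Fin N) (Fin m) ℝ} {k : ℝ} (hk : 0 < k)
    (hΛ : ∀ a : Fin m → ℝ, k * ∑ b, a b ^ 2 ≤ ∑ i, Λ.mulVec a i ^ 2) (a : Fin m → ℝ) :
    k * ∑ i, Λ.mulVec a i ^ 2 ≤ ∑ b, (∑ i, Λ.mulVec a i * Λ i b) ^ 2 := by
  set x := Λ.mulVec a with hx
  have h1 : ∑ i, x i ^ 2 = ∑ b, a b * ∑ i, x i * Λ i b := by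
    have : ∀ i, x i ^ 2 = ∑ b, a b * (x i * Λ i b) := by
      intro i
      have : x i = ∑ b, Λ i b * a b := rfl
      rw [sq]
      nth_rewrite 2 [this]
      rw [Finset.mul_sum]
      exact Finset.sum_congr rfl fun b _ => by ring
    simp only [this, Finset.mul_sum]
    exact Finset.sum_comm
  have h2 := Finset.sum_mul_sq_le_sq_mul_sq Finset.univ a fun b => ∑ i, x i * Λ i b
  rw [← h1] at h2
  have h3 := hΛ a
  have hX : 0 ≤ ∑ i, x i ^ 2 := Finset.sum_nonneg fun _ _ => sq_nonneg _
  have hW : 0 ≤ ∑ b, (∑ i, x i * Λ i b) ^ 2 := Finset.sum_nonneg fun _ _ => sq_nonneg _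
  rcases hX.eq_or_lt with h0 | h0
  · rw [← h0, mul_zero]; exact hW
  · refine le_of_mul_le_mul_right ?_ h0
    nlinarith [mul_le_mul_of_nonneg_right h3 hW]

theorem abs_sum_mul_mul_le {N : ℕ} (x : Fin N → ℝ) (d : Fin N → Fin N → ℝ) {κ : ℝ} (hκ : 0 ≤ κ)
    (hd : ∑ i, ∑ j, d i j ^ 2 ≤ κ ^ 2) : |∑ i, ∑ j, x i * x j * d i j| ≤ κ * ∑ i, x i ^ 2 := by
  have h1 := Finset.sum_mul_sq_le_sq_mul_sq Finset.univ
    (fun p : Fin N × Fin N => x p.1 * x p.2) fun p => d p.1 p.2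
  simp only [Fintype.sum_prod_type] at h1
  have h2 : ∑ i, ∑ j, (x i * x j) ^ 2 = (∑ i, x i ^ 2) ^ 2 := by
    rw [sq (∑ i, x i ^ 2), Finset.sum_mul_sum]; simp only [mul_pow]
  have hX : 0 ≤ ∑ i, x i ^ 2 := Finset.sum_nonneg fun _ _ => sq_nonneg _
  refine abs_le_of_sq_le_sq (h1.trans ?_) (by positivity)
  rw [h2, mul_pow, mul_comm]
  gcongr

/-- On the range of the loadings the mean matrix has at least the signal constant. The condition on
`spectralDev` lets the deviation, measured in Frobenius norm, use up at most half. -/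
theorem le_kendall_mulVec [Nontrivial D.Space] (hb : D.ScaleBounds c₁ c₂ B)
    (hS : SphericalSample D.sph D.P) (hT : 2 ≤ D.T) (hN : 9 ≤ D.N) {γ : ℝ} (hγ : 0 < γ)
    (hΛ : ∀ a : Fin m → ℝ, γ * D.N * ∑ b, a b ^ 2 ≤ ∑ i, D.Lam.mulVec a i ^ 2) {ω : D.Ω}
    (hdev : D.spectralDev ω ≤ D.T * (signalConst c₁ B γ / 2) ^ 2) (a : Fin m → ℝ) :
    signalConst c₁ B γ / 2 * (D.Lam.mulVec a ⬝ᵥ D.Lam.mulVec a) ≤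
      D.Lam.mulVec a ⬝ᵥ (kendall (D.Y ω)).mulVec (D.Lam.mulVec a) := by
  have hT0 : (0 : ℝ) < D.T := by exact_mod_cast (show 0 < D.T by omega)
  have hN0 : (0 : ℝ) < D.N := by exact_mod_cast (show 0 < D.N by omega)
  have hm2 := moment2_nonneg
  have hc1 := hb.pos₁
  have hab := absMoment_pos
  have hκ : 0 < signalConst c₁ B γ := by unfold signalConst; positivity
  set κ := signalConst c₁ B γ with hκd
  set x := D.Lam.mulVec a with hx
  have hxx : x ⬝ᵥ x = ∑ i, x i ^ 2 := by simp [dotProduct, sq]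
  have h1 : κ * ∑ i, x i ^ 2 ≤
      ∑ i, ∑ j, x i * x j * D.meanRatio (D.yvec D.Lam i) (D.yvec D.Lam j) := by
    refine le_trans ?_ (le_sum_meanRatio_yvec hb hS hT hN x)
    have h2 := sum_sq_transpose_mulVec_ge (by positivity) hΛ a
    rw [le_div_iff₀ (by positivity)]
    calc _ = absMoment ^ 2 * (γ * D.N * ∑ i, x i ^ 2) := by
          rw [hκd, signalConst]; field_simp
      _ ≤ _ := by gcongr
  have h3 : ∑ i, ∑ j, D.devRatio (D.yvec D.Lam i) (D.yvec D.Lam j) ω ^ 2 ≤ (κ / 2) ^ 2 := by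
    refine le_of_mul_le_mul_left (le_trans ?_ hdev) hT0
    unfold spectralDev
    have t2 : 0 ≤ D.N * D.T * ∑ i, ∑ a, D.devRatio (D.evec i) (D.fvec a) ω ^ 2 := by positivity
    have t3 : 0 ≤ D.T * ∑ i, ∑ j, D.devRatio (D.evec i) (D.evec j) ω ^ 2 := by positivity
    have t4 : 0 ≤ D.N * ∑ a, ∑ b, |D.avgRatio (D.fvec a) (D.fvec b) ω| := by positivity
    linarith
  have h4 := abs_sum_mul_mul_le x _ (by positivity) h3
  have h5 : x ⬝ᵥ (kendall (D.Y ω)).mulVec x =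
      ∑ i, ∑ j, x i * x j * D.meanRatio (D.yvec D.Lam i) (D.yvec D.Lam j) +
      ∑ i, ∑ j, x i * x j * D.devRatio (D.yvec D.Lam i) (D.yvec D.Lam j) ω := by
    simp only [dotProduct, Matrix.mulVec, kendall_apply, devRatio, Finset.mul_sum,
      ← Finset.sum_add_distrib]
    exact Finset.sum_congr rfl fun i _ => Finset.sum_congr rfl fun j _ => by ring
  rw [h5, hxx]
  have := neg_abs_le (∑ i, ∑ j, x i * x j * D.devRatio (D.yvec D.Lam i) (D.yvec D.Lam j) ω)
  linarith

end Panel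

end GroupedFactor

namespace GroupedFactor

open scoped RealInnerProductSpace ENNReal Matrix.Norms.Frobenius

/-! ### Eigenvector bounds on a good realization, and sizes of the errors -/

namespace Panel
variable {m K₀ : ℕ} {D : Panel.{u} m K₀} {c₁ c₂ B : ℝ}

/-- The constant of the eigenvector bounds when `spectralDev` is at most `Q`. -/
def eigenConst (m : ℕ) (c₁ c₂ B Q : ℝ) : ℝ :=
  Q + B + 2 * m * ratioMoment c₂ * c₁ * B + ratioMoment c₂ * c₁ + m

theorem ScaleBounds.norm_Lam_le (hb : D.ScaleBounds c₁ c₂ B) : ‖D.Lam‖ ≤ B * √D.N := by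
  have hB := hb.B_nonneg
  refine abs_le_of_sq_le_sq' ?_ (by positivity) |>.2
  rw [frob_sq, mul_pow, Real.sq_sqrt (Nat.cast_nonneg _), mul_comm]
  refine (Finset.sum_le_card_nsmul _ _ _ fun i _ => hb.loading i).trans (le_of_eq ?_)
  rw [nsmul_eq_mul, Finset.card_univ, Fintype.card_fin]

theorem eigenBounds [Nontrivial D.Space] (hb : D.ScaleBounds c₁ c₂ B)
    (hS : SphericalSample D.sph D.P) (hT : 2 ≤ D.T) (hN : 9 ≤ D.N) {Q : ℝ} (hQ : 1 ≤ Q) {ω : D.Ω}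
    (hdev : D.spectralDev ω ≤ Q) :
    EigenBounds (kendall (D.Y ω)) D.Lam (D.M1 ω)
      (Matrix.of fun i a => D.devRatio (D.evec i) (D.fvec a) ω)
      (Matrix.of fun i a => D.meanRatio (D.evec i) (D.fvec a))
      (Matrix.of fun i j => D.devRatio (D.evec i) (D.evec j) ω)
      (Matrix.of fun i j => D.meanRatio (D.evec i) (D.evec j)) D.T (eigenConst m c₁ c₂ B Q) := by
  have hT0 : (0 : ℝ) < D.T := by exact_mod_cast (show 0 < D.T by omega)
  have hN0 : (0 : ℝ) < D.N := by exact_mod_cast (show 0 < D.N by omega)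
  have hr := (ratioMoment_pos hb.pos₂).le
  have hB := hb.B_nonneg
  have hc := hb.pos₁
  have q2 : 0 ≤ 2 * m * ratioMoment c₂ * c₁ * B := by positivity
  have q3 : 0 ≤ ratioMoment c₂ * c₁ := by positivity
  have q4 : (0 : ℝ) ≤ m := by positivity
  -- The deviations enter `spectralDev` squared and the factor part linearly; as `Q ≥ 1`, the same
  -- `Q` serves for both.
  have hsQ : √Q ≤ Q := by rw [Real.sqrt_le_left (by linarith)]; nlinarith
  have t1 : 0 ≤ D.T * ∑ i, ∑ j, D.devRatio (D.yvec D.Lam i) (D.yvec D.Lam j) ω ^ 2 := by positivity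
  have t2 : 0 ≤ D.N * D.T * ∑ i, ∑ a, D.devRatio (D.evec i) (D.fvec a) ω ^ 2 := by positivity
  have t3 : 0 ≤ D.T * ∑ i, ∑ j, D.devRatio (D.evec i) (D.evec j) ω ^ 2 := by positivity
  have t4 : 0 ≤ D.N * ∑ a, ∑ b, |D.avgRatio (D.fvec a) (D.fvec b) ω| := by positivity
  unfold spectralDev at hdev
  constructor
  · unfold eigenConst; positivity
  · omega
  · omega
  · have e2 : (Matrix.of fun i a => D.devRatio (D.evec i) (D.fvec a) ω) +
        (Matrix.of fun i a => D.meanRatio (D.evec i) (D.fvec a)) = D.M2 ω := by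
      ext i a; simp [M2, devRatio]
    have e3 : (Matrix.of fun i j => D.devRatio (D.evec i) (D.evec j) ω) +
        (Matrix.of fun i j => D.meanRatio (D.evec i) (D.evec j)) = D.M3 ω := by
      ext i a; simp [M3, devRatio]
    rw [e2, e3]
    exact D.kendall_decomp ω
  · intro i a
    refine (hb.abs_Lam_le i a).trans ?_
    unfold eigenConst; linarith
  · refine hb.norm_Lam_le.trans ?_
    gcongr
    unfold eigenConst; linarith
  · intro a b
    rw [M1_apply, le_div_iff₀ hN0, mul_comm]
    have h1 : |D.avgRatio (D.fvec a) (D.fvec b) ω| ≤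
        ∑ a, ∑ b, |D.avgRatio (D.fvec a) (D.fvec b) ω| :=
      (Finset.single_le_sum (f := fun b => |D.avgRatio (D.fvec a) (D.fvec b) ω|)
        (fun _ _ => abs_nonneg _) (Finset.mem_univ b)).trans
      (Finset.single_le_sum (f := fun a => ∑ b, |D.avgRatio (D.fvec a) (D.fvec b) ω|)
        (fun _ _ => Finset.sum_nonneg fun _ _ => abs_nonneg _) (Finset.mem_univ a))
    have h2 := mul_le_mul_of_nonneg_left h1 hN0.le
    unfold eigenConst; linarith
  · rw [le_div_iff₀ (by positivity)]
    refine le_trans ?_ (show √Q ≤ _ by unfold eigenConst; linarith)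
    refine Real.le_sqrt_of_sq_le ?_
    rw [mul_pow, mul_pow, frob_sq, Real.sq_sqrt hN0.le, Real.sq_sqrt hT0.le, mul_comm]
    simp only [Matrix.of_apply]
    linarith
  · rw [le_div_iff₀ (by positivity)]
    refine le_trans ?_ (show √Q ≤ _ by unfold eigenConst; linarith)
    refine Real.le_sqrt_of_sq_le ?_
    rw [mul_pow, frob_sq, Real.sq_sqrt hT0.le, mul_comm]
    simp only [Matrix.of_apply]
    linarith
  · intro i a
    refine (abs_meanRatio_evec_fvec_le hb hS hT hN i a).trans ?_
    gcongr
    unfold eigenConst; linarith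
  · intro i y
    refine (abs_sum_meanRatio_evec_le hb hS hT hN i y).trans ?_
    gcongr
    unfold eigenConst; linarith

/-! ### Moments of the factors and the errors -/

variable (D) in
/-- The scaled sizes of the error matrix, of its product with the loadings, and of its product with
the factors. -/
def errorSize (ω : D.Ω) : ℝ :=
  (D.N : ℝ)⁻¹ * ∑ i, ((D.T : ℝ)⁻¹ * ∑ t, D.eps i t ω * D.eps i t ω) +
  (D.N : ℝ)⁻¹ * ∑ a, ∑ i, ∑ j, D.Lam i a * D.Lam j a *
    ((D.T : ℝ)⁻¹ * ∑ t, D.eps i t ω * D.eps j t ω) +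
  D.crossMoment ω

theorem norm_epsMat_sq (hN : 0 < D.N) (hT : 0 < D.T) (ω : D.Ω) : ‖D.epsMat ω‖ ^ 2 =
    D.N * D.T * ((D.N : ℝ)⁻¹ * ∑ i, ((D.T : ℝ)⁻¹ * ∑ t, D.eps i t ω * D.eps i t ω)) := by
  have hT0 : (D.T : ℝ) ≠ 0 := by exact_mod_cast hT.ne'
  have hN0 : (D.N : ℝ) ≠ 0 := by exact_mod_cast hN.ne'
  rw [frob_sq, ← Finset.mul_sum, Finset.sum_comm]
  simp only [epsMat, Matrix.of_apply, ← sq]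
  field_simp

theorem norm_epsMat_mul_Lam_sq (hN : 0 < D.N) (hT : 0 < D.T) (ω : D.Ω) :
    ‖D.epsMat ω * D.Lam‖ ^ 2 = D.N * D.T * ((D.N : ℝ)⁻¹ * ∑ a, ∑ i, ∑ j, D.Lam i a * D.Lam j a *
      ((D.T : ℝ)⁻¹ * ∑ t, D.eps i t ω * D.eps j t ω)) := by
  have hT0 : (D.T : ℝ) ≠ 0 := by exact_mod_cast hT.ne'
  have hN0 : (D.N : ℝ) ≠ 0 := by exact_mod_cast hN.ne'
  have e : ∑ a, ∑ i, ∑ j, D.Lam i a * D.Lam j a * ((D.T : ℝ)⁻¹ * ∑ t, D.eps i t ω * D.eps j t ω) =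
      (D.T : ℝ)⁻¹ * ∑ a, ∑ t, (∑ i, D.eps i t ω * D.Lam i a) ^ 2 := by
    rw [Finset.mul_sum]
    refine Finset.sum_congr rfl fun a _ => ?_
    have h : ∀ t, (∑ i, D.eps i t ω * D.Lam i a) ^ 2 =
        ∑ i, ∑ j, D.eps i t ω * D.Lam i a * (D.eps j t ω * D.Lam j a) := fun t => by
      rw [sq, Finset.sum_mul_sum]
    have h' : ∑ t, (∑ i, D.eps i t ω * D.Lam i a) ^ 2 =
        ∑ i, ∑ j, ∑ t, D.eps i t ω * D.Lam i a * (D.eps j t ω * D.Lam j a) := by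
      simp only [h]
      rw [Finset.sum_comm]
      exact Finset.sum_congr rfl fun i _ => Finset.sum_comm
    rw [h']
    simp only [Finset.mul_sum]
    exact Finset.sum_congr rfl fun i _ => Finset.sum_congr rfl fun j _ =>
      Finset.sum_congr rfl fun t _ => by ring
  rw [frob_sq, e, Finset.sum_comm]
  simp only [epsMat, Matrix.mul_apply, Matrix.of_apply]
  field_simp

theorem norm_facMat_transpose_mul_epsMat_sq (hN : 0 < D.N) (hT : 0 < D.T) (ω : D.Ω) :
    ‖(D.facMat ω).transpose * D.epsMat ω‖ ^ 2 = D.N * D.T * D.crossMoment ω := by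
  have hT0 : (0 : ℝ) < D.T := by exact_mod_cast hT
  have hN0 : (D.N : ℝ) ≠ 0 := by exact_mod_cast hN.ne'
  have e : ∀ i, l2norm ((Real.sqrt D.T)⁻¹ • ∑ t, D.eps i t ω • D.f t ω) ^ 2 =
      (D.T : ℝ)⁻¹ * ∑ a, (∑ t, D.f t ω a * D.eps i t ω) ^ 2 := by
    intro i
    rw [l2norm_sq_eq_sum, Finset.mul_sum]
    refine Finset.sum_congr rfl fun a _ => ?_
    rw [Pi.smul_apply, smul_eq_mul, mul_pow, inv_pow, Real.sq_sqrt hT0.le, Finset.sum_apply]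
    congr 2
    exact Finset.sum_congr rfl fun t _ => by simp [mul_comm]
  rw [frob_sq, crossMoment, Finset.sum_comm]
  simp only [e, facMat, epsMat, Matrix.mul_apply, Matrix.of_apply, Matrix.transpose_apply]
  rw [← Finset.mul_sum]
  field_simp

/-- The double sum with the loadings has `N²` terms but is only of order `N` in mean, by the
summability of the cross-sectional covariances. -/
theorem errorSize_meanLE (hb : D.ScaleBounds c₁ c₂ B) (hN : 0 < D.N) {M M' : ℝ}
    (hi : ∀ i j, Integrable (fun ω => (D.T : ℝ)⁻¹ * ∑ t, D.eps i t ω * D.eps j t ω) D.P)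
    {σ : Fin D.N → Fin D.N → ℝ}
    (hσ : ∀ i j, ∫ ω, (D.T : ℝ)⁻¹ * ∑ t, D.eps i t ω * D.eps j t ω ∂D.P = σ i j)
    (hd : ∀ i, |σ i i| ≤ M) (hs : (D.N : ℝ)⁻¹ * ∑ i, ∑ j, |σ i j| ≤ M)
    (hc : MeanLE D.P D.crossMoment M') :
    MeanLE D.P D.errorSize (M + m * B ^ 2 * M + M') := by
  have hN0 : (0 : ℝ) < D.N := by exact_mod_cast hN
  refine MeanLE.add (MeanLE.add ?_ ?_) hc
  · refine MeanLE.mono ((MeanLE.sum fun i => (⟨hi i i, (hσ i i).le.trans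
      ((le_abs_self _).trans (hd i))⟩ : MeanLE D.P _ M)).const_mul (inv_nonneg.2 hN0.le))
      (le_of_eq ?_)
    rw [Fintype.card_fin]; field_simp
  · have hii : ∀ a : Fin m, ∀ i j, Integrable (fun ω => D.Lam i a * D.Lam j a *
        ((D.T : ℝ)⁻¹ * ∑ t, D.eps i t ω * D.eps j t ω)) D.P := fun a i j => (hi i j).const_mul _
    have h1 : ∀ a : Fin m, MeanLE D.P (fun ω => ∑ i, ∑ j, D.Lam i a * D.Lam j a *
        ((D.T : ℝ)⁻¹ * ∑ t, D.eps i t ω * D.eps j t ω)) (B ^ 2 * (D.N * M)) := by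
      intro a
      refine ⟨integrable_finsetSum _ fun i _ => integrable_finsetSum _ fun j _ => hii a i j, ?_⟩
      rw [integral_finsetSum _ fun i _ => integrable_finsetSum _ fun j _ => hii a i j]
      simp only [fun i => integral_finsetSum Finset.univ fun j _ => hii a i j, integral_const_mul,
        hσ]
      have h2 : ∑ i, ∑ j, |σ i j| ≤ D.N * M := by
        rwa [inv_mul_le_iff₀ hN0] at hs
      refine le_trans ?_ (mul_le_mul_of_nonneg_left h2 (sq_nonneg B))
      simp only [Finset.mul_sum]
      refine Finset.sum_le_sum fun i _ => Finset.sum_le_sum fun j _ => ?_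
      refine (le_abs_self _).trans ?_
      rw [abs_mul, abs_mul, sq]
      have := hb.B_nonneg
      gcongr
      · exact hb.abs_Lam_le i a
      · exact hb.abs_Lam_le j a
    refine MeanLE.mono ((MeanLE.sum h1).const_mul (inv_nonneg.2 hN0.le)) (le_of_eq ?_)
    rw [Fintype.card_fin]; field_simp

end Panel

end GroupedFactor

namespace GroupedFactor

open scoped RealInnerProductSpace ENNReal Matrix.Norms.Frobenius

/-! ### A lower bound for the errors in terms of the factors -/

namespace Panel
variable {m K₀ : ℕ} {D : Panel.{u} m K₀} {c₁ c₂ B : ℝ}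

theorem frameBound_mono {E : Type*} [NormedAddCommGroup E] [InnerProductSpace ℝ E] {N : ℕ}
    {c c' : ℝ} {b : Fin N → E} (hb : FrameBound c b) (h : c' ≤ c) : FrameBound c' b := fun u =>
  (mul_le_mul_of_nonneg_right h (Finset.sum_nonneg fun _ _ => sq_nonneg _)).trans (hb u)

theorem yvec_zero : D.yvec 0 = D.evec := by
  ext1 i; simp [yvec]

theorem ScaleBounds.frameBound_evec (hb : D.ScaleBounds c₁ c₂ B) : FrameBound c₂ D.evec :=
  yvec_zero (D := D) ▸ hb.frameBound 0

theorem frameBound_gvec : FrameBound 1 D.gvec := fun u => by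
  rw [EuclideanSpace.real_norm_sq_eq, Fintype.sum_sum_type]
  simp [gvec, Pi.single_apply, WithLp.ofLp_sum]

theorem quadForm_gvec_le (x : D.Space) : quadForm D.gvec x ≤ ‖x‖ ^ 2 := by
  rw [EuclideanSpace.real_norm_sq_eq, Fintype.sum_sum_type, quadForm]
  simp only [inner_gvec]
  exact le_add_of_nonneg_left (Finset.sum_nonneg fun _ _ => sq_nonneg _)

/-- The ratio of the fourth power of the factor part to the square of the error part. -/
def factorRatio (D : Panel.{u} m K₀) (x : D.Space) : ℝ :=
  D.N * (∑ a, ⟪D.fvec a, x⟫ ^ 2) ^ 2 * (quadForm D.evec x)⁻¹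

theorem measurable_factorRatio : Measurable D.factorRatio := by
  have := measurable_quadForm D.evec
  unfold factorRatio; fun_prop

theorem factorRatio_nonneg (x : D.Space) : 0 ≤ D.factorRatio x :=
  mul_nonneg (by positivity) (inv_nonneg.2 (quadForm_nonneg _ _))

theorem factorRatio_smul (c : ℝ) (x : D.Space) : D.factorRatio (c • x) = c ^ 2 * D.factorRatio x := by
  simp only [factorRatio, quadForm_smul, real_inner_smul_right, mul_pow, ← Finset.mul_sum, mul_inv]
  rcases eq_or_ne c 0 with rfl | hc
  · simp
  · field_simp

/-- Replacing `‖x‖ ^ 2` by the smaller form of the error sources turns the integrand into four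
linear forms over two quadratic forms in `N` vectors, so `integral_four_ratio` applies. -/
theorem integral_factorRatio (hb : D.ScaleBounds c₁ c₂ B) (hN : 9 ≤ D.N) :
    ∫⁻ x, ENNReal.ofReal (D.factorRatio x / ‖x‖ ^ 2) ∂stdGaussian D.Space ≤
      ENNReal.ofReal (m ^ 2 * ratioMoment (min c₂ 1) / D.N) := by
  have hN0 : (0 : ℝ) < D.N := by exact_mod_cast (show 0 < D.N by omega)
  -- A common frame constant: `c₂` for the errors, 1 for their Gaussian sources.
  have hc : 0 < min c₂ 1 := lt_min hb.pos₂ one_pos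
  have he := frameBound_mono hb.frameBound_evec (min_le_left c₂ 1)
  have hg := frameBound_mono (frameBound_gvec (D := D)) (min_le_right c₂ 1)
  have h4 := fun a b => integral_four_ratio hN hc he hg (D.fvec a) (D.fvec a) (D.fvec b) (D.fvec b)
  have hM : MeanLE (stdGaussian D.Space) (fun x => D.N * ∑ a, ∑ b,
      |⟪D.fvec a, x⟫ * ⟪D.fvec a, x⟫ * ⟪D.fvec b, x⟫ * ⟪D.fvec b, x⟫| *
        ((quadForm D.evec x)⁻¹ * (quadForm D.gvec x)⁻¹)) _ :=
    (MeanLE.sum fun a => MeanLE.sum fun b => (⟨(h4 a b).1, (h4 a b).2.trans_eq (by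
      simp only [norm_fvec])⟩ : MeanLE _ _ (ratioMoment (min c₂ 1) * (1 * 1 * 1 * 1) / D.N ^ 2))
      ).const_mul hN0.le
  calc _ ≤ ∫⁻ x, ENNReal.ofReal (D.N * ∑ a, ∑ b,
      |⟪D.fvec a, x⟫ * ⟪D.fvec a, x⟫ * ⟪D.fvec b, x⟫ * ⟪D.fvec b, x⟫| *
        ((quadForm D.evec x)⁻¹ * (quadForm D.gvec x)⁻¹)) ∂stdGaussian D.Space := by
        refine lintegral_mono_ae ?_
        filter_upwards [hg.quadForm_pos_ae (by omega) hc] with x hx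
        refine ENNReal.ofReal_le_ofReal ?_
        have e : ∀ a b, |⟪D.fvec a, x⟫ * ⟪D.fvec a, x⟫ * ⟪D.fvec b, x⟫ * ⟪D.fvec b, x⟫| =
            ⟪D.fvec a, x⟫ ^ 2 * ⟪D.fvec b, x⟫ ^ 2 := by
          intro a b
          rw [abs_of_nonneg]
          · ring
          · nlinarith [mul_nonneg (mul_self_nonneg ⟪D.fvec a, x⟫) (mul_self_nonneg ⟪D.fvec b, x⟫)]
        simp only [e, ← Finset.sum_mul, ← Finset.sum_mul_sum]
        rw [factorRatio, div_eq_mul_inv]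
        have h1 : (‖x‖ ^ 2)⁻¹ ≤ (quadForm D.gvec x)⁻¹ := inv_anti₀ hx (quadForm_gvec_le x)
        have h2 := inv_nonneg.2 (quadForm_nonneg D.evec x)
        calc _ ≤ D.N * (∑ a, ⟪D.fvec a, x⟫ ^ 2) ^ 2 * (quadForm D.evec x)⁻¹ *
              (quadForm D.gvec x)⁻¹ := by gcongr
          _ = _ := by ring
    _ = ENNReal.ofReal (∫ x, D.N * ∑ a, ∑ b,
      |⟪D.fvec a, x⟫ * ⟪D.fvec a, x⟫ * ⟪D.fvec b, x⟫ * ⟪D.fvec b, x⟫| *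
        ((quadForm D.evec x)⁻¹ * (quadForm D.gvec x)⁻¹) ∂stdGaussian D.Space) := by
        refine (ofReal_integral_eq_lintegral_ofReal hM.1 (Eventually.of_forall fun x => ?_)).symm
        have h2 := inv_nonneg.2 (quadForm_nonneg D.evec x)
        have h3 := inv_nonneg.2 (quadForm_nonneg D.gvec x)
        exact mul_nonneg hN0.le (Finset.sum_nonneg fun a _ => Finset.sum_nonneg fun b _ =>
          mul_nonneg (abs_nonneg _) (mul_nonneg h2 h3))
    _ ≤ _ := by
      refine ENNReal.ofReal_le_ofReal (hM.2.trans (le_of_eq ?_))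
      rw [Fintype.card_fin]; field_simp

/-- All coordinate vectors, enumerated. -/
def coordVec (D : Panel.{u} m K₀) (k : Fin (m + D.N)) : D.Space :=
  EuclideanSpace.single (finSumFinEquiv.symm k) 1

theorem quadForm_coordVec (x : D.Space) : quadForm D.coordVec x = ‖x‖ ^ 2 := by
  rw [EuclideanSpace.real_norm_sq_eq, quadForm, ← finSumFinEquiv.symm.sum_comp]
  simp [coordVec, EuclideanSpace.inner_single_left]

theorem sum_coordVec (x : D.Space) : ∑ k, x (finSumFinEquiv.symm k) • D.coordVec k = x := by
  rw [← finSumFinEquiv.sum_comp]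
  ext k
  simp [coordVec, WithLp.ofLp_sum, Fintype.sum_sum_type, Pi.single_apply]
  rcases k with k | k <;> simp

/-- The quotient is a sum of ratios over the frame of all `m + N` coordinates. Each has mean at
least a multiple of `1/(m + N)`, and there are `N` of them. -/
theorem le_integral_quadForm_evec (hb : D.ScaleBounds c₁ c₂ B) (hN : 0 < D.N) :
    ENNReal.ofReal (c₂ * absMoment ^ 2 / ((m + 1) * (moment2 + 1))) ≤
      ∫⁻ x, ENNReal.ofReal (quadForm D.evec x / ‖x‖ ^ 2) ∂stdGaussian D.Space := by
  have hN0 : (0 : ℝ) < D.N := by exact_mod_cast hN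
  have hN1 : (1 : ℝ) ≤ D.N := by exact_mod_cast hN
  have hm2 := moment2_nonneg
  have hab := absMoment_pos
  have hc2 := hb.pos₂
  set S : ℝ := (m + D.N) * (moment2 + 1) with hS
  have hS0 : 0 < S := by positivity
  have hbS : (∑ k, ‖D.coordVec k‖ ^ 2) * moment2 ≤ S := by
    have : ∑ k, ‖D.coordVec k‖ ^ 2 = m + D.N := by simp [coordVec]
    rw [this, hS]
    gcongr; linarith
  have hle : ∀ (p x : D.Space), ratio D.coordVec p p x ≤ ‖p‖ ^ 2 := by
    intro p x
    rw [ratio, quadForm_coordVec]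
    rcases eq_or_ne x 0 with rfl | hx
    · simp
    · rw [inv_mul_le_iff₀ (by positivity), ← sq, ← mul_pow, ← sq_abs]
      have := abs_real_inner_le_norm p x
      exact pow_le_pow_left₀ (abs_nonneg _) (by linarith [mul_comm ‖p‖ ‖x‖]) 2
  have hpos : ∀ (p x : D.Space), 0 ≤ ratio D.coordVec p p x := fun p x =>
    mul_nonneg (inv_nonneg.2 (quadForm_nonneg _ x)) (mul_self_nonneg _)
  have hintg : ∀ p, Integrable (ratio D.coordVec p p) (stdGaussian D.Space) := fun p =>
    Integrable.of_bound (measurable_ratio _ _ _).aestronglyMeasurable (‖p‖ ^ 2)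
      (Eventually.of_forall fun x => by
        rw [Real.norm_of_nonneg (hpos p x)]; exact hle p x)
  have hone : ∀ i, c₂ * absMoment ^ 2 / S ≤
      ∫ x, ratio D.coordVec (D.evec i) (D.evec i) x ∂stdGaussian D.Space := by
    intro i
    have h := le_integral_ratio (b := D.coordVec) (fun k => D.evec i (finSumFinEquiv.symm k)) hS0
      hbS (by rw [sum_coordVec]; exact hintg _)
    rw [sum_coordVec] at h
    refine le_trans ?_ h
    rw [mul_pow, mul_comm c₂]
    gcongr
    exact hb.le_norm_evec_sq i
  have e : ∀ x : D.Space, quadForm D.evec x / ‖x‖ ^ 2 =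
      ∑ i, ratio D.coordVec (D.evec i) (D.evec i) x := by
    intro x
    simp only [ratio, quadForm_coordVec, ← Finset.mul_sum, ← sq]
    rw [div_eq_inv_mul]; rfl
  simp only [e]
  rw [← ofReal_integral_eq_lintegral_ofReal (integrable_finsetSum _ fun i _ => hintg _)
    (Eventually.of_forall fun x => Finset.sum_nonneg fun i _ => hpos _ x)]
  refine ENNReal.ofReal_le_ofReal ?_
  rw [integral_finsetSum _ fun i _ => hintg _]
  have h1 := Finset.card_nsmul_le_sum Finset.univ (fun i =>
    ∫ x, ratio D.coordVec (D.evec i) (D.evec i) x ∂stdGaussian D.Space) _ fun i _ => hone i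
  refine le_trans ?_ h1
  rw [nsmul_eq_mul, Finset.card_univ, Fintype.card_fin, hS, ← mul_div_assoc,
    div_le_div_iff₀ (by positivity) (by positivity)]
  have h3 : (m : ℝ) + D.N ≤ D.N * (m + 1) := by
    have : (m : ℝ) * 1 ≤ m * D.N := by gcongr
    linarith
  calc _ = c₂ * absMoment ^ 2 * (moment2 + 1) * (m + D.N) := by ring
    _ ≤ c₂ * absMoment ^ 2 * (moment2 + 1) * (D.N * (m + 1)) := by gcongr
    _ = _ := by ring

variable (D) in
/-- The time average of `factorRatio`. -/
def factorSize (ω : D.Ω) : ℝ := (D.T : ℝ)⁻¹ * ∑ t, D.factorRatio (D.sph t ω)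

/-- The bound for the mean of `factorSize`. -/
def factorConst (m : ℕ) (c₂ M : ℝ) : ℝ :=
  M / (c₂ * absMoment ^ 2 / ((m + 1) * (moment2 + 1))) * (m ^ 2 * ratioMoment (min c₂ 1))

theorem quadForm_evec_sph (ω : D.Ω) (t : Fin D.T) :
    quadForm D.evec (D.sph t ω) = ∑ i, D.eps i t ω * D.eps i t ω := by
  simp only [quadForm, eps_eq, sq]

/-- The error form and `factorRatio` are both homogeneous of degree two, so their means share the
radial second moment as a factor. The error variances bound it by a multiple of `N`, and the
directional part of `factorRatio` is of order `1/N`. -/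
theorem factorSize_meanLE (hb : D.ScaleBounds c₁ c₂ B) (hN : 9 ≤ D.N) (hT : 0 < D.T)
    {ν : Measure ℝ} [IsProbabilityMeasure ν] (hP : PolarSample (D := D) ν) {M : ℝ} (hM : 0 ≤ M)
    (hi : ∀ i t, Integrable (fun ω => D.eps i t ω * D.eps i t ω) D.P)
    (hd : ∀ i, |∫ ω, (D.T : ℝ)⁻¹ * ∑ t, D.eps i t ω * D.eps i t ω ∂D.P| ≤ M) :
    MeanLE D.P D.factorSize (factorConst m c₂ M) := by
  have hN0 : (0 : ℝ) < D.N := by exact_mod_cast (show 0 < D.N by omega)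
  have hT0 : (0 : ℝ) < D.T := by exact_mod_cast hT
  have hm2 := moment2_nonneg
  have hab := absMoment_pos
  have hc2 := hb.pos₂
  have hR := ratioMoment_pos (lt_min hb.pos₂ one_pos)
  set κ : ℝ := c₂ * absMoment ^ 2 / ((m + 1) * (moment2 + 1)) with hκ
  have hκ0 : 0 < κ := by positivity
  set A := ∫⁻ r, ENNReal.ofReal (r ^ 2) ∂ν with hA
  have hiq : ∀ t, Integrable (fun ω => quadForm D.evec (D.sph t ω)) D.P := fun t => by
    simp only [quadForm_evec_sph]
    exact integrable_finsetSum _ fun i _ => hi i t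
  have hquad : ∀ t, ENNReal.ofReal (∫ ω, quadForm D.evec (D.sph t ω) ∂D.P) =
      A * ∫⁻ x, ENNReal.ofReal (quadForm D.evec x / ‖x‖ ^ 2) ∂stdGaussian D.Space := by
    intro t
    rw [ofReal_integral_eq_lintegral_ofReal (hiq t)
      (Eventually.of_forall fun ω => quadForm_nonneg _ _)]
    exact hP.lintegral_sq_homogeneous (measurable_quadForm _) (quadForm_smul _) t
  have hsum : ∑ t, ∫ ω, quadForm D.evec (D.sph t ω) ∂D.P ≤ D.T * (D.N * M) := by
    have e : ∑ t, ∫ ω, quadForm D.evec (D.sph t ω) ∂D.P =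
        D.T * ∑ i, ∫ ω, (D.T : ℝ)⁻¹ * ∑ t, D.eps i t ω * D.eps i t ω ∂D.P := by
      simp only [quadForm_evec_sph, integral_const_mul, ← Finset.mul_sum]
      rw [mul_inv_cancel_left₀ hT0.ne']
      simp only [fun t => integral_finsetSum Finset.univ fun i _ => hi i t,
        fun i => integral_finsetSum Finset.univ fun t _ => hi i t]
      exact Finset.sum_comm
    rw [e]
    gcongr
    refine (Finset.sum_le_card_nsmul _ _ _ fun i _ => (le_abs_self _).trans (hd i)).trans_eq ?_
    rw [nsmul_eq_mul, Finset.card_univ, Fintype.card_fin]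
  -- One period not above the average suffices, as the radial law is the same in all periods.
  obtain ⟨t₀, ht₀⟩ : ∃ t : Fin D.T, ∫ ω, quadForm D.evec (D.sph t ω) ∂D.P ≤ D.N * M := by
    by_contra! hcon
    have h1 := Finset.sum_lt_sum_of_nonempty (s := Finset.univ) (f := fun _ : Fin D.T => D.N * M)
      ⟨⟨0, hT⟩, Finset.mem_univ _⟩ fun t _ => hcon t
    simp only [Finset.sum_const, Finset.card_univ, Fintype.card_fin, nsmul_eq_mul] at h1
    linarith
  have hAle : A ≤ ENNReal.ofReal (D.N * M / κ) := by
    rw [ENNReal.ofReal_div_of_pos hκ0, ENNReal.le_div_iff_mul_le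
      (Or.inl (ENNReal.ofReal_pos.2 hκ0).ne') (Or.inl ENNReal.ofReal_ne_top)]
    calc _ ≤ A * ∫⁻ x, ENNReal.ofReal (quadForm D.evec x / ‖x‖ ^ 2) ∂stdGaussian D.Space := by
          gcongr
          exact le_integral_quadForm_evec hb (by omega)
      _ ≤ _ := by rw [← hquad t₀]; exact ENNReal.ofReal_le_ofReal ht₀
  have hC0 : 0 ≤ factorConst m c₂ M := by unfold factorConst; positivity
  have hone : ∀ t, ∫⁻ ω, ENNReal.ofReal (D.factorRatio (D.sph t ω)) ∂D.P ≤
      ENNReal.ofReal (factorConst m c₂ M) := by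
    intro t
    rw [hP.lintegral_sq_homogeneous measurable_factorRatio factorRatio_smul t]
    calc _ ≤ ENNReal.ofReal (D.N * M / κ) *
          ENNReal.ofReal (m ^ 2 * ratioMoment (min c₂ 1) / D.N) :=
          mul_le_mul' hAle (integral_factorRatio hb hN)
      _ = _ := by
        rw [← ENNReal.ofReal_mul (by positivity), factorConst, ← hκ]
        congr 1
        field_simp
  have hmean : ∀ t, MeanLE D.P (fun ω => D.factorRatio (D.sph t ω)) (factorConst m c₂ M) := by
    intro t
    have hms : AEStronglyMeasurable (fun ω => D.factorRatio (D.sph t ω)) D.P :=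
      (measurable_factorRatio.comp_aemeasurable (hP.hasLaw_sph t).aemeasurable).aestronglyMeasurable
    have h0 : 0 ≤ᵐ[D.P] fun ω => D.factorRatio (D.sph t ω) :=
      Eventually.of_forall fun ω => factorRatio_nonneg _
    have hintg : Integrable (fun ω => D.factorRatio (D.sph t ω)) D.P :=
      ⟨hms, (hasFiniteIntegral_iff_ofReal h0).2 ((hone t).trans_lt ENNReal.ofReal_lt_top)⟩
    refine ⟨hintg, ?_⟩
    have := hone t
    rwa [← ofReal_integral_eq_lintegral_ofReal hintg h0, ENNReal.ofReal_le_ofReal_iff hC0] at this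
  refine MeanLE.mono ((MeanLE.sum hmean).const_mul (inv_nonneg.2 hT0.le)) (le_of_eq ?_)
  rw [Fintype.card_fin]; field_simp

theorem ae_quadForm_evec_pos (hb : D.ScaleBounds c₁ c₂ B) (hN : 0 < D.N)
    {ν : Measure ℝ} [IsProbabilityMeasure ν] (hP : PolarSample (D := D) ν) :
    ∀ᵐ ω ∂D.P, ∀ t, 0 < quadForm D.evec (D.sph t ω) := by
  rw [ae_all_iff]
  intro t
  have h1 : ∀ᵐ p ∂(ν.prod (stdGaussian D.Space)), 0 < quadForm D.evec p.2 :=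
    Measure.quasiMeasurePreserving_snd.ae (hb.frameBound_evec.quadForm_pos_ae hN hb.pos₂)
  rw [← (hP.hasLaw t).map_eq] at h1
  filter_upwards [ae_of_ae_map (hP.hasLaw t).aemeasurable h1, hP.pos t] with ω h2 h3
  have hne : (WithLp.toLp 2 (D.g t ω) : D.Space) ≠ 0 := by
    intro h
    rw [h, quadForm_zero] at h2
    exact lt_irrefl _ h2
  rw [sph, quadForm_smul]
  have h4 : 0 < D.ξ t ω / l2norm (D.g t ω) := div_pos h3 (norm_pos_iff.2 hne)
  positivity

/-- The factors bound the errors from below. -/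
theorem norm_facMat_pow_four_le {ω : D.Ω} (hN : 0 < D.N) (hT : 0 < D.T)
    (h : ∀ t, 0 < quadForm D.evec (D.sph t ω)) :
    (‖D.facMat ω‖ ^ 2) ^ 2 * D.N ≤ D.T * D.factorSize ω * ‖D.epsMat ω‖ ^ 2 := by
  have hN0 : (0 : ℝ) < D.N := by exact_mod_cast hN
  have hT0 : (0 : ℝ) < D.T := by exact_mod_cast hT
  have hE : ‖D.epsMat ω‖ ^ 2 = ∑ t, quadForm D.evec (D.sph t ω) := by
    rw [frob_sq]
    simp only [quadForm_evec_sph, epsMat, Matrix.of_apply, sq]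
  have hF : ‖D.facMat ω‖ ^ 2 = ∑ t, ∑ a, ⟪D.fvec a, D.sph t ω⟫ ^ 2 := by
    rw [frob_sq]
    simp only [facMat, Matrix.of_apply, f_eq]
  -- Cauchy-Schwarz over time. The squared factor part of a period is `factorRatio` times the error
  -- form over `N`, which needs that form to be nonzero.
  have h1 := Finset.sum_sq_le_sum_mul_sum_of_sq_le_mul Finset.univ
    (r := fun t => ∑ a, ⟪D.fvec a, D.sph t ω⟫ ^ 2) (f := fun t => D.factorRatio (D.sph t ω))
    (g := fun t => quadForm D.evec (D.sph t ω) / D.N) (fun t _ => factorRatio_nonneg _)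
    (fun t _ => div_nonneg (quadForm_nonneg _ _) hN0.le) (fun t _ => by
      have := (h t).ne'
      exact le_of_eq (by rw [factorRatio]; field_simp))
  rw [← Finset.sum_div, ← hE, ← hF] at h1
  rw [factorSize, mul_inv_cancel_left₀ hT0.ne']
  calc _ ≤ (∑ t, D.factorRatio (D.sph t ω)) * (‖D.epsMat ω‖ ^ 2 / D.N) * D.N := by gcongr
    _ = _ := by field_simp

end Panel

end GroupedFactor

namespace GroupedFactor

open scoped Matrix.Norms.Frobenius

/-! ### The information criterion selects the true number of groups -/

section Selection

variable {m N T K₀ : ℕ} {F : Matrix (Fin T) (Fin m) ℝ} {E : Matrix (Fin T) (Fin N) ℝ}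
  {Λ L : Matrix (Fin N) (Fin m) ℝ} {H : Matrix (Fin m) (Fin m) ℝ} {B h s r : ℝ}
  {grp : Fin N → Fin K₀} {G : ℕ → Finpartition (Finset.univ : Finset (Fin N))}

theorem log_sub_log_le {x y : ℝ} (hx : 0 < x) (hy : 0 < y) :
    Real.log x - Real.log y ≤ (x - y) / y := by
  rw [← Real.log_div hx.ne' hy.ne', sub_div, div_self hy.ne']
  exact Real.log_le_sub_one_of_pos (div_pos hx hy)

/-- The information criterion prefers the true number of groups. -/
theorem RegularFit.infoCrit_lt (hR : RegularFit F E Λ L H B h s r)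
    (hΛ : ∀ i j, grp i = grp j → Λ i = Λ j)
    (hsep : ∀ i j k l, grp i = grp j → grp k ≠ grp l → dist1 L i j < dist1 L k l) (h1 : 1 ≤ K₀)
    (hKN : K₀ ≤ N) (hsurj : Function.Surjective grp) (hG : IsAHCRun (dist1 L) G) {τ : ℝ}
    (hτ : 0 < τ) (hcard : ∀ i, τ * N ≤ (labelCell grp i).card) {e : ℝ} (he : 0 < e)
    (hE : e * √N * √T ≤ ‖E‖)
    (hsmall : (projConst B h s + 2 * h * (B * h + B ^ 2) * B) * √r ≤ e / 2) {ρ W : ℝ} (hρ : 0 < ρ)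
    (hrρ : projConst B h s ^ 2 * r < e ^ 2 / 4 * ρ)
    (hW : ∀ i j, ∑ a, (Λ i a - Λ j a) ^ 2 ≤ W)
    (hgap : ∀ i j, grp i ≠ grp j →
      e ^ 2 * ρ ≤ τ * s ^ 2 / 16 * ∑ a, (Λ i a - Λ j a) ^ 2 ∧
      K₀ * ρ * ((B ^ 2 + B) ^ 2 + B ^ 2 + τ * s ^ 2 / 32 * W) <
        τ * s ^ 2 / 32 * ∑ a, (Λ i a - Λ j a) ^ 2) {K : ℕ} (hK1 : 1 ≤ K) (hK : K ≠ K₀) :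
    infoCrit (F * Λ.transpose + E) L G ρ K₀ < infoCrit (F * Λ.transpose + E) L G ρ K := by
  have hs := hR.s_pos
  have hB := hR.B_pos
  have hpart : (G K₀).part = labelCell grp := by
    ext1 i; exact hG.part_eq_group hsep h1 hKN hsurj i
  have hlow := hR.le_fitS he.le hE hsmall
  have hpos : ∀ cell, 0 < fitS (F * Λ.transpose + E) L cell := fun cell =>
    lt_of_lt_of_le (by positivity) (hlow cell)
  unfold infoCrit
  rw [hpart]
  set S₀ := fitS (F * Λ.transpose + E) L (labelCell grp) with hS₀
  set S := fitS (F * Λ.transpose + E) L (G K).part with hS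
  have hS0 : 0 < S₀ := hpos _
  have hSp : 0 < S := hpos _
  rcases lt_or_gt_of_ne hK with hlt | hgt
  · obtain ⟨i, j, hij, hc⟩ := hG.exists_merged hsep hKN hsurj hK1 hlt
    have h2 := hR.fitS_merged_ge hΛ hij hc hτ.le (hcard i) (hcard j)
    obtain ⟨h3, h4⟩ := hgap i j hij
    set w := ∑ a, (Λ i a - Λ j a) ^ 2 with hw
    have hw0 : 0 ≤ w := Finset.sum_nonneg fun _ _ => sq_nonneg _
    set d := τ * s ^ 2 / 32 * w with hd
    have hd0 : 0 ≤ d := by positivity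
    -- The fit rises by at least `2 d - 2 projConst² r`. By `hrρ` and the first part of `hgap` the
    -- loss is at most `e² ρ / 2 ≤ d`.
    have h5 : S₀ + d ≤ S := by
      have : τ * s ^ 2 / 16 * w = 2 * d := by rw [hd]; ring
      rw [this] at h2 h3
      linarith
    have h6 : S₀ + d ≤ (B ^ 2 + B) ^ 2 + B ^ 2 + τ * s ^ 2 / 32 * W := by
      have := hR.fitS_true_le hΛ
      have : d ≤ τ * s ^ 2 / 32 * W := by
        rw [hd]; exact mul_le_mul_of_nonneg_left (hW i j) (by positivity)
      linarith
    have h7 := log_sub_log_le hS0 (show 0 < S₀ + d by positivity)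
    have h8 : Real.log (S₀ + d) ≤ Real.log S := Real.log_le_log (by positivity) h5
    -- As `S₀ + d` is bounded by a constant, the relative increase of the fit is of order `d`, and
    -- this exceeds the whole penalty `K₀ ρ` that could be saved.
    have h9 : K₀ * ρ < d / (S₀ + d) := by
      rw [lt_div_iff₀ (by positivity)]
      refine lt_of_le_of_lt ?_ h4
      gcongr
    have h10 : (S₀ - (S₀ + d)) / (S₀ + d) = -(d / (S₀ + d)) := by ring
    rw [h10] at h7
    have : 0 ≤ K * ρ := by positivity
    linarith
  · have h2 := log_sub_log_le hS0 hSp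
    have h3 : (S₀ - S) / S < ρ := by
      rw [div_lt_iff₀ hSp]
      calc S₀ - S ≤ projConst B h s ^ 2 * r := hR.fitS_true_sub_le hΛ _
        _ < e ^ 2 / 4 * ρ := hrρ
        _ ≤ ρ * S := by rw [mul_comm]; exact mul_le_mul_of_nonneg_left (hlow _) hρ.le
    -- An extra cluster costs at least `ρ`, more than the possible gain in the logarithm.
    have h4 : (K₀ : ℝ) + 1 ≤ K := by exact_mod_cast hgt
    nlinarith

end Selection

/-! ### Regular realizations: separation, fit conditions, size of the errors -/

namespace Panel

variable {m K₀ : ℕ} {D : Panel.{u} m K₀} {c₁ c₂ B : ℝ}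

theorem kendall_transpose (ω : D.Ω) : (kendall (D.Y ω)).transpose = kendall (D.Y ω) := by
  ext i j
  rw [Matrix.transpose_apply, kendall_apply, kendall_apply, avgRatio_comm]

theorem mul_Hhat_sub (L : Matrix (Fin D.N) (Fin m) ℝ) (v : Fin m → ℝ) (ω : D.Ω) (i j : Fin D.N)
    (k : Fin m) : ((D.Hhat L v ω).transpose.mulVec (D.Lam i - D.Lam j)) k =
      (D.Lam * D.Hhat L v ω) i k - (D.Lam * D.Hhat L v ω) j k := by
  simp only [Matrix.mulVec, dotProduct, Matrix.transpose_apply, Matrix.mul_apply, Pi.sub_apply,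
    mul_sub, Finset.sum_sub_distrib]
  simp only [mul_comm]

theorem abs_dist1_sub_Delta_le (hm : 0 < m) {L : Matrix (Fin D.N) (Fin m) ℝ} {v : Fin m → ℝ}
    {ω : D.Ω} {δ : ℝ} (hδ : ∀ i a, |(L - D.Lam * D.Hhat L v ω) i a| ≤ δ) (i j : Fin D.N) :
    |dist1 L i j - D.Delta L v ω i j| ≤ 2 * δ := by
  have hm0 : (0 : ℝ) < m := by exact_mod_cast hm
  rw [dist1, Delta, ← mul_sub, ← Finset.sum_sub_distrib, abs_mul, abs_of_pos (by positivity),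
    inv_mul_le_iff₀ hm0]
  refine (Finset.abs_sum_le_sum_abs _ _).trans
    ((Finset.sum_le_card_nsmul _ _ (2 * δ) fun k _ => ?_).trans_eq ?_)
  · rw [mul_Hhat_sub]
    refine (abs_abs_sub_abs_le_abs_sub _ _).trans ?_
    have h1 := hδ i k
    have h2 := hδ j k
    rw [Matrix.sub_apply] at h1 h2
    have e : L i k - L j k - ((D.Lam * D.Hhat L v ω) i k - (D.Lam * D.Hhat L v ω) j k) =
        (L i k - (D.Lam * D.Hhat L v ω) i k) - (L j k - (D.Lam * D.Hhat L v ω) j k) := by ring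
    rw [e]
    exact (abs_sub _ _).trans (by linarith)
  · simp

theorem Delta_eq_zero {L : Matrix (Fin D.N) (Fin m) ℝ} {v : Fin m → ℝ} {ω : D.Ω} {i j : Fin D.N}
    (h : D.grp i = D.grp j) : D.Delta L v ω i j = 0 := by
  have : D.Lam i = D.Lam j := congrArg D.lamG h
  simp [Delta, this]

theorem Delta_nonneg (L : Matrix (Fin D.N) (Fin m) ℝ) (v : Fin m → ℝ) (ω : D.Ω) (i j : Fin D.N) :
    0 ≤ D.Delta L v ω i j := by unfold Delta; positivity

/-- Links the rate condition, stated for rotated loadings, with the gap in fit, which involves the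
true loadings. Only an upper bound on the rotation is needed. -/
theorem Delta_sq_le (hm : 0 < m) {L : Matrix (Fin D.N) (Fin m) ℝ} {v : Fin m → ℝ} {ω : D.Ω} {h : ℝ}
    (hH : ‖D.Hhat L v ω‖ ≤ h) (i j : Fin D.N) :
    D.Delta L v ω i j ^ 2 ≤ h ^ 2 * ∑ a, (D.Lam i a - D.Lam j a) ^ 2 := by
  have hm0 : (0 : ℝ) < m := by exact_mod_cast hm
  set x := (D.Hhat L v ω).transpose.mulVec (D.Lam i - D.Lam j) with hx
  have h1 : (∑ k, |x k|) ^ 2 ≤ m * ∑ k, x k ^ 2 := by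
    have := sq_sum_le_card_mul_sum_sq (s := Finset.univ) (f := fun k => |x k|)
    simpa using this
  have h2 : ∑ k, x k ^ 2 ≤ ‖D.Hhat L v ω‖ ^ 2 * ∑ a, (D.Lam i a - D.Lam j a) ^ 2 := by
    rw [frob_sq, Finset.sum_comm, Finset.sum_mul]
    refine Finset.sum_le_sum fun k _ => ?_
    have := Finset.sum_mul_sq_le_sq_mul_sq Finset.univ (fun a => D.Hhat L v ω a k)
      (fun a => D.Lam i a - D.Lam j a)
    exact this
  have h3 : ‖D.Hhat L v ω‖ ^ 2 ≤ h ^ 2 := pow_le_pow_left₀ (norm_nonneg _) hH 2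
  have hw : 0 ≤ ∑ a, (D.Lam i a - D.Lam j a) ^ 2 := Finset.sum_nonneg fun _ _ => sq_nonneg _
  have hxx : 0 ≤ ∑ k, x k ^ 2 := Finset.sum_nonneg fun _ _ => sq_nonneg _
  have h4 : D.Delta L v ω i j ^ 2 ≤ ∑ k, x k ^ 2 := by
    unfold Delta
    rw [mul_pow, inv_pow, inv_mul_le_iff₀ (by positivity)]
    refine h1.trans (mul_le_mul_of_nonneg_right ?_ hxx)
    have : (1 : ℝ) ≤ m := by exact_mod_cast hm
    nlinarith
  exact h4.trans (h2.trans (mul_le_mul_of_nonneg_right h3 hw))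

theorem ScaleBounds.sum_sub_sq_le (hb : D.ScaleBounds c₁ c₂ B) (i j : Fin D.N) :
    ∑ a, (D.Lam i a - D.Lam j a) ^ 2 ≤ 4 * B ^ 2 := by
  have : ∀ a, (D.Lam i a - D.Lam j a) ^ 2 ≤ 2 * D.Lam i a ^ 2 + 2 * D.Lam j a ^ 2 := fun a => by
    nlinarith [sq_nonneg (D.Lam i a + D.Lam j a)]
  refine (Finset.sum_le_sum fun a _ => this a).trans ?_
  rw [Finset.sum_add_distrib, ← Finset.mul_sum, ← Finset.mul_sum]
  linarith [hb.loading i, hb.loading j]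

theorem _root_.GroupedFactor.IsLeadingEigen.norm_le {N : ℕ} {K : Matrix (Fin N) (Fin N) ℝ}
    {v : Fin m → ℝ} {L : Matrix (Fin N) (Fin m) ℝ} (h : IsLeadingEigen K v L) :
    ‖L‖ ≤ m * √N := by
  refine abs_le_of_sq_le_sq' ?_ (by positivity) |>.2
  rw [← frob_trace_self, h.normalized, Matrix.trace_smul, Matrix.trace_one, mul_pow,
    Real.sq_sqrt (Nat.cast_nonneg _), Fintype.card_fin, smul_eq_mul, mul_comm]
  gcongr
  have : m ≤ m ^ 2 := Nat.le_self_pow two_ne_zero m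
  exact_mod_cast this

/-- The bound for the rotation matrix. -/
def rotConst (m : ℕ) (c₁ c₂ B γ Q : ℝ) : ℝ :=
  m * eigenConst m c₁ c₂ B Q ^ 3 / (signalConst c₁ B γ / 2)

/-- The constant of the uniform bound for the loading errors. -/
def loadConst (m : ℕ) (c₁ c₂ B γ Q : ℝ) : ℝ :=
  EigenBounds.errConst m (eigenConst m c₁ c₂ B Q) / (signalConst c₁ B γ / 2)

/-- The constant of the bounds that enter the fit. -/
def fitConst (m : ℕ) (c₁ c₂ B γ Q : ℝ) : ℝ :=
  eigenConst m c₁ c₂ B Q + (1 + m) * loadConst m c₁ c₂ B γ Q + Q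

variable (D) in
/-- A realization in which the deviations are bounded by `Q` and the factors are not degenerate. -/
structure Regular (Q s : ℝ) (ω : D.Ω) : Prop where
  spectral : D.spectralDev ω ≤ Q
  error : D.errorSize ω ≤ Q
  factor : D.factorSize ω ≤ Q
  error_pos : ∀ t, 0 < quadForm D.evec (D.sph t ω)
  norm_F : ‖D.facMat ω‖ ≤ Q * √D.T
  lower_F : LowerBound (s * √D.T) (D.facMat ω)

theorem signalConst_pos (hb : D.ScaleBounds c₁ c₂ B) {γ : ℝ} (hγ : 0 < γ) :
    0 < signalConst c₁ B γ := by
  have hm2 := moment2_nonneg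
  have hab := absMoment_pos
  have hc1 := hb.pos₁
  unfold signalConst; positivity

theorem eigenvalue_ge [Nontrivial D.Space] (hb : D.ScaleBounds c₁ c₂ B)
    (hS : SphericalSample D.sph D.P) (hT : 2 ≤ D.T) (hN : 9 ≤ D.N) {γ : ℝ} (hγ : 0 < γ)
    (hΛ : ∀ a : Fin m → ℝ, γ * D.N * ∑ b, a b ^ 2 ≤ ∑ i, D.Lam.mulVec a i ^ 2) {ω : D.Ω}
    (hdev : D.spectralDev ω ≤ D.T * (signalConst c₁ B γ / 2) ^ 2)
    {L : Matrix (Fin D.N) (Fin m) ℝ} {v : Fin m → ℝ} (hL : IsLeadingEigen (kendall (D.Y ω)) v L)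
    (j : Fin m) : signalConst c₁ B γ / 2 ≤ v j := by
  have hN0 : (0 : ℝ) < D.N := by exact_mod_cast (show 0 < D.N by omega)
  refine hL.le_eigenvalue (kendall_transpose ω) (by omega) (fun a ha => ?_)
    (le_kendall_mulVec hb hS hT hN hγ hΛ hdev) j
  have h1 := hΛ a
  rw [ha] at h1
  simp only [Pi.zero_apply, ne_eq, OfNat.ofNat_ne_zero, not_false_eq_true, zero_pow,
    Finset.sum_const_zero] at h1
  have h2 : ∑ b, a b ^ 2 = 0 := le_antisymm
    (nonpos_of_mul_nonpos_right h1 (by positivity)) (Finset.sum_nonneg fun _ _ => sq_nonneg _)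
  ext b
  exact pow_eq_zero_iff two_ne_zero |>.1
    ((Finset.sum_eq_zero_iff_of_nonneg fun b _ => sq_nonneg (a b)).1 h2 b (Finset.mem_univ b))

theorem Regular.regularFit [Nontrivial D.Space] (hm : 0 < m) (hb : D.ScaleBounds c₁ c₂ B)
    (hS : SphericalSample D.sph D.P) (hT : 2 ≤ D.T) (hN : 9 ≤ D.N) {γ : ℝ} (hγ : 0 < γ)
    {Q s : ℝ} (hQ : 1 ≤ Q) (hs : 0 < s) {ω : D.Ω} (hreg : D.Regular Q s ω)
    {L : Matrix (Fin D.N) (Fin m) ℝ} {v : Fin m → ℝ} (hL : IsLeadingEigen (kendall (D.Y ω)) v L)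
    (hv : ∀ j, signalConst c₁ B γ / 2 ≤ v j) {r : ℝ} (hrN : 1 / (D.N : ℝ) ≤ r)
    (hrT : 1 / (D.T : ℝ) ≤ r) (h1 : fitConst m c₁ c₂ B γ Q ^ 2 * √r ≤ 1 / 2)
    (h2 : (fitConst m c₁ c₂ B γ Q * rotConst m c₁ c₂ B γ Q + fitConst m c₁ c₂ B γ Q ^ 2) * √r ≤
      s / (4 * rotConst m c₁ c₂ B γ Q)) :
    RegularFit (D.facMat ω) (D.epsMat ω) D.Lam L (D.Hhat L v ω) (fitConst m c₁ c₂ B γ Q)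
      (rotConst m c₁ c₂ B γ Q) s r := by
  have hT0 : (0 : ℝ) < D.T := by exact_mod_cast (show 0 < D.T by omega)
  have hN0 : (0 : ℝ) < D.N := by exact_mod_cast (show 0 < D.N by omega)
  have hm0 : (0 : ℝ) < m := by exact_mod_cast hm
  have hκ := signalConst_pos hb hγ
  have hκ2 : 0 < signalConst c₁ B γ / 2 := by positivity
  have hE := eigenBounds hb hS hT hN hQ hreg.spectral
  have hBq := hE.B_pos
  have hr0 : 0 < r := lt_of_lt_of_le (by positivity) hrN
  have hload : 0 ≤ loadConst m c₁ c₂ B γ Q := by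
    unfold loadConst; exact div_nonneg (EigenBounds.errConst_nonneg hBq.le) hκ2.le
  have hml : 0 ≤ (1 + m) * loadConst m c₁ c₂ B γ Q := by positivity
  have hfq : eigenConst m c₁ c₂ B Q ≤ fitConst m c₁ c₂ B γ Q := by unfold fitConst; linarith
  have hfl : (1 + m) * loadConst m c₁ c₂ B γ Q ≤ fitConst m c₁ c₂ B γ Q := by
    unfold fitConst; linarith
  have hfQ : Q ≤ fitConst m c₁ c₂ B γ Q := by unfold fitConst; linarith
  have hmB : (m : ℝ) ≤ eigenConst m c₁ c₂ B Q := by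
    have := hb.B_nonneg
    have := hb.pos₁
    have := (ratioMoment_pos hb.pos₂).le
    have : 0 ≤ Q + B + 2 * m * ratioMoment c₂ * c₁ * B + ratioMoment c₂ * c₁ := by positivity
    unfold eigenConst; linarith
  have hLn : ‖L‖ ≤ eigenConst m c₁ c₂ B Q * √D.N := hL.norm_le.trans (by gcongr)
  -- The bound `y ≤ Q` gives `y ≤ fitConst²`, because `1 ≤ Q ≤ fitConst`.
  have hsize : ∀ x : ℝ, ∀ y, 0 ≤ x → x ^ 2 = D.N * D.T * y → y ≤ Q →
      x ≤ fitConst m c₁ c₂ B γ Q * √D.N * √D.T := by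
    intro x y _ hxy hy
    refine abs_le_of_sq_le_sq' ?_ (by have := hBq.le.trans hfq; positivity) |>.2
    rw [hxy, mul_pow, mul_pow, Real.sq_sqrt hN0.le, Real.sq_sqrt hT0.le]
    have : y ≤ fitConst m c₁ c₂ B γ Q ^ 2 := by nlinarith
    calc D.N * D.T * y ≤ D.N * D.T * fitConst m c₁ c₂ B γ Q ^ 2 := by gcongr
      _ = _ := by ring
  have herr := hreg.error
  unfold errorSize at herr
  have p1 := norm_epsMat_sq (D := D) (by omega) (by omega) ω
  have p2 := norm_epsMat_mul_Lam_sq (D := D) (by omega) (by omega) ω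
  have p3 := norm_facMat_transpose_mul_epsMat_sq (D := D) (by omega) (by omega) ω
  have n1 := nonneg_of_mul_nonneg_right (p1 ▸ sq_nonneg ‖D.epsMat ω‖) (mul_pos hN0 hT0)
  have n2 := nonneg_of_mul_nonneg_right (p2 ▸ sq_nonneg ‖D.epsMat ω * D.Lam‖) (mul_pos hN0 hT0)
  have n3 := nonneg_of_mul_nonneg_right
    (p3 ▸ sq_nonneg ‖(D.facMat ω).transpose * D.epsMat ω‖) (mul_pos hN0 hT0)
  refine
    { B_pos := hBq.trans_le hfq
      h_pos := by unfold rotConst; positivity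
      s_pos := hs
      N_pos := by omega
      T_pos := by omega
      r_N := hrN
      r_T := hrT
      normalized := hL.normalized
      norm_L := hLn.trans (by gcongr)
      norm_Λ := hE.norm_Λ.trans (by gcongr)
      norm_H := hE.norm_rotation hLn hκ2 hv
      norm_sub := ?_
      norm_E := hsize _ _ (norm_nonneg _) p1 (by linarith)
      norm_EΛ := hsize _ _ (norm_nonneg _) p2 (by linarith)
      norm_FE := hsize _ _ (norm_nonneg _) p3 (by linarith)
      norm_F := hreg.norm_F.trans (by gcongr)
      lower_F := hreg.lower_F
      small_rot := h1
      small_err := h2 }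
  have hq1 : 1 ≤ √r * √D.N := by
    rw [← Real.sqrt_mul hr0.le, Real.one_le_sqrt, ← div_le_iff₀ hN0]; exact hrN
  have hq2 : 1 ≤ √r * √D.T := by
    rw [← Real.sqrt_mul hr0.le, Real.one_le_sqrt, ← div_le_iff₀ hT0]; exact hrT
  refine (hE.norm_sub_le hLn hκ2 hv hL.eigen hq1 hq2).trans ?_
  rw [mul_div_assoc]
  gcongr
  exact hfl

/-- Loading errors that are small relative to the signal make the groups separated. -/
theorem Regular.separated [Nontrivial D.Space] (hm : 0 < m) (hb : D.ScaleBounds c₁ c₂ B)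
    (hS : SphericalSample D.sph D.P) (hT : 2 ≤ D.T) (hN : 9 ≤ D.N) {γ : ℝ} (hγ : 0 < γ)
    {Q s : ℝ} (hQ : 1 ≤ Q) {ω : D.Ω} (hreg : D.Regular Q s ω)
    {L : Matrix (Fin D.N) (Fin m) ℝ} {v : Fin m → ℝ} (hL : IsLeadingEigen (kendall (D.Y ω)) v L)
    (hv : ∀ j, signalConst c₁ B γ / 2 ≤ v j) {η : ℝ}
    (hη : 8 * loadConst m c₁ c₂ B γ Q * η < 1)
    (hsig : ∀ i j, D.grp i ≠ D.grp j →
      max (√(D.N / D.T)) ((D.N : ℝ) ^ (-(1 / 4) : ℝ)) ≤ η * D.Delta L v ω i j)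
    (i j k l : Fin D.N) (hij : D.grp i = D.grp j) (hkl : D.grp k ≠ D.grp l) :
    dist1 L i j < dist1 L k l := by
  have hT0 : (0 : ℝ) < D.T := by exact_mod_cast (show 0 < D.T by omega)
  have hN0 : (0 : ℝ) < D.N := by exact_mod_cast (show 0 < D.N by omega)
  have hN1 : (1 : ℝ) ≤ D.N := by exact_mod_cast (show 1 ≤ D.N by omega)
  have hκ := signalConst_pos hb hγ
  have hκ2 : 0 < signalConst c₁ B γ / 2 := by positivity
  have hE := eigenBounds hb hS hT hN hQ hreg.spectral
  have hBq := hE.B_pos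
  have hload : 0 ≤ loadConst m c₁ c₂ B γ Q := by
    unfold loadConst; exact div_nonneg (EigenBounds.errConst_nonneg hBq.le) hκ2.le
  have hmB : (m : ℝ) ≤ eigenConst m c₁ c₂ B Q := by
    have := hb.B_nonneg
    have := hb.pos₁
    have := (ratioMoment_pos hb.pos₂).le
    have : 0 ≤ Q + B + 2 * m * ratioMoment c₂ * c₁ * B + ratioMoment c₂ * c₁ := by positivity
    unfold eigenConst; linarith
  have hLn : ‖L‖ ≤ eigenConst m c₁ c₂ B Q * √D.N := hL.norm_le.trans (by gcongr)
  set δ := loadConst m c₁ c₂ B γ Q * (√D.N / √D.T + 1 / √D.N) with hδ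
  have herr : ∀ i a, |(L - D.Lam * D.Hhat L v ω) i a| ≤ δ :=
    fun i a => hE.entry_sub_le hLn hκ2 hv hL.eigen i a
  set μ := max (√(D.N / D.T)) ((D.N : ℝ) ^ (-(1 / 4) : ℝ)) with hμ
  have hμ0 : 0 < μ := lt_of_lt_of_le (Real.rpow_pos_of_pos hN0 _) (le_max_right _ _)
  -- The signal rate dominates both parts of the loading error; `1/√N ≤ N^(-1/4)` as `N ≥ 1`.
  have hδμ : δ ≤ 2 * loadConst m c₁ c₂ B γ Q * μ := by
    have a1 : √D.N / √D.T ≤ μ := by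
      rw [← Real.sqrt_div hN0.le]; exact le_max_left _ _
    have a2 : 1 / √D.N ≤ μ := by
      refine le_trans ?_ (le_max_right _ _)
      rw [Real.sqrt_eq_rpow, one_div, ← Real.rpow_neg hN0.le]
      exact Real.rpow_le_rpow_of_exponent_le hN1 (by norm_num)
    calc δ ≤ loadConst m c₁ c₂ B γ Q * (μ + μ) := by rw [hδ]; gcongr
      _ = _ := by ring
  have h1 := (abs_le.1 (abs_dist1_sub_Delta_le hm herr i j)).2
  have h2 := (abs_le.1 (abs_dist1_sub_Delta_le hm herr k l)).1
  rw [Delta_eq_zero hij] at h1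
  have h3 := hsig k l hkl
  have hΔ := D.Delta_nonneg L v ω k l
  set Δ := D.Delta L v ω k l
  have hΔ0 : 0 < Δ := by
    rcases hΔ.eq_or_lt with h0 | h0
    · rw [← h0, mul_zero] at h3; linarith
    · exact h0
  -- Within groups distances are at most `2 δ` and between groups at least `Δ - 2 δ`, so `4 δ < Δ`
  -- is the target.
  have h4 : 8 * loadConst m c₁ c₂ B γ Q * (η * Δ) < Δ := by
    calc _ = 8 * loadConst m c₁ c₂ B γ Q * η * Δ := by ring
      _ < 1 * Δ := by gcongr
      _ = Δ := one_mul _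
  have h5 : 4 * δ ≤ 8 * loadConst m c₁ c₂ B γ Q * (η * Δ) := by
    calc 4 * δ ≤ 8 * loadConst m c₁ c₂ B γ Q * μ := by linarith
      _ ≤ _ := by gcongr
  linarith

/-- Nondegenerate factors give `‖F‖ ≥ s √T`. Inserted in the fourth-power inequality this yields `s⁴
N T ≤ Q ‖E‖²`. -/
theorem Regular.le_norm_epsMat (hm : 0 < m) (hN : 0 < D.N) (hT : 0 < D.T) {Q s : ℝ} (hQ : 1 ≤ Q)
    (hs : 0 < s) {ω : D.Ω} (hreg : D.Regular Q s ω) :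
    s ^ 2 / Q * √D.N * √D.T ≤ ‖D.epsMat ω‖ := by
  have hT0 : (0 : ℝ) < D.T := by exact_mod_cast hT
  have hN0 : (0 : ℝ) < D.N := by exact_mod_cast hN
  have hQ0 : 0 < Q := by linarith
  have h1 := norm_facMat_pow_four_le hN hT hreg.error_pos
  have h2 : s * √D.T ≤ ‖D.facMat ω‖ := by
    have h := hreg.lower_F m 1
    rw [Matrix.mul_one] at h
    refine le_trans (le_mul_of_one_le_right (by positivity) ?_) h
    have := frob_entry_le (1 : Matrix (Fin m) (Fin m) ℝ) ⟨0, hm⟩ ⟨0, hm⟩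
    simpa using this
  have h3 : s ^ 2 * D.T ≤ ‖D.facMat ω‖ ^ 2 := by
    have := pow_le_pow_left₀ (by positivity) h2 2
    rwa [mul_pow, Real.sq_sqrt hT0.le] at this
  have h4 : (s ^ 2 * D.T) ^ 2 * D.N ≤ D.T * Q * ‖D.epsMat ω‖ ^ 2 := by
    calc (s ^ 2 * D.T) ^ 2 * D.N ≤ (‖D.facMat ω‖ ^ 2) ^ 2 * D.N := by gcongr
      _ ≤ _ := h1
      _ ≤ _ := by
        have := hreg.factor
        gcongr
  refine abs_le_of_sq_le_sq' ?_ (norm_nonneg _) |>.2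
  rw [mul_pow, mul_pow, Real.sq_sqrt hN0.le, Real.sq_sqrt hT0.le, div_pow]
  have h5 : s ^ 4 * D.N * D.T ≤ Q * ‖D.epsMat ω‖ ^ 2 := by
    refine le_of_mul_le_mul_left ?_ hT0
    calc _ = (s ^ 2 * D.T) ^ 2 * D.N := by ring
      _ ≤ _ := h4
      _ = _ := by ring
  have hE : 0 ≤ ‖D.epsMat ω‖ ^ 2 := sq_nonneg _
  rw [div_mul_eq_mul_div, div_mul_eq_mul_div, div_le_iff₀ (by positivity)]
  calc _ = s ^ 4 * D.N * D.T := by ring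
    _ ≤ Q * ‖D.epsMat ω‖ ^ 2 := h5
    -- The factor `Q` is weakened to `Q²` to match the constant `s² / Q`.
    _ ≤ _ := by nlinarith [mul_nonneg (mul_nonneg hQ0.le hE) (sub_nonneg.2 hQ)]

end Panel

end GroupedFactor

namespace GroupedFactor

open scoped Matrix.Norms.Frobenius

/-! ### Recovery on a regular realization -/

namespace Panel

variable {m K₀ : ℕ} {D : Panel.{u} m K₀} {c₁ c₂ B : ℝ}

/-- The deterministic core. Asymptotic conditions appear as numerical inequalities in `r`, `ρ` and
`η`, where `η` bounds the loading-error rate relative to the signal and `ρ` relative to its square.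
-/
theorem Regular.recovers [Nontrivial D.Space] (hm : 0 < m) (hb : D.ScaleBounds c₁ c₂ B)
    (hS : SphericalSample D.sph D.P) (hT : 2 ≤ D.T) (hN : 9 ≤ D.N) (hKN : K₀ ≤ D.N)
    {γ τ : ℝ} (hγ : 0 < γ)
    (hΛ : ∀ a : Fin m → ℝ, γ * D.N * ∑ b, a b ^ 2 ≤ ∑ i, D.Lam.mulVec a i ^ 2)
    (hτ : 0 < τ) (hcard : ∀ k, τ * D.N ≤ (D.group k).card) {Q s : ℝ} (hQ : 1 ≤ Q) (hs : 0 < s)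
    (hdev : Q ≤ D.T * (signalConst c₁ B γ / 2) ^ 2) {r ρ η : ℝ}
    (hrN : 1 / (D.N : ℝ) ≤ r) (hrT : 1 / (D.T : ℝ) ≤ r)
    (h1 : fitConst m c₁ c₂ B γ Q ^ 2 * √r ≤ 1 / 2)
    (h2 : (fitConst m c₁ c₂ B γ Q * rotConst m c₁ c₂ B γ Q + fitConst m c₁ c₂ B γ Q ^ 2) * √r ≤
      s / (4 * rotConst m c₁ c₂ B γ Q))
    (h3 : (RegularFit.projConst (fitConst m c₁ c₂ B γ Q) (rotConst m c₁ c₂ B γ Q) s +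
      2 * rotConst m c₁ c₂ B γ Q * (fitConst m c₁ c₂ B γ Q * rotConst m c₁ c₂ B γ Q +
        fitConst m c₁ c₂ B γ Q ^ 2) * fitConst m c₁ c₂ B γ Q) * √r ≤ s ^ 2 / Q / 2)
    (hρ : 0 < ρ)
    (hrρ : RegularFit.projConst (fitConst m c₁ c₂ B γ Q) (rotConst m c₁ c₂ B γ Q) s ^ 2 * r <
      (s ^ 2 / Q) ^ 2 / 4 * ρ)
    (hη : 8 * loadConst m c₁ c₂ B γ Q * η < 1) (hη0 : 0 < η)
    (hη1 : (s ^ 2 / Q) ^ 2 * (η * rotConst m c₁ c₂ B γ Q ^ 2) ≤ τ * s ^ 2 / 16)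
    (hη2 : K₀ * (η * rotConst m c₁ c₂ B γ Q ^ 2) * ((fitConst m c₁ c₂ B γ Q ^ 2 +
      fitConst m c₁ c₂ B γ Q) ^ 2 + fitConst m c₁ c₂ B γ Q ^ 2 + τ * s ^ 2 / 32 * (4 * B ^ 2)) <
        τ * s ^ 2 / 32)
    {ω : D.Ω} (hreg : D.Regular Q s ω) {Kbar Khat : ℕ} (hK : K₀ ≤ Kbar)
    {L : Matrix (Fin D.N) (Fin m) ℝ} {v : Fin m → ℝ}
    {G : ℕ → Finpartition (Finset.univ : Finset (Fin D.N))}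
    (hout : IsOutput Kbar ρ (D.Y ω) L v G Khat)
    (hsig : ∀ i j, D.grp i ≠ D.grp j →
      max (√(D.N / D.T)) ((D.N : ℝ) ^ (-(1 / 4) : ℝ)) ≤ η * D.Delta L v ω i j)
    (hsmall : ∀ i j, D.grp i ≠ D.grp j → ρ ≤ η * D.Delta L v ω i j ^ 2) :
    Khat = K₀ ∧ (G K₀).part = D.trueCell := by
  have hN0 : (0 : ℝ) < D.N := by exact_mod_cast (show 0 < D.N by omega)
  have hQ0 : 0 < Q := by linarith
  have hv := eigenvalue_ge hb hS hT hN hγ hΛ (hreg.spectral.trans hdev) hout.eigen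
  have hR := hreg.regularFit hm hb hS hT hN hγ hQ hs hout.eigen hv hrN hrT h1 h2
  have hsep := hreg.separated hm hb hS hT hN hγ hQ hout.eigen hv hη hsig
  have hK1 : 1 ≤ K₀ := Nat.succ_le_of_lt (Fin.pos (D.grp ⟨0, by omega⟩))
  have hsurj : Function.Surjective D.grp := by
    intro k
    have h4 : (0 : ℝ) < (D.group k).card := lt_of_lt_of_le (by positivity) (hcard k)
    obtain ⟨i, hi⟩ := Finset.card_pos.1 (by exact_mod_cast h4)
    exact ⟨i, (Finset.mem_filter.1 hi).2⟩
  have hW : ∀ i j, D.grp i ≠ D.grp j →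
      -- The penalty is small against the squared gap of the true loadings; this also makes that gap
      -- positive, since `ρ > 0`.
      ρ ≤ η * rotConst m c₁ c₂ B γ Q ^ 2 * ∑ a, (D.Lam i a - D.Lam j a) ^ 2 := by
    intro i j hij
    refine (hsmall i j hij).trans ?_
    rw [mul_assoc]
    exact mul_le_mul_of_nonneg_left (Delta_sq_le hm hR.norm_H i j) hη0.le
  have hpart : (G K₀).part = D.trueCell := by
    ext1 i; exact hout.ahc.part_eq_group hsep hK1 hKN hsurj i
  refine ⟨?_, hpart⟩
  by_contra hne
  have hlt := hR.infoCrit_lt (grp := D.grp) (G := G) (fun i j h => congrArg D.lamG h) hsep hK1 hKN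
    hsurj hout.ahc hτ (fun i => hcard (D.grp i)) (e := s ^ 2 / Q) (by positivity)
    (hreg.le_norm_epsMat hm (by omega) (by omega) hQ hs) h3 hρ hrρ hb.sum_sub_sq_le
    (fun i j hij => ?_) hout.range.1 hne
  · rw [← Y_eq_mul] at hlt
    exact absurd (hout.minimizes K₀ hK1 hK) (not_le.2 hlt)
  · have h5 := hW i j hij
    set w := ∑ a, (D.Lam i a - D.Lam j a) ^ 2
    have hw0 : 0 < w := by
      have : 0 ≤ w := Finset.sum_nonneg fun _ _ => sq_nonneg _
      rcases this.eq_or_lt with h0 | h0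
      · rw [← h0, mul_zero] at h5; linarith
      · exact h0
    constructor
    · calc _ ≤ (s ^ 2 / Q) ^ 2 * (η * rotConst m c₁ c₂ B γ Q ^ 2 * w) := by gcongr
        _ = (s ^ 2 / Q) ^ 2 * (η * rotConst m c₁ c₂ B γ Q ^ 2) * w := by ring
        _ ≤ _ := by gcongr
    · have hX : 0 ≤ (fitConst m c₁ c₂ B γ Q ^ 2 + fitConst m c₁ c₂ B γ Q) ^ 2 +
          fitConst m c₁ c₂ B γ Q ^ 2 + τ * s ^ 2 / 32 * (4 * B ^ 2) := by positivity
      calc _ ≤ K₀ * (η * rotConst m c₁ c₂ B γ Q ^ 2 * w) * ((fitConst m c₁ c₂ B γ Q ^ 2 +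
            fitConst m c₁ c₂ B γ Q) ^ 2 + fitConst m c₁ c₂ B γ Q ^ 2 +
              τ * s ^ 2 / 32 * (4 * B ^ 2)) := by gcongr
        _ = K₀ * (η * rotConst m c₁ c₂ B γ Q ^ 2) * ((fitConst m c₁ c₂ B γ Q ^ 2 +
            fitConst m c₁ c₂ B γ Q) ^ 2 + fitConst m c₁ c₂ B γ Q ^ 2 +
              τ * s ^ 2 / 32 * (4 * B ^ 2)) * w := by ring
        _ < _ := by gcongr

end Panel

/-! ### Gram matrices -/

section Gram

variable {m : ℕ}

theorem exists_dotProduct_mulVec_ge {S : Matrix (Fin m) (Fin m) ℝ} (hm : 0 < m) (hS : S.PosDef) :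
    ∃ c, 0 < c ∧ ∀ u : Fin m → ℝ, c * ∑ a, u a ^ 2 ≤ u ⬝ᵥ S.mulVec u := by
  have : Nonempty (Fin m) := ⟨⟨0, hm⟩⟩
  obtain ⟨i, hi⟩ := Finite.exists_min hS.isHermitian.eigenvalues
  obtain ⟨j, hj⟩ := Finite.exists_max hS.isHermitian.eigenvalues
  refine ⟨hS.isHermitian.eigenvalues i, hS.eigenvalues_pos i, fun u =>
    (dotProduct_bounds_of_spectrum hS.isHermitian (c₁ := hS.isHermitian.eigenvalues j)
      (fun μ hμ => ?_) u).1⟩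
  rw [hS.isHermitian.spectrum_real_eq_range_eigenvalues] at hμ
  obtain ⟨k, rfl⟩ := hμ
  exact ⟨hi k, hj k⟩

/-- Entrywise distance `δ` means Frobenius distance at most `m δ`, which costs at most half of the
constant. -/
theorem dotProduct_mulVec_ge_of_close {S M : Matrix (Fin m) (Fin m) ℝ} {c δ : ℝ} (hδ : 0 ≤ δ)
    (hS : ∀ u : Fin m → ℝ, c * ∑ a, u a ^ 2 ≤ u ⬝ᵥ S.mulVec u)
    (hM : ∀ a b, |M a b - S a b| ≤ δ) (hc : m * δ ≤ c / 2) (u : Fin m → ℝ) :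
    c / 2 * ∑ a, u a ^ 2 ≤ u ⬝ᵥ M.mulVec u := by
  have h1 : ∑ a, ∑ b, (M a b - S a b) ^ 2 ≤ (m * δ) ^ 2 := by
    have : ∀ a b, (M a b - S a b) ^ 2 ≤ δ ^ 2 := fun a b => by
      rw [← sq_abs]; exact pow_le_pow_left₀ (abs_nonneg _) (hM a b) 2
    refine (Finset.sum_le_sum fun a _ => Finset.sum_le_sum fun b _ => this a b).trans_eq ?_
    simp; ring
  have h2 := Panel.abs_sum_mul_mul_le u (fun a b => M a b - S a b) (by positivity) h1
  have h3 : u ⬝ᵥ M.mulVec u = u ⬝ᵥ S.mulVec u + ∑ a, ∑ b, u a * u b * (M a b - S a b) := by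
    simp only [dotProduct, Matrix.mulVec, Finset.mul_sum, ← Finset.sum_add_distrib]
    exact Finset.sum_congr rfl fun a _ => Finset.sum_congr rfl fun b _ => by ring
  have hu : 0 ≤ ∑ a, u a ^ 2 := Finset.sum_nonneg fun _ _ => sq_nonneg _
  have h4 := (abs_le.1 h2).1
  have h5 := hS u
  have h6 := mul_le_mul_of_nonneg_right hc hu
  rw [h3]
  linarith

theorem dotProduct_gram {n : ℕ} (A : Matrix (Fin n) (Fin m) ℝ) (k : ℝ) (u : Fin m → ℝ) :
    u ⬝ᵥ (k • (A.transpose * A)).mulVec u = k * ∑ i, A.mulVec u i ^ 2 := by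
  rw [Matrix.smul_mulVec, dotProduct_smul, smul_eq_mul, ← Matrix.mulVec_mulVec,
    Matrix.dotProduct_mulVec, ← Matrix.mulVec_transpose, Matrix.transpose_transpose]
  simp [dotProduct, sq]

theorem lowerBound_of_gram {n : ℕ} {A : Matrix (Fin n) (Fin m) ℝ} {s k : ℝ}
    (hk : 0 ≤ k) (h : ∀ u : Fin m → ℝ, s ^ 2 * k * ∑ a, u a ^ 2 ≤ ∑ i, A.mulVec u i ^ 2) :
    LowerBound (s * √k) A := by
  intro l X
  refine abs_le_of_sq_le_sq' ?_ (norm_nonneg _) |>.2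
  rw [mul_pow, mul_pow, Real.sq_sqrt hk, frob_sq, frob_sq, Finset.sum_comm,
    Finset.sum_comm (f := fun i j => (A * X) i j ^ 2), Finset.mul_sum]
  exact Finset.sum_le_sum fun j _ => h fun a => X a j

end Gram

end GroupedFactor

namespace GroupedFactor

open scoped Matrix.Norms.Frobenius

theorem MeanLE.measure_gt_le {Ω : Type*} [MeasurableSpace Ω] {P : Measure Ω}
    [IsProbabilityMeasure P] {X : Ω → ℝ} {C : ℝ} (h : MeanLE P X C) (h0 : ∀ ω, 0 ≤ X ω) {Q : ℝ}
    (hQ : 0 < Q) : P {ω | Q < X ω} ≤ ENNReal.ofReal (C / Q) := by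
  have h1 := mul_meas_ge_le_integral_of_nonneg (Eventually.of_forall h0) h.1 Q
  have h2 : P.real {ω | Q ≤ X ω} ≤ C / Q := by
    rw [le_div_iff₀ hQ, mul_comm]; exact h1.trans h.2
  calc P {ω | Q < X ω} ≤ P {ω | Q ≤ X ω} := measure_mono fun ω (hω : Q < X ω) =>
        show Q ≤ X ω from hω.le
    _ = ENNReal.ofReal (P.real {ω | Q ≤ X ω}) := (ofReal_measureReal (measure_ne_top _ _)).symm
    _ ≤ _ := ENNReal.ofReal_le_ofReal h2

/-- The order of limits: `Q` is fixed large enough for `C / Q` to be small, and only then `n` grows.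
Thresholds in `n` may therefore depend on `Q`. -/
theorem tendsto_zero_of_forall_le {x : ℕ → ENNReal} {C Q₀ : ℝ}
    (h : ∀ Q, Q₀ ≤ Q → ∃ y : ℕ → ENNReal, Tendsto y atTop (𝓝 0) ∧
      ∀ᶠ n in atTop, x n ≤ ENNReal.ofReal (C / Q) + y n) : Tendsto x atTop (𝓝 0) := by
  rw [ENNReal.tendsto_nhds_zero]
  intro ε hε
  have hε2 : 0 < ε / 2 := ENNReal.half_pos hε.ne'
  have hlim : Tendsto (fun Q : ℝ => ENNReal.ofReal (C / Q)) atTop (𝓝 0) := by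
    have := ENNReal.tendsto_ofReal (tendsto_const_nhds.div_atTop tendsto_id :
      Tendsto (fun Q : ℝ => C / Q) atTop (𝓝 0))
    simpa using this
  obtain ⟨Q, hQ, hQ₀⟩ := ((ENNReal.tendsto_nhds_zero.1 hlim _ hε2).and
    (eventually_ge_atTop Q₀)).exists
  obtain ⟨y, hy, hxy⟩ := h Q hQ₀
  filter_upwards [hxy, ENNReal.tendsto_nhds_zero.1 hy _ hε2] with n h1 h2
  calc x n ≤ ENNReal.ofReal (C / Q) + y n := h1
    _ ≤ ε / 2 + ε / 2 := add_le_add hQ h2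
    _ = ε := ENNReal.add_halves ε

theorem eventually_mul_lt {α : Type*} {l : Filter α} {f : α → ℝ} (hf : Tendsto f l (𝓝 0)) (A : ℝ)
    {a : ℝ} (ha : 0 < a) : ∀ᶠ x in l, A * f x < a := by
  have := hf.const_mul A
  rw [mul_zero] at this
  exact this.eventually (Iio_mem_nhds ha)

/-! ### Nonnegativity, rates and the signal in real numbers -/

namespace Panel

variable {m K₀ : ℕ}

theorem nontrivial_space (D : Panel.{u} m K₀) (hm : 0 < m) : Nontrivial D.Space :=
  ⟨D.fvec ⟨0, hm⟩, 0, fun h => by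
    have := D.norm_fvec ⟨0, hm⟩
    rw [h, norm_zero] at this
    exact zero_ne_one this⟩

variable {D : Panel.{u} m K₀}

theorem spectralDev_nonneg (ω : D.Ω) : 0 ≤ D.spectralDev ω := by
  unfold spectralDev; positivity

theorem factorSize_nonneg (ω : D.Ω) : 0 ≤ D.factorSize ω :=
  mul_nonneg (by positivity) (Finset.sum_nonneg fun _ _ => factorRatio_nonneg _)

theorem errorSize_nonneg (hN : 0 < D.N) (hT : 0 < D.T) (ω : D.Ω) : 0 ≤ D.errorSize ω := by
  have hNT : (0 : ℝ) < D.N * D.T := by exact_mod_cast Nat.mul_pos hN hT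
  have p1 := norm_epsMat_sq hN hT ω
  have p2 := norm_epsMat_mul_Lam_sq hN hT ω
  have p3 := norm_facMat_transpose_mul_epsMat_sq hN hT ω
  exact add_nonneg (add_nonneg (nonneg_of_mul_nonneg_right (p1 ▸ sq_nonneg ‖D.epsMat ω‖) hNT)
    (nonneg_of_mul_nonneg_right (p2 ▸ sq_nonneg ‖D.epsMat ω * D.Lam‖) hNT))
    (nonneg_of_mul_nonneg_right (p3 ▸ sq_nonneg ‖(D.facMat ω).transpose * D.epsMat ω‖) hNT)

theorem CNT_sq_le (hK : 0 < K₀) : D.CNT ^ 2 ≤ D.N ∧ D.CNT ^ 2 ≤ D.T := by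
  have h0 : 0 ≤ D.CNT := le_min (Real.sqrt_nonneg _) (Real.sqrt_nonneg _)
  constructor
  · have h1 : D.CNT ≤ √(⨅ k : Fin K₀, ((D.group k).card : ℝ)) := min_le_left _ _
    have h2 : (⨅ k : Fin K₀, ((D.group k).card : ℝ)) ≤ D.N := by
      refine (ciInf_le (Set.finite_range _).bddBelow (⟨0, hK⟩ : Fin K₀)).trans ?_
      have := Finset.card_le_univ (D.group ⟨0, hK⟩)
      rw [Fintype.card_fin] at this
      exact_mod_cast this
    calc D.CNT ^ 2 ≤ √(D.N : ℝ) ^ 2 :=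
          pow_le_pow_left₀ h0 (h1.trans (Real.sqrt_le_sqrt h2)) 2
      _ = D.N := Real.sq_sqrt (Nat.cast_nonneg _)
  · calc D.CNT ^ 2 ≤ √(D.T : ℝ) ^ 2 := pow_le_pow_left₀ h0 (min_le_right _ _) 2
      _ = D.T := Real.sq_sqrt (Nat.cast_nonneg _)

theorem le_mul_Delta_of_zeta {L : Matrix (Fin D.N) (Fin m) ℝ} {v : Fin m → ℝ} {ω : D.Ω} {η x : ℝ}
    (hη : 0 ≤ η) (h : ENNReal.ofReal x ≤ ENNReal.ofReal η * D.zeta L v ω) (i j : Fin D.N)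
    (hij : D.grp i ≠ D.grp j) : x ≤ η * D.Delta L v ω i j := by
  have hz : D.zeta L v ω ≤ ENNReal.ofReal (D.Delta L v ω i j) :=
    iInf_le_of_le i (iInf_le_of_le j (iInf_le _ hij))
  have h1 := h.trans (mul_le_mul_right hz (ENNReal.ofReal η))
  rwa [← ENNReal.ofReal_mul hη,
    ENNReal.ofReal_le_ofReal_iff (mul_nonneg hη (D.Delta_nonneg L v ω i j))] at h1

theorem le_mul_Delta_sq_of_zeta {L : Matrix (Fin D.N) (Fin m) ℝ} {v : Fin m → ℝ} {ω : D.Ω}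
    {η x : ℝ} (hη : 0 ≤ η) (h : ENNReal.ofReal x ≤ ENNReal.ofReal η * D.zeta L v ω ^ 2)
    (i j : Fin D.N) (hij : D.grp i ≠ D.grp j) : x ≤ η * D.Delta L v ω i j ^ 2 := by
  have hz : D.zeta L v ω ≤ ENNReal.ofReal (D.Delta L v ω i j) :=
    iInf_le_of_le i (iInf_le_of_le j (iInf_le _ hij))
  have h1 := h.trans (mul_le_mul_right (pow_le_pow_left' hz 2) (ENNReal.ofReal η))
  rwa [← ENNReal.ofReal_pow (D.Delta_nonneg L v ω i j), ← ENNReal.ofReal_mul hη,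
    ENNReal.ofReal_le_ofReal_iff (mul_nonneg hη (sq_nonneg _))] at h1

/-- One matrix convergence serves twice: the diagonal bounds the size of the factors, and the
quadratic form bounds them below in every direction. -/
theorem facMat_bounds (hT : 0 < D.T) {S : Matrix (Fin m) (Fin m) ℝ} {c δ : ℝ} (hc : 0 ≤ c)
    (hδ : 0 ≤ δ) (hS : ∀ u : Fin m → ℝ, c * ∑ a, u a ^ 2 ≤ u ⬝ᵥ S.mulVec u) (hcδ : m * δ ≤ c / 2)
    {ω : D.Ω}
    (h : ∀ a b, |(D.T : ℝ)⁻¹ * ∑ t, D.f t ω a * D.f t ω b - S a b| ≤ δ) {Q : ℝ}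
    (hQ : 1 + ∑ a, (|S a a| + δ) ≤ Q) :
    ‖D.facMat ω‖ ≤ Q * √D.T ∧ LowerBound (√(c / 2) * √D.T) (D.facMat ω) := by
  have hT0 : (0 : ℝ) < D.T := by exact_mod_cast hT
  have hX : 0 ≤ ∑ a, (|S a a| + δ) := Finset.sum_nonneg fun a _ => by positivity
  have hQ1 : 1 ≤ Q := by linarith
  constructor
  · refine abs_le_of_sq_le_sq' ?_ (by positivity) |>.2
    have e : ‖D.facMat ω‖ ^ 2 = D.T * ∑ a, (D.T : ℝ)⁻¹ * ∑ t, D.f t ω a * D.f t ω a := by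
      rw [← Finset.mul_sum, mul_inv_cancel_left₀ hT0.ne', frob_sq, Finset.sum_comm]
      simp only [facMat, Matrix.of_apply, sq]
    rw [e, mul_pow, Real.sq_sqrt hT0.le, mul_comm]
    gcongr
    calc _ ≤ ∑ a, (|S a a| + δ) := Finset.sum_le_sum fun a _ => by
          have h1 := (abs_le.1 (h a a)).2
          have h2 := le_abs_self (S a a)
          linarith
      _ ≤ Q := by linarith
      _ ≤ Q ^ 2 := by nlinarith
  · refine lowerBound_of_gram hT0.le fun u => ?_
    have h1 := dotProduct_mulVec_ge_of_close
      (M := (D.T : ℝ)⁻¹ • ((D.facMat ω).transpose * D.facMat ω)) hδ hS (fun a b => by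
        simpa [Matrix.mul_apply, facMat] using h a b) hcδ u
    rw [dotProduct_gram, le_inv_mul_iff₀ hT0] at h1
    rw [Real.sq_sqrt (by positivity)]
    linarith

end Panel

end GroupedFactor

/-! ### Recovery with probability tending to one -/

namespace GroupedFactor

open scoped Matrix.Norms.Frobenius

/-- With probability tending to one, the true number of groups is selected and the clustering into
that number of groups recovers the true grouping. -/
theorem probTendsToOne_recovery {m K₀ Kbar : ℕ} (hm : 0 < m) (hK : K₀ ≤ Kbar)
    (D : ℕ → Panel.{u} m K₀)
    (hN : Tendsto (fun n => (D n).N) atTop atTop) (hT : Tendsto (fun n => (D n).T) atTop atTop)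
    (ρ : ℕ → ℝ)
    (Ltil : ∀ n, (D n).Ω → Matrix (Fin (D n).N) (Fin m) ℝ)
    (vhat : ∀ n, (D n).Ω → Fin m → ℝ)
    (G : ∀ n, (D n).Ω → ℕ → Finpartition (Finset.univ : Finset (Fin (D n).N)))
    (Khat : ∀ n, (D n).Ω → ℕ)
    (hout : ∀ᶠ n in atTop, ∀ ω,
      IsOutput Kbar (ρ n) ((D n).Y ω) (Ltil n ω) (vhat n ω) (G n ω) (Khat n ω))
    (h1 : EllipticalErrors D) (h2 : PervasiveLoadings D) (h3 : BoundedErrorSpectrum D)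
    (h4 : FactorSecondMoment D) (h5 : WeakErrorDependence D) (h6 : WeakFactorErrorDependence D)
    (h7a : GroupSizes D) (h7b : TuningRates D ρ Ltil vhat) :
    ProbTendsToOne D (fun n => {ω | Khat n ω = K₀ ∧ (G n ω K₀).part = (D n).trueCell}) := by
  obtain ⟨B₀, hB₀⟩ := h2.bounded
  obtain ⟨V, hV, -, -, hVlim⟩ := h2.limit
  obtain ⟨c₁, c₂, hc₁, hc₂, hspec⟩ := h3
  obtain ⟨S, hS, hSlim⟩ := h4
  obtain ⟨M, hM, hdep⟩ := h5
  obtain ⟨M', hM', hcross⟩ := h6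
  obtain ⟨τ, hτ, -, hτN⟩ := h7a
  obtain ⟨cV, hcV, hVq⟩ := exists_dotProduct_mulVec_ge hm hV
  obtain ⟨cS, hcS, hSq⟩ := exists_dotProduct_mulVec_ge hm hS
  have hm0 : (0 : ℝ) < m := by exact_mod_cast hm
  set B := max B₀ 0 with hB
  set γ := cV / 2 with hγd
  have hγ : 0 < γ := by positivity
  -- Chosen so that `m δ = cS / 2`, the tolerance of `facMat_bounds`.
  set δ := cS / (2 * m) with hδd
  have hδ : 0 < δ := by positivity
  set s := √(cS / 2) with hsd
  have hs : 0 < s := Real.sqrt_pos.2 (by positivity)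
  have hb : ∀ n, (D n).ScaleBounds c₁ c₂ B := fun n => (D n).scaleBounds hc₁ hc₂ (hspec n)
    (fun i => (hB₀ n i).trans (le_max_left _ _)) (le_max_right _ _)
  have hnt : ∀ n, Nontrivial (D n).Space := fun n => (D n).nontrivial_space hm
  choose ν hν hlaw using h1.law
  have hpol : ∀ n, Panel.PolarSample (D := D n) (ν n) := fun n =>
    ⟨hlaw n, h1.indep n, h1.pos n⟩
  have hsph : ∀ n, SphericalSample (D n).sph (D n).P := fun n => (hpol n).sphericalSample
  set C₁ := Panel.spectralConst m c₁ c₂ B with hC₁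
  set C₂ := M + m * B ^ 2 * M + M' with hC₂
  set C₃ := Panel.factorConst m c₂ M with hC₃
  have hC₁0 : 0 ≤ C₁ := by
    have := (ratioMoment_pos hc₂).le
    rw [hC₁, Panel.spectralConst]; positivity
  have hC₂0 : 0 ≤ C₂ := by positivity
  have hC₃0 : 0 ≤ C₃ := by
    have := (ratioMoment_pos (lt_min hc₂ one_pos)).le
    have := moment2_nonneg
    rw [hC₃, Panel.factorConst]; positivity
  have hVe : ∀ᶠ n in atTop, ∀ a : Fin m → ℝ,
      γ * (D n).N * ∑ b, a b ^ 2 ≤ ∑ i, (D n).Lam.mulVec a i ^ 2 := by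
    have hent : ∀ a b, ∀ᶠ n in atTop,
        |(((D n).N : ℝ)⁻¹ • ((D n).Lam.transpose * (D n).Lam)) a b - V a b| ≤ cV / (2 * m) := by
      intro a b
      have h := ((continuous_id.matrix_elem a b).tendsto V).comp hVlim
      have h' := Metric.tendsto_nhds.1 h (cV / (2 * m)) (by positivity)
      filter_upwards [h'] with n hn
      rw [Real.dist_eq] at hn
      exact hn.le
    filter_upwards [eventually_all.2 fun a => eventually_all.2 fun b => hent a b,
      hN.eventually_ge_atTop 1] with n hn hn1 a
    have hN0 : (0 : ℝ) < (D n).N := by exact_mod_cast hn1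
    have h := dotProduct_mulVec_ge_of_close (by positivity) hVq hn
      (le_of_eq (by field_simp)) a
    rw [dotProduct_gram, le_inv_mul_iff₀ hN0, ← hγd] at h
    linarith
  have hNr : Tendsto (fun n => ((D n).N : ℝ)) atTop atTop := tendsto_natCast_atTop_atTop.comp hN
  have hTr : Tendsto (fun n => ((D n).T : ℝ)) atTop atTop := tendsto_natCast_atTop_atTop.comp hT
  set r : ℕ → ℝ := fun n => 1 / ((D n).N : ℝ) + 1 / ((D n).T : ℝ) with hr
  have hr0 : Tendsto r atTop (𝓝 0) := by
    have := (tendsto_const_nhds (x := (1 : ℝ)).div_atTop hNr).add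
      (tendsto_const_nhds (x := (1 : ℝ)).div_atTop hTr)
    rwa [add_zero] at this
  have hsr : Tendsto (fun n => √(r n)) atTop (𝓝 0) := by
    have := (Real.continuous_sqrt.tendsto 0).comp hr0
    simpa [Function.comp_def] using this
  -- The two sample sizes are at least `CNT²`, so `r ≤ 2 / CNT²`. Since `ρ < 1` and `CNT · ρ` is
  -- large, `CNT ≥ 1`, so `CNT² ρ` is at least `CNT ρ` and is large as well.
  have hrρ : ∀ A a : ℝ, 0 ≤ A → 0 < a → ∀ᶠ n in atTop, A * r n < a * ρ n := by
    intro A a hA ha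
    filter_upwards [h7b.large.eventually_gt_atTop (2 * A / a + 1), hN.eventually_ge_atTop 1,
      hT.eventually_ge_atTop 1] with n hn hn1 hn2
    have hN0 : (0 : ℝ) < (D n).N := by exact_mod_cast hn1
    have hT0 : (0 : ℝ) < (D n).T := by exact_mod_cast hn2
    obtain ⟨hρ0, hρ1⟩ := h7b.range n
    obtain ⟨e1, e2⟩ := (D n).CNT_sq_le (Fin.pos ((D n).grp ⟨0, hn1⟩))
    set x := (D n).CNT with hx
    have hq : 0 ≤ 2 * A / a := by positivity
    have hx0 : 0 < x := pos_of_mul_pos_left (lt_trans (by linarith) hn) hρ0.le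
    have hx1 : 1 < x * ρ n := by linarith
    have hxx : 0 < x ^ 2 := by positivity
    have hr2 : r n ≤ 2 / x ^ 2 := by
      have a1 : 1 / ((D n).N : ℝ) ≤ 1 / x ^ 2 := one_div_le_one_div_of_le hxx e1
      have a2 : 1 / ((D n).T : ℝ) ≤ 1 / x ^ 2 := one_div_le_one_div_of_le hxx e2
      calc r n ≤ 1 / x ^ 2 + 1 / x ^ 2 := add_le_add a1 a2
        _ = _ := by ring
    have hA2 : 2 * A < a * (x * ρ n) := by
      have : 2 * A / a < x * ρ n := by linarith
      rw [div_lt_iff₀ ha] at this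
      linarith
    have hxge : 1 ≤ x := by nlinarith
    calc A * r n ≤ A * (2 / x ^ 2) := by gcongr
      _ = 2 * A / x ^ 2 := by ring
      _ < a * ρ n := by
        rw [div_lt_iff₀ hxx]
        have : a * (x * ρ n) ≤ a * ρ n * x ^ 2 := by
          have : 0 ≤ a * ρ n * x * (x - 1) := by
            have := sub_nonneg.2 hxge; positivity
          nlinarith
        linarith
  refine tendsto_zero_of_forall_le (C := C₁ + C₂ + C₃) (Q₀ := 1 + ∑ a, (|S a a| + δ)) fun Q hQ => ?_
  have hQ1 : 1 ≤ Q := by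
    have : 0 ≤ ∑ a, (|S a a| + δ) := Finset.sum_nonneg fun a _ => by positivity
    linarith
  have hQ0 : 0 < Q := by linarith
  have hκ : 0 < Panel.signalConst c₁ B γ := Panel.signalConst_pos (hb 0) hγ
  have hBq : 0 < Panel.eigenConst m c₁ c₂ B Q := by
    have := ratioMoment_pos hc₂
    have := (hb 0).B_nonneg
    unfold Panel.eigenConst; positivity
  have hrot : 0 < Panel.rotConst m c₁ c₂ B γ Q := by unfold Panel.rotConst; positivity
  set R := Panel.rotConst m c₁ c₂ B γ Q with hR
  set Φ := Panel.fitConst m c₁ c₂ B γ Q with hΦ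
  have hid : Tendsto (fun η : ℝ => η) (𝓝[>] 0) (𝓝 0) := nhdsWithin_le_nhds
  -- Given `Q`, the three conditions of `Regular.recovers` on `η` are each satisfied by every small
  -- positive number.
  obtain ⟨η, ⟨⟨hη1, hη2⟩, hη3⟩, hη⟩ := (((eventually_mul_lt hid
      (8 * Panel.loadConst m c₁ c₂ B γ Q) one_pos).and
    (eventually_mul_lt hid ((s ^ 2 / Q) ^ 2 * R ^ 2)
      (show 0 < τ * s ^ 2 / 16 by positivity))).and
    (eventually_mul_lt hid (K₀ * R ^ 2 * ((Φ ^ 2 + Φ) ^ 2 + Φ ^ 2 + τ * s ^ 2 / 32 * (4 * B ^ 2)))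
      (show 0 < τ * s ^ 2 / 32 by positivity))).and self_mem_nhdsWithin |>.exists
  have hη0 : 0 < η := hη
  refine ⟨fun n => ∑ a, ∑ b, (D n).P {ω | δ ≤
      |((D n).T : ℝ)⁻¹ * ∑ t, (D n).f t ω a * (D n).f t ω b - S a b|} +
    (D n).P {ω | ENNReal.ofReal η * (D n).zeta (Ltil n ω) (vhat n ω) ω <
      ENNReal.ofReal (max (Real.sqrt ((D n).N / (D n).T)) (((D n).N : ℝ) ^ (-(1 / 4) : ℝ)))} +
    (D n).P {ω | ENNReal.ofReal η * (D n).zeta (Ltil n ω) (vhat n ω) ω ^ 2 <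
      ENNReal.ofReal (ρ n)}, ?_, ?_⟩
  · have hF : Tendsto (fun n => ∑ a, ∑ b, (D n).P {ω | δ ≤
        |((D n).T : ℝ)⁻¹ * ∑ t, (D n).f t ω a * (D n).f t ω b - S a b|}) atTop (𝓝 0) := by
      have := tendsto_finsetSum Finset.univ fun a _ =>
        tendsto_finsetSum (Finset.univ : Finset (Fin m)) fun b _ => hSlim a b δ hδ
      simpa using this
    simpa using (hF.add (h7b.signal η hη0)).add (h7b.small η hη0)
  set Ψ := RegularFit.projConst Φ R s with hΨ
  filter_upwards [hout, hVe, hN.eventually_ge_atTop (max 9 K₀), hT.eventually_ge_atTop 2,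
    hTr.eventually_ge_atTop (Q / (Panel.signalConst c₁ B γ / 2) ^ 2),
    eventually_mul_lt hsr (Φ ^ 2) (show (0 : ℝ) < 1 / 2 by norm_num),
    eventually_mul_lt hsr (Φ * R + Φ ^ 2) (show 0 < s / (4 * R) by positivity),
    eventually_mul_lt hsr (Ψ + 2 * R * (Φ * R + Φ ^ 2) * Φ) (show 0 < s ^ 2 / Q / 2 by positivity),
    hrρ (Ψ ^ 2) ((s ^ 2 / Q) ^ 2 / 4) (sq_nonneg _) (by positivity)]
    with n hon hΛn hNn hTn hTκ e1 e2 e3 e4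
  have hN9 : 9 ≤ (D n).N := (le_max_left _ _).trans hNn
  have hKN : K₀ ≤ (D n).N := (le_max_right _ _).trans hNn
  have hTκ' : Q ≤ (D n).T * (Panel.signalConst c₁ B γ / 2) ^ 2 := by
    rwa [div_le_iff₀ (by positivity)] at hTκ
  obtain ⟨⟨hi, -⟩, hi2, σ, hσ, hσd, hσs⟩ := hdep n
  have m1 := (Panel.integral_spectralDev_le (hb n) (hsph n) hTn hN9).measure_gt_le
    Panel.spectralDev_nonneg hQ0
  have m2 := (Panel.errorSize_meanLE (hb n) (by omega) hi2 hσ hσd hσs (hcross n)).measure_gt_le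
    (Panel.errorSize_nonneg (by omega) (by omega)) hQ0
  have m3 := (Panel.factorSize_meanLE (hb n) hN9 (by omega) (hpol n) hM.le
    (fun i t => hi i t t) (fun i => by rw [hσ]; exact hσd i)).measure_gt_le
    Panel.factorSize_nonneg hQ0
  have m4 : (D n).P {ω | ¬ ∀ t, 0 < quadForm (D n).evec ((D n).sph t ω)} = 0 :=
    Panel.ae_quadForm_evec_pos (hb n) (by omega) (hpol n)
  -- Failure of recovery forces a size above `Q`, a vanishing error vector, a bad factor second
  -- moment, or a signal too weak. Markov's inequality handles the sizes, the second event is null,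
  -- and the rest tend to zero by assumption.
  have hsub : {ω | Khat n ω = K₀ ∧ (G n ω K₀).part = (D n).trueCell}ᶜ ⊆
      ({ω | Q < (D n).spectralDev ω} ∪ {ω | Q < (D n).errorSize ω} ∪ {ω | Q < (D n).factorSize ω} ∪
        {ω | ¬ ∀ t, 0 < quadForm (D n).evec ((D n).sph t ω)}) ∪
      ((⋃ a, ⋃ b, {ω | δ ≤
        |((D n).T : ℝ)⁻¹ * ∑ t, (D n).f t ω a * (D n).f t ω b - S a b|}) ∪
      {ω | ENNReal.ofReal η * (D n).zeta (Ltil n ω) (vhat n ω) ω <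
        ENNReal.ofReal (max (Real.sqrt ((D n).N / (D n).T)) (((D n).N : ℝ) ^ (-(1 / 4) : ℝ)))} ∪
      {ω | ENNReal.ofReal η * (D n).zeta (Ltil n ω) (vhat n ω) ω ^ 2 < ENNReal.ofReal (ρ n)}) := by
    intro ω hω
    by_contra hcon
    simp only [Set.mem_union, Set.mem_iUnion, Set.mem_ofPred_eq, not_or, not_exists, not_lt,
      not_not, not_le] at hcon
    obtain ⟨⟨⟨⟨g1, g2⟩, g3⟩, g4⟩, ⟨g5, g6⟩, g7⟩ := hcon
    obtain ⟨f1, f2⟩ := Panel.facMat_bounds (D := D n) (by omega) hcS.le hδ.le hSq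
      (le_of_eq (by rw [hδd]; field_simp)) (fun a b => (g5 a b).le) hQ
    have hreg : (D n).Regular Q s ω := ⟨g1, g2, g3, g4, f1, f2⟩
    refine hω (hreg.recovers hm (hb n) (hsph n) hTn hN9 hKN hγ hΛn hτ (hτN n) hQ1 hs hTκ'
      (r := r n) (le_add_of_nonneg_right (by positivity)) (le_add_of_nonneg_left (by positivity))
      e1.le e2.le e3.le (h7b.range n).1 e4 hη1 hη0 ?_ ?_ hK (hon ω)
      (Panel.le_mul_Delta_of_zeta hη0.le g6) (Panel.le_mul_Delta_sq_of_zeta hη0.le g7))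
    · refine le_trans (le_of_eq ?_) hη2.le
      ring
    · refine lt_of_le_of_lt (le_of_eq ?_) hη3
      ring
  refine (measure_mono hsub).trans ((measure_union_le _ _).trans (add_le_add ?_ ?_))
  · refine (measure_union_le _ _).trans ?_
    rw [m4, add_zero]
    refine (measure_union_le _ _).trans ((add_le_add ((measure_union_le _ _).trans
      (add_le_add m1 m2)) m3).trans_eq ?_)
    rw [← ENNReal.ofReal_add (by positivity) (by positivity),
      ← ENNReal.ofReal_add (by positivity) (by positivity), ← add_div, ← add_div]
  · refine (measure_union_le _ _).trans (add_le_add ((measure_union_le _ _).trans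
      (add_le_add ?_ le_rfl)) le_rfl)
    exact (measure_iUnion_fintype_le _ _).trans (Finset.sum_le_sum fun a _ =>
      measure_iUnion_fintype_le _ _)

end GroupedFactor

end

open GroupedFactor in
theorem theorem3 {m K₀ Kbar : ℕ} (hm : 0 < m) (hK : K₀ ≤ Kbar)
    (D : ℕ → Panel.{u} m K₀)
    (hN : Tendsto (fun n => (D n).N) atTop atTop) (hT : Tendsto (fun n => (D n).T) atTop atTop)
    (ρ : ℕ → ℝ)
    (Ltil : ∀ n, (D n).Ω → Matrix (Fin (D n).N) (Fin m) ℝ)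
    (vhat : ∀ n, (D n).Ω → Fin m → ℝ)
    (G : ∀ n, (D n).Ω → ℕ → Finpartition (Finset.univ : Finset (Fin (D n).N)))
    (Khat : ∀ n, (D n).Ω → ℕ)
    (hout : ∀ᶠ n in atTop, ∀ ω,
      IsOutput Kbar (ρ n) ((D n).Y ω) (Ltil n ω) (vhat n ω) (G n ω) (Khat n ω))
    (h1 : EllipticalErrors D) (h2 : PervasiveLoadings D) (h3 : BoundedErrorSpectrum D)
    (h4 : FactorSecondMoment D) (h5 : WeakErrorDependence D) (h6 : WeakFactorErrorDependence D)
    (h7a : GroupSizes D) (h7b : TuningRates D ρ Ltil vhat) :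
    ProbTendsToOne D (fun n => {ω | Khat n ω = K₀}) ∧
    ProbTendsToOne D (fun n => {ω |
      groupedLoading ((D n).Y ω) (Ltil n ω) (G n ω (Khat n ω)).part =
        groupedLoading ((D n).Y ω) (Ltil n ω) (D n).trueCell}) := by
  have h := probTendsToOne_recovery hm hK D hN hT ρ Ltil vhat G Khat hout h1 h2 h3 h4 h5 h6 h7a h7b
  constructor
  -- Both claims hold on the recovery event; there the estimator and the oracle use the same cells
  -- and so coincide.
  · exact tendsto_of_tendsto_of_tendsto_of_le_of_le tendsto_const_nhds h (fun _ => zero_le)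
      fun n => measure_mono (Set.compl_subset_compl.2 fun ω hω => hω.1)
  · refine tendsto_of_tendsto_of_tendsto_of_le_of_le tendsto_const_nhds h (fun _ => zero_le)
      fun n => measure_mono (Set.compl_subset_compl.2 fun ω hω => ?_)
    simp only [Set.mem_ofPred_eq] at hω ⊢
    rw [hω.1, hω.2]
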